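/- Let $d\ge 2$, let $\mathsf g(x)=-\log|x|$ if $d=2$ and $\mathsf g(x)=|x|^{2-d}$ if $d\ge 3$, and let $\mathsf c_d$ be the constant with $-\Delta \mathsf g=\mathsf c_d\delta_0$. Let $N\ge 1$, $\beta>0$, and let $\theta>2$ be such that $\beta N^{2/d}\ge\theta$. Let $V_1\in C^2(\mathbb R^d)$ satisfy $V_1(x)+\mathsf g(x)\to+\infty$ as $|x|\to\infty$ and $$\int_{|x|\ge 1}e^{-\frac\theta2(V_1(x)-\log|x|)}dx+\int_{|x|\ge1}e^{-\theta(V_1(x)-\log|x|)}|x|\log^2|x|\,dx<\infty\ \ (d=2),\qquad \int_{|x|\ge 1}e^{-\frac\theta2V_1(x)}dx<\infty\ \ (d\ge3).$$ Put $V(x)=N^{2/d}V_1(N^{-1/d}x)$ and consider the Coulomb gas, i.e. the probability measure on $(\mathbb R^d)^N$ proportional to $e^{-\beta \mathsf H(x_1,\dots,x_N)}dx_1\cdots dx_N$, where $\mathsf H=\frac12\sum_{i\ne j}\mathsf g(x_i-x_j)+\sum_iV(x_i)$. For $0\le k\le N$ let $\rho_k$ be the Lebesgue density of $\frac{N!}{(N-k)!}$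 times its $k$-particle marginal ($\rho_0=1$), in the version given by integrating out $N-k$ particles from the Gibbs density (with $e^{-\beta\mathsf H}=0$ when two points coincide), and let $\rho_1(x\,|\,y_2,\dots,y_k)=\rho_k(x,y_2,\dots,y_k)/\rho_{k-1}(y_2,\dots,y_k)$. Let $\mu_{\infty,1}$ be the equilibrium measure of $V_1$: the probability measure for which there is a constant $c_{\infty,1}$ such that $\zeta_1=\int \mathsf g(\cdot-y)\mu_{\infty,1}(dy)+V_1-c_{\infty,1}$ is finite everywhere, $\zeta_1\ge0$, and $\zeta_1=0$ on $\operatorname{supp}\mu_{\infty,1}$ outside a set of capacity zero. Put $\zeta(x)=N^{2/d}\zeta_1(N^{-1/d}x)$, $\mu_\infty(A)=N\mu_{\infty,1}(N^{-1/d}A)$ and $\Sigma=\operatorname{supp}\mu_\infty$. A regular domain is a bounded open set $\omega\subset\mathbb R^d$ in which the Dirichlet problem for $\Delta$ is solvable for all continuous boundary values, and whose harmonic measures $\mathrm{harm}_\omega(x,\cdot)$, $x\in\omega$, exist and are absolutely continuous with respect to $(d-1)$-dimensional Hausdorff measure on $\partial\omega$; for $x\notin\omega$ put $\mathrm{harm}_\omega(x,\cdot)=\delta_x$.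 For a signed measure $\nu$ put $h^\nu_\omega(x)=\int_\omega \mathsf g_\omega(x,y)\,\nu(dy)$ for $x\in\omega$, where $\mathsf c_d^{-1}\mathsf g_\omega$ is the Dirichlet Green's function of $-\Delta$ in $\omega$, and $h^\nu_\omega(x)=0$ for $x\notin\omega$. Then: (1) In the sense of distributions on $\mathbb R^d$, $$-\Delta\big(e^{\beta\zeta}\rho_1\big)\le\beta\,\mathsf c_d\,e^{\beta\zeta}\rho_1\,\mu_\infty ,$$ and $e^{\beta\zeta}\rho_1$ is subharmonic (upper semicontinuous with the sub-mean value property) on $\mathbb R^d\setminus\Sigma$. (2) For every $1\le k\le N$ and almost every $(y_2,\dots,y_k)$ with respect to the $(k-1)$-particle marginal of the gas (no condition if $k=1$), the function $\tilde\rho_1(x)=\rho_1(x\,|\,y_2,\dots,y_k)$ satisfies (1) in place of $\rho_1$ and, for every regular domain $\omega$ and every $x\in\mathbb R^d$, $$e^{\beta\zeta(x)}\tilde\rho_1(x)\le\exp\Big(\beta\,h_\omega^{\mu_\infty-\sum_{i=2}^k\delta_{y_i}}(x)\Big)\int e^{\beta\zeta(z)}\tilde\rho_1(z)\,\mathrm{harm}_\omega(x,dz),$$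 $$\tilde\rho_1(x)\le\exp\Big(\beta\,h_\omega^{\mathsf c_d^{-1}\Delta V-\sum_{i=2}^k\delta_{y_i}}(x)\Big)\int\tilde\rho_1(z)\,\mathrm{harm}_\omega(x,dz).$$ (At $x\in\{y_2,\dots,y_k\}$ both left-hand sides are zero.) -/

import Mathlib

open MeasureTheory Filter Topology
open scoped ENNReal ContDiff

namespace CoulombGas

noncomputable section

/-- Euclidean space of dimension `d`. -/
abbrev Space (d : ℕ) : Type := EuclideanSpace ℝ (Fin d)

/-! ### Coulomb kernel and potentials -/

/-- The Coulomb kernel `g`: `-log |x|` if `d = 2`, and `|x|^(2-d)` if `d ≥ 3`.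
The value at `x = 0` is irrelevant: wherever `g 0 = +∞` matters it is dealt with explicitly. -/
def coulomb {d : ℕ} (x : Space d) : ℝ :=
  if d = 2 then -Real.log ‖x‖ else (‖x‖ ^ (d - 2))⁻¹

/-- The positive part of the Coulomb kernel, with its true value `+∞` at the origin. -/
def coulombPos {d : ℕ} (x : Space d) : ℝ≥0∞ :=
  if x = 0 then ⊤ else ENNReal.ofReal (coulomb x)

/-- The constant `c_d` with `-Δ g = c_d δ₀`, i.e. `2π` if `d = 2` and `(d-2) |S^{d-1}|` if `d ≥ 3`,
where `|S^{d-1}| = d |B₁|`. -/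
def coulombConst (d : ℕ) : ℝ :=
  (if d = 2 then 1 else (d : ℝ) - 2) * (d * (volume (Metric.ball (0 : Space d) 1)).toReal)

/-- The electric potential `h^μ(x) = ∫ g(x-y) μ(dy)`. -/
def potential {d : ℕ} (μ : Measure (Space d)) (x : Space d) : ℝ :=
  ∫ y, coulomb (x - y) ∂μ

/-- The potential of `μ` is well defined and finite at every point. -/
def HasFinitePotential {d : ℕ} (μ : Measure (Space d)) : Prop :=
  ∀ x, (∫⁻ y, coulombPos (x - y) ∂μ) ≠ ⊤ ∧ Integrable (fun y => coulomb (x - y)) μ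

/-- `A` has capacity zero: it is not charged by any compactly supported finite measure of finite
Coulomb energy (on compact sets the negative part of the kernel is bounded, so finiteness of the
energy concerns the positive part only). -/
def CapacityZero {d : ℕ} (A : Set (Space d)) : Prop :=
  ∀ ν : Measure (Space d), IsFiniteMeasure ν → (∃ K, IsCompact K ∧ ν Kᶜ = 0) →
    (∫⁻ x, ∫⁻ y, coulombPos (x - y) ∂ν ∂ν) ≠ ⊤ → ν A = 0

/-! ### Confining potential, equilibrium measure, droplet -/

/-- The standing assumptions on the confining potential: `V₁ ∈ C²`, `V₁ + g → +∞` at infinity,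
and the integrability conditions at inverse temperature parameter `θ`. -/
structure AdmissiblePotential {d : ℕ} (V₁ : Space d → ℝ) (θ : ℝ) : Prop where
  contDiff : ContDiff ℝ 2 V₁
  growth : Tendsto (fun x => V₁ x + coulomb x) (cocompact (Space d)) atTop
  integrable_two : d = 2 →
    IntegrableOn (fun x => Real.exp (-(θ / 2) * (V₁ x - Real.log ‖x‖))) {x | 1 ≤ ‖x‖} ∧
    IntegrableOn (fun x => Real.exp (-θ * (V₁ x - Real.log ‖x‖)) * (‖x‖ * Real.log ‖x‖ ^ 2))
      {x | 1 ≤ ‖x‖}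
  integrable_ge : 3 ≤ d → IntegrableOn (fun x => Real.exp (-(θ / 2) * V₁ x)) {x | 1 ≤ ‖x‖}

/-- `ζ₁ = h^{μ₁} + V₁ - c₁`. -/
def effPotentialOne {d : ℕ} (V₁ : Space d → ℝ) (μ₁ : Measure (Space d)) (c₁ : ℝ)
    (x : Space d) : ℝ :=
  potential μ₁ x + V₁ x - c₁

/-- `μ₁` is the equilibrium (probability) measure associated with `V₁`, with constant `c₁`:
`ζ₁ = h^{μ₁} + V₁ - c₁` is a finite function which is nonnegative everywhere and vanishes on the
support of `μ₁` outside a set of capacity zero. -/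
structure IsEquilibriumMeasure {d : ℕ} (V₁ : Space d → ℝ) (μ₁ : Measure (Space d)) (c₁ : ℝ) :
    Prop where
  isProbabilityMeasure : IsProbabilityMeasure μ₁
  hasFinitePotential : HasFinitePotential μ₁
  nonneg : ∀ x, 0 ≤ effPotentialOne V₁ μ₁ c₁ x
  eq_zero_qe : CapacityZero {x | x ∈ μ₁.support ∧ effPotentialOne V₁ μ₁ c₁ x ≠ 0}

/-- `V = V_N = N^{2/d} V₁(N^{-1/d} ·)`; the same rescaling turns `ζ₁` into `ζ`. -/
def rescale {d : ℕ} (N : ℕ) (f : Space d → ℝ) (x : Space d) : ℝ :=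
  (N : ℝ) ^ ((2 : ℝ) / d) * f (((N : ℝ) ^ ((1 : ℝ) / d))⁻¹ • x)

/-- The rescaled equilibrium measure `μ_∞(A) = N μ₁(N^{-1/d} A)`, of total mass `N`.
The droplet is its support. -/
def rescaleMeasure {d : ℕ} (N : ℕ) (μ₁ : Measure (Space d)) : Measure (Space d) :=
  (N : ℝ≥0∞) • μ₁.map (fun x => (N : ℝ) ^ ((1 : ℝ) / d) • x)

/-- The effective confining potential `ζ = ζ_N`. -/
def effPotential {d : ℕ} (N : ℕ) (V₁ : Space d → ℝ) (μ₁ : Measure (Space d)) (c₁ : ℝ) :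
    Space d → ℝ :=
  rescale N (effPotentialOne V₁ μ₁ c₁)

/-! ### The Coulomb gas and its correlation functions -/

/-- The Coulomb energy `½ ∑_{i ≠ j} g(x_i - x_j) + ∑_i V(x_i)` of a configuration of distinct
points. -/
def energy {d N : ℕ} (V : Space d → ℝ) (X : Fin N → Space d) : ℝ :=
  (1 / 2) * ∑ i, ∑ j ∈ Finset.univ.erase i, coulomb (X i - X j) + ∑ i, V (X i)

open scoped Classical in
/-- The Boltzmann factor `e^{-β H(X)}`; it is zero if two points coincide, as `g 0 = +∞`. -/
def boltzmann {d N : ℕ} (β : ℝ) (V : Space d → ℝ) (X : Fin N → Space d) : ℝ≥0∞ :=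
  if Function.Injective X then ENNReal.ofReal (Real.exp (-β * energy V X)) else 0

/-- The partition function. -/
def partitionFunction {d : ℕ} (N : ℕ) (β : ℝ) (V : Space d → ℝ) : ℝ≥0∞ :=
  ∫⁻ X : Fin N → Space d, boltzmann β V X

/-- The Gibbs measure of the Coulomb gas with `N` particles. -/
def gibbs {d : ℕ} (N : ℕ) (β : ℝ) (V : Space d → ℝ) : Measure (Fin N → Space d) :=
  (partitionFunction N β V)⁻¹ • (volume : Measure (Fin N → Space d)).withDensity (boltzmann β V)

/-- The `k`-particle marginal of the Coulomb gas: the law of the first `k` particles. -/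
def marginal {d : ℕ} (N : ℕ) (β : ℝ) (V : Space d → ℝ) {k : ℕ} (hk : k ≤ N) :
    Measure (Fin k → Space d) :=
  (gibbs N β V).map (fun X i => X (Fin.castLE hk i))

/-- The configuration of `N` points with first `k` points `y` and remaining points `w`. -/
def joinConfig {d N k : ℕ} (y : Fin k → Space d) (w : Fin (N - k) → Space d) :
    Fin N → Space d :=
  fun i => if h : (i : ℕ) < k then y ⟨i, h⟩ else w ⟨i - k, by have := i.isLt; omega⟩

/-- The Lebesgue density `ρ_k` of the `k`-point correlation measure, `k ≤ N`, i.e. of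
`N! / (N-k)!` times the `k`-particle marginal, obtained by integrating out `N - k` particles. -/
def corr {d : ℕ} (N : ℕ) (β : ℝ) (V : Space d → ℝ) {k : ℕ} (y : Fin k → Space d) : ℝ≥0∞ :=
  (N.descFactorial k : ℝ≥0∞) *
    (∫⁻ w : Fin (N - k) → Space d, boltzmann β V (joinConfig y w)) / partitionFunction N β V

/-- The one-point function `ρ₁`. -/
def onePoint {d : ℕ} (N : ℕ) (β : ℝ) (V : Space d → ℝ) (x : Space d) : ℝ≥0∞ :=
  corr N β V (fun _ : Fin 1 => x)

/-- The conditional one-point function `ρ₁(x | y) = ρ_{m+1}(x, y) / ρ_m(y)` given `m` other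
particles at `y = (y₁, …, y_m)`. -/
def condOnePoint {d : ℕ} (N : ℕ) (β : ℝ) (V : Space d → ℝ) {m : ℕ} (y : Fin m → Space d)
    (x : Space d) : ℝ≥0∞ :=
  corr N β V (Fin.cons x y : Fin (m + 1) → Space d) / corr N β V y

/-! ### Dirichlet problem, harmonic measure, Green's function -/

/-- `u` solves `Δ u = 0` in `Ω`, `u = f` on `∂Ω`, and is continuous on the closure of `Ω`. -/
structure IsDirichletSolution {d : ℕ} (Ω : Set (Space d)) (f u : Space d → ℝ) : Prop where
  harmonic : InnerProductSpace.HarmonicOnNhd u Ω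
  continuousOn : ContinuousOn u (closure Ω)
  boundary : ∀ z ∈ frontier Ω, u z = f z

open scoped Classical in
/-- The solution (unique on the closure of a bounded open `Ω`) of the Dirichlet problem. -/
def dirichletSolution {d : ℕ} (Ω : Set (Space d)) (f : Space d → ℝ) : Space d → ℝ :=
  if h : ∃ u, IsDirichletSolution Ω f u then h.choose else 0

/-- `m` is harmonic measure of `Ω` seen from `x ∈ Ω`: a probability measure on `∂Ω` which
represents the value at `x` of the solution of the Dirichlet problem. -/
structure IsHarmonicMeasureAt {d : ℕ} (Ω : Set (Space d)) (x : Space d)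
    (m : Measure (Space d)) : Prop where
  isProbabilityMeasure : IsProbabilityMeasure m
  frontier_compl : m (frontier Ω)ᶜ = 0
  represents : ∀ f u, IsDirichletSolution Ω f u → u x = ∫ z, f z ∂m

/-- Regular domains: bounded open sets in which the Dirichlet problem is solvable for every
continuous boundary value, with harmonic measures that are absolutely continuous with respect to
`(d-1)`-dimensional Hausdorff measure on the boundary. -/
structure IsRegularDomain {d : ℕ} (Ω : Set (Space d)) : Prop where
  isOpen : IsOpen Ω
  isBounded : Bornology.IsBounded Ω
  solvable : ∀ f, ContinuousOn f (frontier Ω) → ∃ u, IsDirichletSolution Ω f u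
  exists_harmonicMeasure : ∀ x ∈ Ω, ∃ m, IsHarmonicMeasureAt Ω x m ∧
    m ≪ (Measure.hausdorffMeasure ((d : ℝ) - 1)).restrict (frontier Ω)

open scoped Classical in
/-- Harmonic measure `harm_Ω(x, ·)`; by convention it is the Dirac mass at `x` if `x ∉ Ω`. -/
def harmonicMeasure {d : ℕ} (Ω : Set (Space d)) (x : Space d) : Measure (Space d) :=
  if x ∈ Ω then
    if h : ∃ m, IsHarmonicMeasureAt Ω x m then h.choose else 0
  else Measure.dirac x

/-- `g_Ω(x, y)` for `x, y ∈ Ω`, i.e. `c_d` times the Dirichlet Green's function of `-Δ` in `Ω`: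
`g(x - y)` minus the harmonic function of `x` with the same boundary values. -/
def green {d : ℕ} (Ω : Set (Space d)) (x y : Space d) : ℝ :=
  coulomb (x - y) - dirichletSolution Ω (fun z => coulomb (z - y)) x

open scoped Classical in
/-- The Dirichlet electrostatic potential `h_Ω^ν(x) = ∫_Ω g_Ω(x, y) ν(dy)` of the signed measure
`ν(dy) = f(y) μ(dy)`; it vanishes outside `Ω`. -/
def dirichletPotential {d : ℕ} (Ω : Set (Space d)) (μ : Measure (Space d)) (f : Space d → ℝ)
    (x : Space d) : ℝ :=
  if x ∈ Ω then ∫ y in Ω, green Ω x y * f y ∂μ else 0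

/-- The Dirichlet electrostatic potential in `Ω` of the point charges `∑_i δ_{y_i}`. -/
def dirichletPotentialPoints {d m : ℕ} (Ω : Set (Space d)) (y : Fin m → Space d)
    (x : Space d) : ℝ :=
  ∑ i, dirichletPotential Ω (Measure.dirac (y i)) 1 x

/-! ### Subharmonicity -/

/-- `-Δ f ≤ w μ` in the sense of distributions. -/
def NegLaplacianLE {d : ℕ} (f w : Space d → ℝ) (μ : Measure (Space d)) : Prop :=
  LocallyIntegrable f ∧ LocallyIntegrable w μ ∧
    ∀ φ : Space d → ℝ, ContDiff ℝ ∞ φ → HasCompactSupport φ → (∀ x, 0 ≤ φ x) →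
      -∫ x, f x * Laplacian.laplacian φ x ≤ ∫ x, φ x * w x ∂μ

/-- `f` is a (finite) subharmonic function on the open set `U`: it is upper semicontinuous and
satisfies the sub-mean value inequality on every closed ball in `U`. -/
def SubharmonicOn {d : ℕ} (f : Space d → ℝ) (U : Set (Space d)) : Prop :=
  IsOpen U ∧ UpperSemicontinuousOn f U ∧
    ∀ x r, 0 < r → Metric.closedBall x r ⊆ U →
      IntegrableOn f (Metric.ball x r) ∧ f x ≤ ⨍ z in Metric.ball x r, f z

end

end CoulombGas

open CoulombGas

/-! Freeze all particles but one. As a function of the position x of the free particle, the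
Boltzmann weight is a constant times exp(-β V(x)) times the product of exp(-β g(x - q)) over the
frozen positions q (`boltzmann_joinConfig_cons`). Since ζ = h^μ + V - c, multiplying by exp(β ζ)
leaves exp(β (h^μ - ∑ g(· - q))) up to a constant. Let m be a probability measure that averages
every kernel g(· - w) to at most g(x - w). Jensen's inequality for exp bounds the value at x by
exp(β (h^μ(x) - ∫ h^μ dm)) times the m-average. This prefactor does not see the frozen particles, so
the bound survives integration over them and multiplication by a normalizing constant
(`IsSuperAveraging.exp_mul_prod_le`, `exp_mul_insertionWeight_le`, `IsInsertionDensity.exp_mul_le`).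

Two choices of m give the two kinds of conclusions. For m uniform on a ball of radius r, the
exponent is β times the μ-integral of the mean value defect of g, which is nonnegative, lives in |z|
≤ r and, divided by r², tends to a multiple of δ₀. Letting r → 0 gives the distributional inequality
(`negLaplacianLE_of_le_ballAvg`); on balls that avoid the support the prefactor is 1, which is the
sub-mean value property. For m a harmonic measure, the conditioning charges inside the domain are
kept in the exponent and averaged exactly, which produces their Green's functions. A Riesz
decomposition (`IsRegularCharge.integral_green`) turns h^μ(x) - ∫ h^μ dm into the Dirichlet
potential of μ. The bound without ζ is the same argument with -V in the exponent, decomposed by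
`dirichletPotential_laplacian`.

Singularities are handled by replacing |x| in the kernel by √(|x|² + ε²), which gives a smooth,
strictly superharmonic function increasing to g as ε decreases. It is super-averaged by balls
because the radial derivative of a ball average is a weighted integral of the Laplacian, and by
harmonic measure because of the minimum principle.

Continuity of h^μ is also needed. The equilibrium measure has compact support because ζ₁ is positive
near infinity; lower semicontinuity makes ζ₁ vanish on the whole support; there the potential equals
c₁ - V₁, and the Evans–Vasilesco principle (`IsCharge.isRegularCharge_of_continuousOn_support`)
extends continuity to the whole space. Finally, Jensen on unit balls dominates the weights locally
uniformly, so the densities themselves are continuous (`continuous_insertionWeight`). -/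

namespace CoulombGas
open Laplacian

/-! ### The Laplacian in coordinates -/

/-- Coordinate vectors. -/
noncomputable abbrev coordVec {d : ℕ} (i : Fin d) : Space d := EuclideanSpace.single i (1 : ℝ)

/-- Partial derivatives. -/
noncomputable def partialDeriv {d : ℕ} (i : Fin d) (f : Space d → ℝ) (x : Space d) : ℝ :=
  fderiv ℝ f x (coordVec i)

theorem laplacian_eq_sum_partialDeriv {d : ℕ} {f : Space d → ℝ} {x : Space d}
    (hf : ContDiffAt ℝ 2 f x) :
    Laplacian.laplacian f x = ∑ i, partialDeriv i (partialDeriv i f) x := by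
  rw [InnerProductSpace.laplacian_eq_iteratedFDeriv_orthonormalBasis f
    (EuclideanSpace.basisFun (Fin d) ℝ)]
  refine Finset.sum_congr rfl fun i _ => ?_
  rw [iteratedFDeriv_two_apply]
  have h1 : DifferentiableAt ℝ (fderiv ℝ f) x :=
    (hf.fderiv_right (m := 1) (by norm_num)).differentiableAt (by norm_num)
  unfold partialDeriv
  rw [fderiv_clm_apply h1 (differentiableAt_const _)]
  simp

theorem contDiff_partialDeriv {d : ℕ} {f : Space d → ℝ} {n m : WithTop ℕ∞} (hf : ContDiff ℝ n f)
    (hmn : m + 1 ≤ n) (i : Fin d) : ContDiff ℝ m (partialDeriv i f) :=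
  (hf.fderiv_right hmn).clm_apply contDiff_const

theorem continuous_laplacian {d : ℕ} {f : Space d → ℝ} (hf : ContDiff ℝ 2 f) :
    Continuous (Laplacian.laplacian f) := by
  have : Laplacian.laplacian f = fun x => ∑ i, partialDeriv i (partialDeriv i f) x := by
    ext x; exact laplacian_eq_sum_partialDeriv hf.contDiffAt
  rw [this]
  refine continuous_finsetSum _ fun i _ => ?_
  exact (contDiff_partialDeriv (n := 1) (m := 0)
    (contDiff_partialDeriv hf (by norm_num) i) (by norm_num) i).continuous

theorem hasCompactSupport_partialDeriv {d : ℕ} {f : Space d → ℝ} (hf : HasCompactSupport f)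
    (i : Fin d) : HasCompactSupport (partialDeriv i f) :=
  hf.fderiv_apply (𝕜 := ℝ) (coordVec i)

theorem laplacian_eq_zero_of_notMem_tsupport {d : ℕ} {f : Space d → ℝ} {x : Space d}
    (hx : x ∉ tsupport f) : Laplacian.laplacian f x = 0 := by
  have h : f =ᶠ[𝓝 x] fun _ => (0 : ℝ) := notMem_tsupport_iff_eventuallyEq.1 hx
  have := (InnerProductSpace.laplacian_congr_nhds h).eq_of_nhds
  rw [this, InnerProductSpace.laplacian_const]; rfl

theorem hasCompactSupport_laplacian {d : ℕ} {f : Space d → ℝ} (hf : HasCompactSupport f) :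
    HasCompactSupport (Laplacian.laplacian f) :=
  HasCompactSupport.intro hf fun _ hx => laplacian_eq_zero_of_notMem_tsupport hx

theorem laplacian_comp_const_sub {d : ℕ} {f : Space d → ℝ} (hf : ContDiff ℝ 2 f) (a x : Space d) :
    Laplacian.laplacian (fun z => f (a - z)) x = Laplacian.laplacian f (a - x) := by
  have hc : ContDiff ℝ 2 (fun z => f (a - z)) := hf.comp (contDiff_const.sub contDiff_id)
  rw [laplacian_eq_sum_partialDeriv hc.contDiffAt, laplacian_eq_sum_partialDeriv hf.contDiffAt]
  refine Finset.sum_congr rfl fun i _ => ?_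
  have key : ∀ (h : Space d → ℝ), Differentiable ℝ h → partialDeriv i (fun z => h (a - z)) =
      fun z => - partialDeriv i h (a - z) := by
    intro h hh; ext z
    simp only [partialDeriv]
    have := (hh (a - z)).hasFDerivAt.comp z ((hasFDerivAt_id z).const_sub a)
    rw [HasFDerivAt.fderiv (f := fun z => h (a - z)) this]; simp
  rw [key f (hf.differentiable (by norm_num))]
  have : partialDeriv i (fun z => - partialDeriv i f (a - z)) =
      fun z => - partialDeriv i (fun z => partialDeriv i f (a - z)) z := by
    ext z
    simp only [partialDeriv]
    rw [fderiv_fun_neg]; simp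
  rw [this, key _ ((contDiff_partialDeriv (m := 1) hf (by norm_num) i).differentiable
    (by norm_num))]; simp

theorem laplacian_comp_sub_const {d : ℕ} {f : Space d → ℝ} (hf : ContDiff ℝ 2 f) (a x : Space d) :
    Laplacian.laplacian (fun z => f (z - a)) x = Laplacian.laplacian f (x - a) := by
  have hc : ContDiff ℝ 2 (fun z => f (z - a)) := hf.comp (contDiff_id.sub contDiff_const)
  rw [laplacian_eq_sum_partialDeriv hc.contDiffAt, laplacian_eq_sum_partialDeriv hf.contDiffAt]
  refine Finset.sum_congr rfl fun i _ => ?_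
  have key : ∀ (h : Space d → ℝ), partialDeriv i (fun z => h (z - a)) =
      fun z => partialDeriv i h (z - a) := by
    intro h; ext z
    simp only [partialDeriv]
    rw [fderiv_comp_sub]
  rw [key, key]

/-- Green's second identity on the whole space. -/
theorem integral_mul_laplacian {d : ℕ} {f φ : Space d → ℝ} (hf : ContDiff ℝ 2 f)
    (hφ : ContDiff ℝ 2 φ) (hc : HasCompactSupport φ) :
    ∫ x, f x * Laplacian.laplacian φ x = ∫ x, Laplacian.laplacian f x * φ x := by
  have hd1 : ∀ i, ContDiff ℝ 1 (partialDeriv i φ) :=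
    fun i => contDiff_partialDeriv hφ (by norm_num) i
  have hf1 : ∀ i, ContDiff ℝ 1 (partialDeriv i f) :=
    fun i => contDiff_partialDeriv hf (by norm_num) i
  have hd2 : ∀ i, Continuous (partialDeriv i (partialDeriv i φ)) :=
    fun i => (contDiff_partialDeriv (m := 0) (hd1 i) (by norm_num) i).continuous
  have hf2 : ∀ i, Continuous (partialDeriv i (partialDeriv i f)) :=
    fun i => (contDiff_partialDeriv (m := 0) (hf1 i) (by norm_num) i).continuous
  have hc1 := fun i => hasCompactSupport_partialDeriv hc i
  have hc2 := fun i => hasCompactSupport_partialDeriv (hc1 i) i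
  have hint : ∀ g h : Space d → ℝ, Continuous g → Continuous h → HasCompactSupport h →
      Integrable (fun x => g x * h x) := fun g h hg hh hhc =>
    (hg.mul hh).integrable_of_hasCompactSupport hhc.mul_left
  have e1 : ∀ i, ∫ x, f x * partialDeriv i (partialDeriv i φ) x
      = ∫ x, partialDeriv i (partialDeriv i f) x * φ x := by
    intro i
    have a1 := integral_mul_fderiv_eq_neg_fderiv_mul_of_integrable (μ := (volume : Measure (Space d)))
      (f := f) (g := partialDeriv i φ) (v := coordVec i)
      (hint _ _ (hf1 i).continuous (hd1 i).continuous (hc1 i))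
      (hint _ _ hf.continuous (hd2 i) (hc2 i))
      (hint _ _ hf.continuous (hd1 i).continuous (hc1 i))
      (fun x _ => (hf.differentiable (by norm_num)).differentiableAt)
      (fun x _ => ((hd1 i).differentiable (by norm_num)).differentiableAt)
    have a2 := integral_mul_fderiv_eq_neg_fderiv_mul_of_integrable (μ := (volume : Measure (Space d)))
      (f := partialDeriv i f) (g := φ) (v := coordVec i)
      (hint _ _ (hf2 i) hφ.continuous hc)
      (hint _ _ (hf1 i).continuous (hd1 i).continuous (hc1 i))
      (hint _ _ (hf1 i).continuous hφ.continuous hc)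
      (fun x _ => ((hf1 i).differentiable (by norm_num)).differentiableAt)
      (fun x _ => (hφ.differentiable (by norm_num)).differentiableAt)
    have b1 : ∫ x, f x * partialDeriv i (partialDeriv i φ) x
        = - ∫ x, partialDeriv i f x * partialDeriv i φ x := a1
    have b2 : ∫ x, partialDeriv i f x * partialDeriv i φ x
        = - ∫ x, partialDeriv i (partialDeriv i f) x * φ x := a2
    rw [b1, b2, neg_neg]
  simp_rw [laplacian_eq_sum_partialDeriv hf.contDiffAt, laplacian_eq_sum_partialDeriv hφ.contDiffAt,
    Finset.mul_sum, Finset.sum_mul]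
  rw [integral_finsetSum _ fun i _ => hint _ _ hf.continuous (hd2 i) (hc2 i),
    integral_finsetSum _ fun i _ => hint _ _ (hf2 i) hφ.continuous hc]
  exact Finset.sum_congr rfl fun i _ => e1 i

/-! ### Averages over balls -/

/-- Smooth cutoff: `1` on the closed ball of radius `R`, compactly supported. -/
theorem exists_smooth_cutoff {d : ℕ} {R : ℝ} (hR : 0 < R) : ∃ χ : Space d → ℝ,
    ContDiff ℝ ∞ χ ∧ HasCompactSupport χ ∧ (∀ x, 0 ≤ χ x) ∧ (∀ x, χ x ≤ 1) ∧
      (∀ x ∈ Metric.closedBall (0 : Space d) R, χ x = 1) ∧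
      (∀ x, x ∉ Metric.ball (0 : Space d) (2 * R) → χ x = 0) := by
  let b : ContDiffBump (0 : Space d) := ⟨R, 2 * R, hR, by linarith⟩
  refine ⟨b, b.contDiff, b.hasCompactSupport, fun x => b.nonneg, fun x => b.le_one,
    fun x hx => b.one_of_mem_closedBall hx, fun x hx => ?_⟩
  have : x ∉ Function.support b := by rw [b.support_eq]; exact hx
  simpa using this

/-- The uniform probability measure on the unit ball. -/
noncomputable def unitBallMeasure (d : ℕ) : Measure (Space d) :=
  (volume (Metric.ball (0 : Space d) 1))⁻¹ • volume.restrict (Metric.ball (0 : Space d) 1)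

theorem volume_unitBall_ne_zero (d : ℕ) : volume (Metric.ball (0 : Space d) 1) ≠ 0 :=
  (Metric.measure_ball_pos _ _ one_pos).ne'

theorem volume_unitBall_ne_top (d : ℕ) : volume (Metric.ball (0 : Space d) 1) ≠ ⊤ :=
  measure_ball_lt_top.ne

instance (d : ℕ) : IsProbabilityMeasure (unitBallMeasure d) :=
  ⟨by simp [unitBallMeasure, ENNReal.inv_mul_cancel (volume_unitBall_ne_zero d)
    (volume_unitBall_ne_top d)]⟩

theorem ae_unitBallMeasure (d : ℕ) : ∀ᵐ z ∂(unitBallMeasure d), ‖z‖ < 1 := by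
  have : ∀ᵐ z ∂(volume.restrict (Metric.ball (0 : Space d) 1)), ‖z‖ < 1 := by
    filter_upwards [ae_restrict_mem measurableSet_ball] with z hz
    simpa using hz
  exact (Measure.ae_smul_measure this _)

theorem unitBallMeasure_absolutelyContinuous (d : ℕ) : unitBallMeasure d ≪ volume :=
  (Measure.smul_absolutelyContinuous).trans Measure.restrict_le_self.absolutelyContinuous

theorem integral_unitBallMeasure {d : ℕ} (f : Space d → ℝ) :
    ∫ z, f z ∂(unitBallMeasure d) = ((volume (Metric.ball (0 : Space d) 1)).toReal)⁻¹ *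
      ∫ z in Metric.ball (0 : Space d) 1, f z := by
  rw [unitBallMeasure, integral_smul_measure, ENNReal.toReal_inv, smul_eq_mul]

/-- The weight (1 - |z|²)₊ has a kink on the unit sphere; being Lipschitz is enough for the
integration by parts that follows. -/
theorem lipschitzWith_one_sub_min_sq {d : ℕ} :
    LipschitzWith 2 (fun z : Space d => 1 - (min ‖z‖ 1) ^ 2) := by
  refine LipschitzWith.of_dist_le_mul fun x y => ?_
  rw [Real.dist_eq]
  have h1 : |min ‖x‖ 1 - min ‖y‖ 1| ≤ dist x y := by
    have := (lipschitzWith_one_norm (E := Space d)).min_const 1 |>.dist_le_mul x y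
    simpa [Real.dist_eq] using this
  have hx : 0 ≤ min ‖x‖ 1 := le_min (norm_nonneg _) zero_le_one
  have hy : 0 ≤ min ‖y‖ 1 := le_min (norm_nonneg _) zero_le_one
  have hx' : min ‖x‖ 1 ≤ 1 := min_le_right _ _
  have hy' : min ‖y‖ 1 ≤ 1 := min_le_right _ _
  have : (1 - min ‖x‖ 1 ^ 2) - (1 - min ‖y‖ 1 ^ 2) =
    -((min ‖x‖ 1 - min ‖y‖ 1) * (min ‖x‖ 1 + min ‖y‖ 1)) := by ring
  rw [this, abs_neg, abs_mul, abs_of_nonneg (add_nonneg hx hy)]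
  have h2 : min ‖x‖ 1 + min ‖y‖ 1 ≤ 2 := by linarith
  calc _ ≤ dist x y * 2 := by gcongr
    _ = _ := by simp [mul_comm]

/-- The coordinate z_i is -½ ∂_i (1 - |z|²), and 1 - |z|² vanishes on the sphere, so integrating by
parts leaves no boundary term. This replaces the divergence theorem and avoids surface measure. -/
theorem setIntegral_ball_mul_coord {d : ℕ} {f : Space d → ℝ} (hf : ContDiff ℝ 1 f) (i : Fin d) :
    ∫ z in Metric.ball (0 : Space d) 1, f z * z i =
      (1 / 2) * ∫ z in Metric.ball (0 : Space d) 1, (1 - ‖z‖ ^ 2) * partialDeriv i f z := by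
  -- The cutoff makes f globally Lipschitz without changing it near the closed unit ball.
  obtain ⟨χ, hχ, hχc, -, -, hχ1, -⟩ := exists_smooth_cutoff (d := d) (R := 2) two_pos
  set F : Space d → ℝ := fun z => χ z * f z with hF
  have hFd : ContDiff ℝ 1 F := (hχ.of_le (by exact_mod_cast le_top)).mul hf
  have hFc : HasCompactSupport F := hχc.mul_right
  obtain ⟨C, hC⟩ := hFd.lipschitzWith_of_hasCompactSupport hFc (by norm_num)
  set h : Space d → ℝ := fun z => 1 - (min ‖z‖ 1) ^ 2 with hh
  have hh0 : ∀ z : Space d, 1 ≤ ‖z‖ → h z = 0 := fun z hz => by simp [hh, min_eq_right hz]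
  have hh1 : ∀ z : Space d, ‖z‖ < 1 → h z = 1 - ‖z‖ ^ 2 := fun z hz => by
    simp [hh, min_eq_left hz.le]
  have hhc : HasCompactSupport h := HasCompactSupport.intro (isCompact_closedBall (0 : Space d) 1)
    fun z hz => hh0 z (by simpa using (not_le.1 (by simpa using hz)).le)
  have key := hC.integral_lineDeriv_mul_eq (μ := (volume : Measure (Space d)))
    lipschitzWith_one_sub_min_sq hhc (coordVec i)
  have hFeq : ∀ z : Space d, ‖z‖ < 2 → F =ᶠ[𝓝 z] f := fun z hz => by
    have : Metric.ball (0 : Space d) 2 ∈ 𝓝 z := Metric.isOpen_ball.mem_nhds (by simpa using hz)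
    filter_upwards [this] with y hy
    simp [hF, hχ1 y (Metric.ball_subset_closedBall hy)]
  have e1 : ∫ x, lineDeriv ℝ F x (coordVec i) * h x =
      ∫ z in Metric.ball (0 : Space d) 1, (1 - ‖z‖ ^ 2) * partialDeriv i f z := by
    rw [← integral_indicator measurableSet_ball]
    refine integral_congr_ae (Eventually.of_forall fun z => ?_)
    by_cases hz : ‖z‖ < 1
    · rw [Set.indicator_of_mem (by simpa using hz)]
      simp only
      rw [hh1 z hz, (hFd.differentiable (by norm_num)).differentiableAt.lineDeriv_eq_fderiv,
        (hFeq z (by linarith)).fderiv_eq, mul_comm]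
      rfl
    · rw [Set.indicator_of_notMem (by simpa using hz)]
      simp only
      rw [hh0 z (not_lt.1 hz), mul_zero]
  have e2 : ∫ x, lineDeriv ℝ h x (-coordVec i) * F x =
      ∫ z in Metric.ball (0 : Space d) 1, 2 * (f z * z i) := by
    rw [← integral_indicator measurableSet_ball]
    -- The weight fails to be differentiable only on the unit sphere, which is a null set.
    have hs : ∀ᵐ z : Space d, z ∉ Metric.sphere (0 : Space d) 1 := by
      exact measure_eq_zero_iff_ae_notMem.1
        (Measure.addHaar_sphere_of_ne_zero volume (0 : Space d) one_ne_zero)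
    refine integral_congr_ae ?_
    filter_upwards [hs] with z hz
    by_cases hz1 : ‖z‖ < 1
    · rw [Set.indicator_of_mem (by simpa using hz1)]
      have hd : HasFDerivAt (fun y : Space d => 1 - ‖y‖ ^ 2) (-(2 • (innerSL ℝ z))) z :=
        ((hasStrictFDerivAt_norm_sq z).hasFDerivAt).const_sub 1
      have he : h =ᶠ[𝓝 z] fun y : Space d => 1 - ‖y‖ ^ 2 := by
        filter_upwards [Metric.isOpen_ball.mem_nhds (show z ∈ Metric.ball (0 : Space d) 1 by
          simpa using hz1)] with y hy
        exact hh1 y (by simpa using hy)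
      rw [(hd.congr_of_eventuallyEq he).differentiableAt.lineDeriv_eq_fderiv,
        (hd.congr_of_eventuallyEq he).fderiv, (hFeq z (by linarith)).eq_of_nhds]
      simp [EuclideanSpace.inner_single_right]
      ring
    · have hz2 : 1 < ‖z‖ := lt_of_le_of_ne (not_lt.1 hz1) (fun h => hz (by simp [← h]))
      rw [Set.indicator_of_notMem (by simpa using hz1)]
      have he : h =ᶠ[𝓝 z] fun _ => 0 := by
        filter_upwards [(isOpen_lt continuous_const continuous_norm).mem_nhds hz2] with y hy
        exact hh0 y (le_of_lt hy)
      rw [((hasFDerivAt_const (0 : ℝ) z).congr_of_eventuallyEq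
        he).differentiableAt.lineDeriv_eq_fderiv, he.fderiv_eq]
      simp
  rw [e1, e2, integral_const_mul] at key
  rw [key]; ring

/-- The average of `f` over the ball of radius `r` around `x`. -/
noncomputable def ballAvg {d : ℕ} (r : ℝ) (f : Space d → ℝ) (x : Space d) : ℝ :=
  ∫ z, f (x + r • z) ∂(unitBallMeasure d)

theorem integrable_unitBallMeasure_of_continuousOn {d : ℕ} {f : Space d → ℝ}
    (hf : ContinuousOn f (Metric.closedBall 0 1)) : Integrable f (unitBallMeasure d) := by
  unfold unitBallMeasure
  refine Integrable.smul_measure ?_ (ENNReal.inv_ne_top.2 (volume_unitBall_ne_zero d))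
  exact (hf.integrableOn_compact (isCompact_closedBall _ _)).mono_set Metric.ball_subset_closedBall

theorem integrable_unitBallMeasure {d : ℕ} {f : Space d → ℝ} (hf : Continuous f) :
    Integrable f (unitBallMeasure d) :=
  integrable_unitBallMeasure_of_continuousOn hf.continuousOn

theorem integral_unitBallMeasure_mul_coord {d : ℕ} {f : Space d → ℝ} (hf : ContDiff ℝ 1 f)
    (i : Fin d) :
    ∫ z, f z * z i ∂(unitBallMeasure d) =
      (1 / 2) * ∫ z, (1 - ‖z‖ ^ 2) * partialDeriv i f z ∂(unitBallMeasure d) := by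
  rw [integral_unitBallMeasure, integral_unitBallMeasure, setIntegral_ball_mul_coord hf]; ring

theorem fderiv_apply_eq_sum {d : ℕ} (f : Space d → ℝ) (x z : Space d) :
    fderiv ℝ f x z = ∑ i, partialDeriv i f x * z i := by
  have : z = ∑ i, z i • coordVec i := by
    ext j; simp [Finset.sum_apply, Pi.single_apply]
  conv_lhs => rw [this]
  simp [partialDeriv, mul_comm]

/-- Differentiating under the integral gives ∇φ(x + r z) · z, and one integration by parts in each
coordinate turns this into the Laplacian with weight 1 - |z|². The sign of Δφ thus controls the
monotonicity of ball averages in the radius. -/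
theorem hasDerivAt_ballAvg {d : ℕ} {φ : Space d → ℝ} (hφ : ContDiff ℝ 2 φ) (x : Space d) (r : ℝ) :
    HasDerivAt (fun s => ballAvg s φ x)
      (r / 2 * ∫ z, (1 - ‖z‖ ^ 2) * Laplacian.laplacian φ (x + r • z) ∂(unitBallMeasure d)) r := by
  have hD : Continuous (fun p : ℝ × Space d => fderiv ℝ φ (x + p.1 • p.2) p.2) := by
    have := hφ.continuous_fderiv (by norm_num)
    exact (this.comp (by fun_prop)).clm_apply continuous_snd
  have hdiff : ∀ s : ℝ, ∀ z : Space d,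
      HasDerivAt (fun t : ℝ => φ (x + t • z)) (fderiv ℝ φ (x + s • z) z) s := fun s z => by
    have h1 : HasDerivAt (fun t : ℝ => x + t • z) z s := by
      simpa using ((hasDerivAt_id s).smul_const z).const_add x
    exact ((hφ.differentiable (by norm_num) _).hasFDerivAt).comp_hasDerivAt s h1
  obtain ⟨C, hC⟩ := ((isCompact_Icc (a := r - 1) (b := r + 1)).prod
    (isCompact_closedBall (0 : Space d) 1)).exists_bound_of_continuousOn hD.continuousOn
  have hcont : ∀ s : ℝ, Continuous fun z => φ (x + s • z) := fun s =>
    hφ.continuous.comp (by fun_prop)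
  have main := (hasDerivAt_integral_of_dominated_loc_of_deriv_le (μ := unitBallMeasure d)
    (F := fun s z => φ (x + s • z)) (F' := fun s z => fderiv ℝ φ (x + s • z) z) (x₀ := r)
    (bound := fun _ => C) (s := Metric.ball r 1) (Metric.ball_mem_nhds r one_pos)
    (Eventually.of_forall fun s => (hcont s).aestronglyMeasurable)
    (integrable_unitBallMeasure (hcont r))
    ((hD.comp (Continuous.prodMk_right r)).aestronglyMeasurable)
    (by
      filter_upwards [ae_unitBallMeasure d] with z hz s hs
      refine hC (s, z) ⟨?_, by simpa using hz.le⟩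
      rw [Real.ball_eq_Ioo] at hs
      exact ⟨hs.1.le, hs.2.le⟩)
    (integrable_const _)
    (Eventually.of_forall fun z s _ => hdiff s z)).2
  refine main.congr_deriv (Eq.symm ?_)
  simp_rw [fderiv_apply_eq_sum φ]
  have hp : ∀ i, ContDiff ℝ 1 fun z : Space d => partialDeriv i φ (x + r • z) := fun i =>
    (contDiff_partialDeriv hφ (by norm_num) i).comp (by fun_prop)
  have hcoord : ∀ i : Fin d, Continuous fun z : Space d => z i := fun i => by fun_prop
  have hpc : ∀ i, Continuous fun z : Space d => partialDeriv i φ (x + r • z) * z i :=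
    fun i => (hp i).continuous.mul (hcoord i)
  rw [integral_finsetSum _ fun i _ => integrable_unitBallMeasure (hpc i)]
  have hpp : ∀ i (z : Space d), partialDeriv i (fun z : Space d => partialDeriv i φ (x + r • z)) z
      = r * partialDeriv i (partialDeriv i φ) (x + r • z) := fun i z => by
    have hdi : DifferentiableAt ℝ (partialDeriv i φ) (x + r • z) :=
      (contDiff_partialDeriv (m := 1) hφ (by norm_num) i).differentiable (by norm_num) _
    have h1 : HasFDerivAt (fun z : Space d => x + r • z)
        (r • ContinuousLinearMap.id ℝ (Space d)) z := by
      simpa using ((hasFDerivAt_id z).const_smul r).const_add x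
    have h2 := hdi.hasFDerivAt.comp z h1
    have h3 : fderiv ℝ (fun z : Space d => partialDeriv i φ (x + r • z)) z = _ := h2.fderiv
    conv_lhs => rw [partialDeriv, h3]
    simp [partialDeriv]
  simp_rw [integral_unitBallMeasure_mul_coord (hp _), hpp,
    laplacian_eq_sum_partialDeriv hφ.contDiffAt, Finset.mul_sum]
  have hc2 : ∀ i, Continuous fun z : Space d =>
      (1 - ‖z‖ ^ 2) * partialDeriv i (partialDeriv i φ) (x + r • z) := fun i => by
    have : Continuous (partialDeriv i (partialDeriv i φ)) :=
      (contDiff_partialDeriv (m := 0) (contDiff_partialDeriv (m := 1) hφ (by norm_num) i)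
        (by norm_num) i).continuous
    exact (by fun_prop : Continuous fun z : Space d => 1 - ‖z‖ ^ 2).mul (this.comp (by fun_prop))
  rw [integral_finsetSum _ fun i _ => integrable_unitBallMeasure (hc2 i), Finset.mul_sum]
  refine Finset.sum_congr rfl fun i _ => ?_
  rw [show (fun z : Space d => (1 - ‖z‖ ^ 2) * (r * partialDeriv i (partialDeriv i φ) (x + r • z)))
    = fun z => r * ((1 - ‖z‖ ^ 2) * partialDeriv i (partialDeriv i φ) (x + r • z)) by
      ext z; ring, integral_const_mul]
  ring

theorem ballAvg_zero {d : ℕ} (f : Space d → ℝ) (x : Space d) : ballAvg 0 f x = f x := by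
  simp [ballAvg]

/-- The second order coefficient of the ball average. -/
noncomputable def ballConst (d : ℕ) : ℝ := (1 / 4) * ∫ z, (1 - ‖z‖ ^ 2) ∂(unitBallMeasure d)

theorem ballConst_pos (d : ℕ) : 0 < ballConst d := by
  unfold ballConst
  refine mul_pos (by norm_num) ?_
  rw [integral_pos_iff_support_of_nonneg_ae]
  · have : (Function.support fun z : Space d => 1 - ‖z‖ ^ 2) ∈ ae (unitBallMeasure d) := by
      filter_upwards [ae_unitBallMeasure d] with z hz
      have : ‖z‖ ^ 2 < 1 := by nlinarith [norm_nonneg z]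
      exact (sub_pos.2 this).ne'
    rw [measure_congr (eventuallyEq_univ.2 this)]
    simp
  · filter_upwards [ae_unitBallMeasure d] with z hz
    have : ‖z‖ ^ 2 < 1 := by nlinarith [norm_nonneg z]
    simpa using this.le
  · exact integrable_unitBallMeasure (by fun_prop)

/-- Second order expansion of the ball average, with a bound on the remainder. -/
theorem abs_ballAvg_sub_le {d : ℕ} {φ : Space d → ℝ} (hφ : ContDiff ℝ 2 φ) (x : Space d) {r ε L : ℝ}
    (hr : 0 ≤ r) (h : ∀ z ∈ Metric.ball x r, |Laplacian.laplacian φ z - L| ≤ ε) :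
    |ballAvg r φ x - φ x - ballConst d * r ^ 2 * L| ≤ ballConst d * r ^ 2 * ε := by
  have hd : ∀ s, HasDerivAt (fun s => ballAvg s φ x - ballConst d * s ^ 2 * L)
      (s / 2 * ∫ z, (1 - ‖z‖ ^ 2) * (Laplacian.laplacian φ (x + s • z) - L)
        ∂(unitBallMeasure d)) s := fun s => by
    have h1 := hasDerivAt_ballAvg hφ x s
    have h2 : HasDerivAt (fun s => ballConst d * s ^ 2 * L) (ballConst d * (2 * s) * L) s := by
      simpa using ((hasDerivAt_pow 2 s).const_mul (ballConst d)).mul_const L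
    refine (h1.sub h2).congr_deriv (Eq.symm ?_)
    have hc : Continuous fun z : Space d => (1 - ‖z‖ ^ 2) * Laplacian.laplacian φ (x + s • z) :=
      (by fun_prop : Continuous fun z : Space d => 1 - ‖z‖ ^ 2).mul
        ((continuous_laplacian hφ).comp (by fun_prop))
    have hc' : Continuous fun z : Space d => (1 - ‖z‖ ^ 2) * L := by fun_prop
    simp_rw [mul_sub]
    rw [integral_sub (integrable_unitBallMeasure hc) (integrable_unitBallMeasure hc'),
      integral_mul_const, ballConst]
    ring
  have hb : ∀ s ∈ Set.Ico 0 r, ‖s / 2 * ∫ z, (1 - ‖z‖ ^ 2) *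
      (Laplacian.laplacian φ (x + s • z) - L) ∂(unitBallMeasure d)‖ ≤
        ballConst d * (2 * s) * ε := fun s hs => by
    rw [norm_mul, Real.norm_eq_abs, abs_of_nonneg (by linarith [hs.1])]
    have : ‖∫ z, (1 - ‖z‖ ^ 2) * (Laplacian.laplacian φ (x + s • z) - L) ∂(unitBallMeasure d)‖ ≤
        ∫ z, (1 - ‖z‖ ^ 2) * ε ∂(unitBallMeasure d) := by
      refine norm_integral_le_of_norm_le (integrable_unitBallMeasure (by fun_prop)) ?_
      filter_upwards [ae_unitBallMeasure d] with z hz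
      have h0 : 0 ≤ 1 - ‖z‖ ^ 2 := by nlinarith [norm_nonneg z]
      rw [norm_mul, Real.norm_eq_abs, abs_of_nonneg h0]
      refine mul_le_mul_of_nonneg_left (h _ ?_) h0
      simp only [Metric.mem_ball, dist_self_add_left, norm_smul, Real.norm_eq_abs,
        abs_of_nonneg hs.1]
      nlinarith [norm_nonneg z, hs.1, hs.2]
    calc _ ≤ s / 2 * ∫ z, (1 - ‖z‖ ^ 2) * ε ∂(unitBallMeasure d) :=
          mul_le_mul_of_nonneg_left this (by linarith [hs.1])
      _ = _ := by rw [integral_mul_const, ballConst]; ring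
  have hB : ∀ s, HasDerivAt (fun s => ballConst d * s ^ 2 * ε) (ballConst d * (2 * s) * ε) s :=
    fun s => by simpa using ((hasDerivAt_pow 2 s).const_mul (ballConst d)).mul_const ε
  -- Mean value inequality: the remainder vanishes at radius 0 and its derivative is bounded by that
  -- of `ballConst d * s ^ 2 * ε`.
  have := image_norm_le_of_norm_deriv_right_le_deriv_boundary
    (f := fun s => ballAvg s φ x - ballConst d * s ^ 2 * L - φ x) (a := 0) (b := r)
    (f' := fun s => s / 2 * ∫ z, (1 - ‖z‖ ^ 2) * (Laplacian.laplacian φ (x + s • z) - L)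
        ∂(unitBallMeasure d))
    (B := fun s => ballConst d * s ^ 2 * ε) (B' := fun s => ballConst d * (2 * s) * ε)
    (fun s _ => ((hd s).sub_const _).continuousAt.continuousWithinAt)
    (fun s _ => ((hd s).sub_const _).hasDerivWithinAt)
    (by simp [ballAvg_zero]) hB hb (Set.right_mem_Icc.2 hr)
  rw [Real.norm_eq_abs] at this
  convert this using 2
  ring

/-- The sub-mean value inequality for functions with negative Laplacian. -/
theorem ballAvg_le_of_laplacian_nonpos {d : ℕ} {φ : Space d → ℝ} (hφ : ContDiff ℝ 2 φ)
    (h : ∀ z, Laplacian.laplacian φ z ≤ 0) (x : Space d) {r : ℝ} (hr : 0 ≤ r) :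
    ballAvg r φ x ≤ φ x := by
  have : AntitoneOn (fun s => ballAvg s φ x) (Set.Ici 0) := by
    refine antitoneOn_of_deriv_nonpos (convex_Ici 0)
      (fun s _ => (hasDerivAt_ballAvg hφ x s).continuousAt.continuousWithinAt)
      (fun s _ => (hasDerivAt_ballAvg hφ x s).differentiableAt.differentiableWithinAt)
      fun s hs => ?_
    rw [(hasDerivAt_ballAvg hφ x s).deriv]
    rw [interior_Ici] at hs
    refine mul_nonpos_of_nonneg_of_nonpos (by linarith [Set.mem_Ioi.1 hs]) ?_
    refine integral_nonpos_of_ae ?_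
    filter_upwards [ae_unitBallMeasure d] with z hz
    exact mul_nonpos_of_nonneg_of_nonpos (by nlinarith [norm_nonneg z]) (h _)
  have := this (Set.mem_Ici.2 le_rfl) (Set.mem_Ici.2 hr) hr
  simpa [ballAvg_zero] using this

/-! ### The Coulomb kernel and its regularization -/

/-- The Coulomb kernel as a function of the distance. -/
noncomputable def coulombProfile (d : ℕ) (t : ℝ) : ℝ :=
  if d = 2 then -Real.log t else (t ^ (d - 2))⁻¹

theorem coulomb_neg {d : ℕ} (x : Space d) : coulomb (-x) = coulomb x := by
  simp [coulomb]

theorem coulomb_sub_comm {d : ℕ} (x y : Space d) : coulomb (x - y) = coulomb (y - x) := by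
  rw [← coulomb_neg, neg_sub]

theorem coulombProfile_anti {d : ℕ} {s t : ℝ} (hs : 0 < s) (hst : s ≤ t) :
    coulombProfile d t ≤ coulombProfile d s := by
  unfold coulombProfile
  split_ifs
  · exact neg_le_neg (Real.log_le_log hs hst)
  · gcongr

theorem continuousAt_coulombProfile {d : ℕ} {t : ℝ} (ht : 0 < t) :
    ContinuousAt (coulombProfile d) t := by
  unfold coulombProfile
  split_ifs
  · exact (Real.continuousAt_log ht.ne').neg
  · exact (continuousAt_id.pow _).inv₀ (pow_ne_zero _ ht.ne')

theorem continuousOn_coulomb {d : ℕ} : ContinuousOn (coulomb (d := d)) {0}ᶜ := fun x hx => by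
  have : ContinuousAt (coulomb (d := d)) x :=
    (continuousAt_coulombProfile (norm_pos_iff.2 hx)).comp continuous_norm.continuousAt
  exact this.continuousWithinAt

theorem continuousAt_coulomb {d : ℕ} {x : Space d} (hx : x ≠ 0) :
    ContinuousAt (coulomb (d := d)) x :=
  continuousOn_coulomb.continuousAt (isOpen_compl_singleton.mem_nhds hx)

theorem tendsto_coulombProfile_zero {d : ℕ} (hd : 2 ≤ d) :
    Tendsto (coulombProfile d) (𝓝[>] 0) atTop := by
  unfold coulombProfile
  split_ifs with h
  · exact tendsto_neg_atBot_atTop.comp Real.tendsto_log_nhdsGT_zero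
  · refine tendsto_inv_nhdsGT_zero.comp ?_
    refine tendsto_nhdsWithin_iff.2 ⟨?_, ?_⟩
    · have : Tendsto (fun t : ℝ => t ^ (d - 2)) (𝓝 0) (𝓝 (0 ^ (d - 2))) :=
        (continuous_pow _).tendsto _
      rw [zero_pow (by omega)] at this
      exact this.mono_left nhdsWithin_le_nhds
    · filter_upwards [self_mem_nhdsWithin] with t ht
      exact pow_pos (Set.mem_Ioi.1 ht) _

@[fun_prop]
theorem measurable_coulomb {d : ℕ} : Measurable (coulomb (d := d)) := by
  unfold coulomb
  split_ifs
  · exact (Real.measurable_log.comp measurable_norm).neg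
  · exact (measurable_norm.pow_const _).inv

/-- A lower bound of the kernel on bounded sets. -/
noncomputable def coulombLower (R : ℝ) : ℝ := max (Real.log R) 0

theorem neg_coulombLower_le {d : ℕ} {R : ℝ} {x : Space d} (hx : ‖x‖ ≤ R) :
    -coulombLower R ≤ coulomb x := by
  unfold coulomb coulombLower
  split_ifs
  · rcases eq_or_ne x 0 with rfl | h
    · simp
    · exact neg_le_neg (le_max_of_le_left (Real.log_le_log (norm_pos_iff.2 h) hx))
  · have : 0 ≤ (‖x‖ ^ (d - 2))⁻¹ := by positivity
    linarith [le_max_right (Real.log R) 0]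

theorem coulombLower_nonneg (R : ℝ) : 0 ≤ coulombLower R := le_max_right _ _

theorem abs_coulomb_le {d : ℕ} {R : ℝ} {x : Space d} (hx : ‖x‖ ≤ R) :
    |coulomb x| ≤ coulomb x + 2 * coulombLower R := by
  have h1 := neg_coulombLower_le hx
  have h2 := coulombLower_nonneg R
  rw [abs_le]; constructor <;> linarith

/-- Smooth regularization of the Coulomb kernel. -/
noncomputable def regCoulomb {d : ℕ} (ε : ℝ) (x : Space d) : ℝ :=
  coulombProfile d (Real.sqrt (‖x‖ ^ 2 + ε ^ 2))

theorem norm_lt_sqrt {d : ℕ} {ε : ℝ} (hε : 0 < ε) (x : Space d) :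
    ‖x‖ < Real.sqrt (‖x‖ ^ 2 + ε ^ 2) := by
  refine Real.lt_sqrt_of_sq_lt ?_
  have := sq_pos_of_pos hε; linarith

theorem regCoulomb_le {d : ℕ} {ε : ℝ} (hε : 0 < ε) {x : Space d} (hx : x ≠ 0) :
    regCoulomb ε x ≤ coulomb x :=
  coulombProfile_anti (norm_pos_iff.2 hx) (norm_lt_sqrt hε x).le

theorem regCoulomb_anti {d : ℕ} {ε δ : ℝ} (hε : 0 < ε) (h : ε ≤ δ) (x : Space d) :
    regCoulomb δ x ≤ regCoulomb ε x :=
  coulombProfile_anti ((norm_nonneg x).trans_lt (norm_lt_sqrt hε x))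
    (Real.sqrt_le_sqrt (by gcongr))

theorem tendsto_regCoulomb {d : ℕ} {x : Space d} (hx : x ≠ 0) :
    Tendsto (fun ε => regCoulomb ε x) (𝓝[>] 0) (𝓝 (coulomb x)) := by
  refine Tendsto.mono_left ?_ nhdsWithin_le_nhds
  have h1 : Tendsto (fun ε : ℝ => Real.sqrt (‖x‖ ^ 2 + ε ^ 2)) (𝓝 0) (𝓝 ‖x‖) := by
    have : Continuous fun ε : ℝ => Real.sqrt (‖x‖ ^ 2 + ε ^ 2) := by fun_prop
    simpa using this.tendsto 0
  exact (continuousAt_coulombProfile (norm_pos_iff.2 hx)).tendsto.comp h1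

theorem tendsto_regCoulomb_zero {d : ℕ} (hd : 2 ≤ d) :
    Tendsto (fun ε => regCoulomb ε (0 : Space d)) (𝓝[>] 0) atTop := by
  refine (tendsto_coulombProfile_zero hd).congr' ?_
  filter_upwards [self_mem_nhdsWithin] with ε hε
  simp [regCoulomb, Real.sqrt_sq (Set.mem_Ioi.1 hε).le]

/-- The dimensional factor in `c_d = κ d |B₁|`. -/
noncomputable def kappa (d : ℕ) : ℝ := if d = 2 then 1 else (d : ℝ) - 2

theorem kappa_pos {d : ℕ} (hd : 2 ≤ d) : 0 < kappa d := by
  unfold kappa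
  split_ifs with h
  · norm_num
  · have : (3 : ℝ) ≤ d := by exact_mod_cast (by omega : 3 ≤ d)
    linarith

theorem coulombConst_pos {d : ℕ} (hd : 2 ≤ d) : 0 < coulombConst d :=
  mul_pos (kappa_pos hd) (mul_pos (by exact_mod_cast (by omega : 0 < d))
    (ENNReal.toReal_pos (volume_unitBall_ne_zero d) (volume_unitBall_ne_top d)))

/-- In the variable s = |x|² the logarithmic and power kernels have the same derivative up to
`kappa`, so the gradient and Laplacian computations need no case distinction on the dimension. -/
theorem hasDerivAt_coulombProfile_sqrt {d : ℕ} (hd : 2 ≤ d) {s : ℝ} (hs : 0 < s) :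
    HasDerivAt (fun s => coulombProfile d (Real.sqrt s)) (-(kappa d / 2) * s ^ (-(d : ℝ) / 2)) s := by
  by_cases h : d = 2
  · subst h
    have h1 : HasDerivAt (fun s => -(Real.log s / 2)) (-(s⁻¹ / 2)) s :=
      ((Real.hasDerivAt_log hs.ne').div_const 2).neg
    have h2 : (fun s => coulombProfile 2 (Real.sqrt s)) =ᶠ[𝓝 s] fun s => -(Real.log s / 2) := by
      filter_upwards [lt_mem_nhds hs] with t ht
      simp [coulombProfile, Real.log_sqrt ht.le]
    refine (h1.congr_of_eventuallyEq h2).congr_deriv ?_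
    have : (-((2 : ℕ) : ℝ) / 2) = -1 := by norm_num
    rw [this, Real.rpow_neg_one]; simp [kappa]; ring
  · have h1 : HasDerivAt (fun s : ℝ => s ^ (-((d : ℝ) - 2) / 2))
        ((-((d : ℝ) - 2) / 2) * s ^ (-((d : ℝ) - 2) / 2 - 1)) s :=
      Real.hasDerivAt_rpow_const (Or.inl hs.ne')
    have h2 : (fun s => coulombProfile d (Real.sqrt s)) =ᶠ[𝓝 s]
        fun s : ℝ => s ^ (-((d : ℝ) - 2) / 2) := by
      filter_upwards [lt_mem_nhds hs] with t ht
      simp only [coulombProfile, if_neg h]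
      rw [Real.sqrt_eq_rpow, ← Real.rpow_natCast, ← Real.rpow_mul ht.le, ← Real.rpow_neg ht.le,
        Nat.cast_sub hd]
      congr 1; push_cast; ring
    refine (h1.congr_of_eventuallyEq h2).congr_deriv ?_
    have : (-((d : ℝ) - 2) / 2 - 1) = -(d : ℝ) / 2 := by ring
    rw [this, kappa, if_neg h]; ring

theorem norm_sq_add_pos {d : ℕ} {ε : ℝ} (hε : 0 < ε) (x : Space d) : 0 < ‖x‖ ^ 2 + ε ^ 2 := by
  positivity

theorem contDiff_regCoulomb {d : ℕ} {ε : ℝ} (hε : 0 < ε) {n : ℕ∞} :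
    ContDiff ℝ n (regCoulomb (d := d) ε) := by
  have hs : ContDiff ℝ n fun x : Space d => Real.sqrt (‖x‖ ^ 2 + ε ^ 2) :=
    ((contDiff_norm_sq ℝ).add contDiff_const).sqrt fun x => (norm_sq_add_pos hε x).ne'
  have hpos : ∀ x : Space d, Real.sqrt (‖x‖ ^ 2 + ε ^ 2) ≠ 0 := fun x =>
    (Real.sqrt_pos.2 (norm_sq_add_pos hε x)).ne'
  unfold regCoulomb coulombProfile
  split_ifs
  · exact (hs.log hpos).neg
  · exact (hs.pow _).inv fun x => pow_ne_zero _ (hpos x)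

theorem partialDeriv_comp_norm_sq {d : ℕ} {ψ : ℝ → ℝ} {ψ' ε : ℝ} {x : Space d}
    (h : HasDerivAt ψ ψ' (‖x‖ ^ 2 + ε ^ 2)) (i : Fin d) :
    partialDeriv i (fun z => ψ (‖z‖ ^ 2 + ε ^ 2)) x = ψ' * (2 * x i) := by
  have h1 : HasFDerivAt (fun y : Space d => ‖y‖ ^ 2 + ε ^ 2) (2 • (innerSL ℝ x)) x :=
    ((hasStrictFDerivAt_norm_sq x).hasFDerivAt).add_const _
  have h2 := h.comp_hasFDerivAt x h1
  have h3 : fderiv ℝ (fun z => ψ (‖z‖ ^ 2 + ε ^ 2)) x = _ := h2.fderiv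
  rw [partialDeriv, h3]
  simp [EuclideanSpace.inner_single_right]

theorem laplacian_regCoulomb {d : ℕ} (hd : 2 ≤ d) {ε : ℝ} (hε : 0 < ε) (x : Space d) :
    Laplacian.laplacian (regCoulomb ε) x =
      -(kappa d * d * (ε ^ 2 * (‖x‖ ^ 2 + ε ^ 2) ^ (-(d : ℝ) / 2 - 1))) := by
  rw [laplacian_eq_sum_partialDeriv (contDiff_regCoulomb (n := 2) hε).contDiffAt]
  have h1 : ∀ i, partialDeriv i (regCoulomb (d := d) ε) =
      fun z => (-(kappa d) * (‖z‖ ^ 2 + ε ^ 2) ^ (-(d : ℝ) / 2)) * z i := fun i => by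
    ext z
    have := partialDeriv_comp_norm_sq (hasDerivAt_coulombProfile_sqrt hd (norm_sq_add_pos hε z)) i
    unfold regCoulomb
    rw [this]; ring
  have h2 : ∀ i, partialDeriv i (partialDeriv i (regCoulomb (d := d) ε)) x =
      -(kappa d) * (‖x‖ ^ 2 + ε ^ 2) ^ (-(d : ℝ) / 2) +
        kappa d * d * (‖x‖ ^ 2 + ε ^ 2) ^ (-(d : ℝ) / 2 - 1) * (x i) ^ 2 := fun i => by
    rw [h1]
    have hpow : HasDerivAt (fun s : ℝ => -(kappa d) * s ^ (-(d : ℝ) / 2))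
        (-(kappa d) * ((-(d : ℝ) / 2) * (‖x‖ ^ 2 + ε ^ 2) ^ (-(d : ℝ) / 2 - 1)))
        (‖x‖ ^ 2 + ε ^ 2) :=
      (Real.hasDerivAt_rpow_const (Or.inl (norm_sq_add_pos hε x).ne')).const_mul _
    have hp := partialDeriv_comp_norm_sq hpow i
    have hdf : DifferentiableAt ℝ (fun z : Space d =>
        -(kappa d) * (‖z‖ ^ 2 + ε ^ 2) ^ (-(d : ℝ) / 2)) x := by
      have h1 : HasFDerivAt (fun y : Space d => ‖y‖ ^ 2 + ε ^ 2) (2 • (innerSL ℝ x)) x :=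
        ((hasStrictFDerivAt_norm_sq x).hasFDerivAt).add_const _
      exact (hpow.comp_hasFDerivAt x h1).differentiableAt
    have hc : HasFDerivAt (fun z : Space d => z i) (EuclideanSpace.proj i : Space d →L[ℝ] ℝ) x :=
      (EuclideanSpace.proj i : Space d →L[ℝ] ℝ).hasFDerivAt
    have h3 := (hdf.hasFDerivAt.mul hc).fderiv
    unfold partialDeriv at hp ⊢
    erw [h3]
    simp only [add_apply, smul_apply, hp, smul_eq_mul]
    simp
    ring
  simp_rw [h2]
  rw [Finset.sum_add_distrib, Finset.sum_const, Finset.card_univ,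
    Fintype.card_fin, ← Finset.mul_sum, ← EuclideanSpace.real_norm_sq_eq]
  -- With s = |x|² + ε², factoring out s^(-d/2-1) leaves d s - d |x|² = d ε²; only this multiple of
  -- ε² survives.
  have h4 : (‖x‖ ^ 2 + ε ^ 2) ^ (-(d : ℝ) / 2) =
      (‖x‖ ^ 2 + ε ^ 2) ^ (-(d : ℝ) / 2 - 1) * (‖x‖ ^ 2 + ε ^ 2) := by
    rw [Real.rpow_sub_one (norm_sq_add_pos hε x).ne']
    field_simp [(norm_sq_add_pos hε x).ne']
  rw [h4, nsmul_eq_mul]; ring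

/-- Strict negativity lets the minimum principle be applied directly at a minimum point, without a
perturbation. -/
theorem laplacian_regCoulomb_neg {d : ℕ} (hd : 2 ≤ d) {ε : ℝ} (hε : 0 < ε) (x : Space d) :
    Laplacian.laplacian (regCoulomb ε) x < 0 := by
  rw [laplacian_regCoulomb hd hε, neg_lt_zero]
  have := kappa_pos hd
  have h2 : (0 : ℝ) < d := by exact_mod_cast (by omega : 0 < d)
  have := Real.rpow_pos_of_pos (norm_sq_add_pos hε x) (-(d : ℝ) / 2 - 1)
  positivity

/-! ### Integrability and the fundamental solution -/

/-- On balls the kernel is O(|x|^(-α)) with α < d: α = d - 2 for a power kernel, while for d = 2 the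
exponent 1/2 absorbs the logarithm. -/
theorem locallyIntegrable_coulomb {d : ℕ} (hd : 2 ≤ d) :
    LocallyIntegrable (coulomb (d := d)) := by
  have hdim : Module.finrank ℝ (Space d) = d := by simp
  rw [locallyIntegrable_iff]
  intro K hK
  obtain ⟨R, hR_pos, hR⟩ := hK.isBounded.exists_pos_norm_lt
  suffices IntegrableOn (coulomb (d := d)) (Metric.ball 0 R) from
    this.mono_set (mem_ball_zero_iff.mpr <| hR · ·)
  by_cases h : d = 2
  · subst h
    -- The summand 2 bounds |log t| t^(1/2) for t ≤ 1, and R · R^(1/2) bounds log t · t^(1/2) for 1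
    -- < t < R.
    refine integrableOn_ball_of_norm_le_rpow (C := 2 + R * R ^ (1 / 2 : ℝ)) (α := 1 / 2)
      (by simp) (by norm_num) ?_ measurable_coulomb.aestronglyMeasurable
    have h0 : ∀ᵐ x : Space 2 ∂(volume.restrict (Metric.ball 0 R)), x ≠ 0 :=
      ae_restrict_of_ae (Measure.ae_ne volume 0)
    filter_upwards [h0, ae_restrict_mem measurableSet_ball] with x hx hxR
    have hp := norm_pos_iff.2 hx
    have hxR' : ‖x‖ < R := by simpa using hxR
    have hpp := Real.rpow_pos_of_pos hp (1 / 2)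
    have hRp := Real.rpow_pos_of_pos hR_pos (1 / 2)
    simp only [coulomb, if_true, norm_neg, Real.norm_eq_abs]
    rw [Real.rpow_neg hp.le, ← div_eq_mul_inv, le_div_iff₀ hpp]
    rcases le_or_gt ‖x‖ 1 with h1 | h1
    · have := Real.abs_log_mul_self_rpow_lt ‖x‖ (1 / 2) hp h1 (by norm_num)
      rw [abs_mul, abs_of_pos hpp] at this
      have h3 : 0 < R * R ^ (1 / 2 : ℝ) := by positivity
      norm_num at this ⊢
      norm_num at h3
      linarith
    · rw [abs_of_nonneg (Real.log_nonneg h1.le)]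
      have h3 : Real.log ‖x‖ ≤ R := (Real.log_le_self hp.le).trans hxR'.le
      have h4 : ‖x‖ ^ (1 / 2 : ℝ) ≤ R ^ (1 / 2 : ℝ) := Real.rpow_le_rpow hp.le hxR'.le (by norm_num)
      have : Real.log ‖x‖ * ‖x‖ ^ (1 / 2 : ℝ) ≤ R * R ^ (1 / 2 : ℝ) := by gcongr
      linarith
  · refine integrableOn_ball_of_norm_le_rpow (C := 1) (α := (d : ℝ) - 2)
      (by rw [hdim]; omega) (by rw [hdim]; linarith) ?_ measurable_coulomb.aestronglyMeasurable
    refine Eventually.of_forall fun x => ?_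
    simp only [coulomb, if_neg h]
    rw [norm_inv, norm_pow, norm_norm, Real.rpow_neg (norm_nonneg x), one_mul, ← Real.rpow_natCast,
      Nat.cast_sub hd]
    simp

/-- In polar coordinates the integrand r^(d-1) (r² + 1)^(-d/2-1) has the primitive r^d (r² +
1)^(-d/2) / d, which rises from 0 to 1/d and cancels the factor d in the surface measure d |B₁|.
This is the total mass of the mollifier -Δ g_ε, up to `kappa d * d`. -/
theorem integral_one_add_norm_sq_rpow {d : ℕ} (hd : 2 ≤ d) :
    Integrable (fun x : Space d => (‖x‖ ^ 2 + 1) ^ (-(d : ℝ) / 2 - 1)) ∧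
    ∫ x : Space d, (‖x‖ ^ 2 + 1) ^ (-(d : ℝ) / 2 - 1) =
      (volume (Metric.ball (0 : Space d) 1)).toReal := by
  have hdim : Module.finrank ℝ (Space d) = d := by simp
  have : NeZero d := ⟨by omega⟩
  have : Nontrivial (Space d) := Module.nontrivial_of_finrank_pos (R := ℝ) (by rw [hdim]; omega)
  have hd0 : (0 : ℝ) < d := by exact_mod_cast (by omega : 0 < d)
  have hpos : ∀ y : ℝ, 0 < y ^ 2 + 1 := fun y => by positivity
  have hder : ∀ y ∈ Set.Ici (0 : ℝ), HasDerivAt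
      (fun y : ℝ => (1 / (d : ℝ)) * (y ^ d * (y ^ 2 + 1) ^ (-(d : ℝ) / 2)))
      (y ^ (d - 1) * (y ^ 2 + 1) ^ (-(d : ℝ) / 2 - 1)) y := fun y _ => by
    have h1 : HasDerivAt (fun y : ℝ => y ^ 2 + 1) (2 * y) y := by
      simpa using (hasDerivAt_pow 2 y).add_const 1
    have h2 : HasDerivAt (fun y : ℝ => (y ^ 2 + 1) ^ (-(d : ℝ) / 2)) _ y :=
      h1.rpow_const (p := -(d : ℝ) / 2) (Or.inl (hpos y).ne')
    refine (((hasDerivAt_pow d y).mul h2).const_mul (1 / (d : ℝ))).congr_deriv ?_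
    have h4 : (y ^ 2 + 1) ^ (-(d : ℝ) / 2) = (y ^ 2 + 1) ^ (-(d : ℝ) / 2 - 1) * (y ^ 2 + 1) := by
      rw [Real.rpow_sub_one (hpos y).ne']
      field_simp [(hpos y).ne']
    have h5 : y ^ d = y ^ (d - 1) * y := by
      rw [← pow_succ]; congr 1; omega
    rw [h4, h5]
    field_simp
    ring
  have hlim : Tendsto (fun y : ℝ => (1 / (d : ℝ)) * (y ^ d * (y ^ 2 + 1) ^ (-(d : ℝ) / 2))) atTop
      (𝓝 (1 / (d : ℝ))) := by
    have h1 : Tendsto (fun y : ℝ => 1 - 1 / (y ^ 2 + 1)) atTop (𝓝 (1 - 0)) := by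
      refine tendsto_const_nhds.sub ?_
      refine Tendsto.div_atTop tendsto_const_nhds ?_
      exact tendsto_atTop_add_const_right _ _ (tendsto_pow_atTop (by norm_num))
    have h2 : Tendsto (fun y : ℝ => (1 - 1 / (y ^ 2 + 1)) ^ ((d : ℝ) / 2)) atTop (𝓝 1) := by
      have := h1.rpow_const (p := (d : ℝ) / 2) (Or.inl (by norm_num))
      simpa using this
    have h3 : Tendsto (fun y : ℝ => (1 / (d : ℝ)) * (1 - 1 / (y ^ 2 + 1)) ^ ((d : ℝ) / 2)) atTop
        (𝓝 (1 / (d : ℝ))) := by simpa using h2.const_mul (1 / (d : ℝ))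
    refine h3.congr' ?_
    filter_upwards [eventually_gt_atTop 0] with y hy
    congr 1
    have : 1 - 1 / (y ^ 2 + 1) = y ^ 2 / (y ^ 2 + 1) := by field_simp [(hpos y).ne']; ring
    rw [this, Real.div_rpow (by positivity) (hpos y).le, neg_div, Real.rpow_neg (hpos y).le,
      div_eq_mul_inv]
    congr 1
    rw [← Real.rpow_natCast y 2, ← Real.rpow_mul hy.le, ← Real.rpow_natCast y d]
    congr 1; push_cast; ring
  have hnn : ∀ y ∈ Set.Ioi (0 : ℝ), 0 ≤ y ^ (d - 1) * (y ^ 2 + 1) ^ (-(d : ℝ) / 2 - 1) :=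
    fun y hy => mul_nonneg (pow_nonneg (Set.mem_Ioi.1 hy).le _) (Real.rpow_nonneg (hpos y).le _)
  have hI := integrableOn_Ioi_deriv_of_nonneg' hder hnn hlim
  have hv := integral_Ioi_of_hasDerivAt_of_nonneg' hder hnn hlim
  constructor
  · have := (integrable_fun_norm_addHaar (volume : Measure (Space d))
      (f := fun y => (y ^ 2 + 1) ^ (-(d : ℝ) / 2 - 1))).2
    rw [hdim] at this
    exact this hI
  · have := integral_fun_norm_addHaar (volume : Measure (Space d))
      (fun y => (y ^ 2 + 1) ^ (-(d : ℝ) / 2 - 1))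
    rw [this, hdim]
    simp only [smul_eq_mul, nsmul_eq_mul]
    rw [hv, zero_pow (by omega)]
    simp [Measure.real]
    field_simp

/-- Monotonicity in ε squeezes the regularized kernel between its value at ε = 1 and the true
kernel; this provides the majorant for limits ε → 0. -/
theorem abs_regCoulomb_le {d : ℕ} {ε : ℝ} (hε : 0 < ε) (h1 : ε ≤ 1) {x : Space d} (hx : x ≠ 0) :
    |regCoulomb ε x| ≤ |coulomb x| + |regCoulomb 1 x| := by
  have h2 := regCoulomb_le hε hx
  have h3 := regCoulomb_anti hε h1 x
  rw [abs_le]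
  constructor
  · linarith [neg_abs_le (regCoulomb 1 x), abs_nonneg (coulomb x)]
  · linarith [le_abs_self (coulomb x), abs_nonneg (regCoulomb 1 x)]

/-- `-Δ g = c_d δ₀`. -/
theorem integral_coulomb_mul_laplacian {d : ℕ} (hd : 2 ≤ d) {φ : Space d → ℝ}
    (hφ : ContDiff ℝ 2 φ) (hc : HasCompactSupport φ) :
    ∫ x, coulomb x * Laplacian.laplacian φ x = -(coulombConst d * φ 0) := by
  have : Nontrivial (Space d) := Module.nontrivial_of_finrank_pos (R := ℝ) (by simp; omega)
  have hL := continuous_laplacian hφ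
  have hLc := hasCompactSupport_laplacian hc
  have hev : ∀ᶠ ε : ℝ in 𝓝[>] 0, 0 < ε ∧ ε ≤ 1 := by
    filter_upwards [Ioc_mem_nhdsGT one_pos] with ε h using h
  have lim1 : Tendsto (fun ε => ∫ x, regCoulomb ε x * Laplacian.laplacian φ x) (𝓝[>] 0)
      (𝓝 (∫ x, coulomb x * Laplacian.laplacian φ x)) := by
    refine tendsto_integral_filter_of_dominated_convergence
      (fun x => ‖coulomb x * Laplacian.laplacian φ x‖ +
        ‖regCoulomb 1 x * Laplacian.laplacian φ x‖) ?_ ?_ ?_ ?_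
    · filter_upwards [hev] with ε hε
      exact ((contDiff_regCoulomb (n := 0) hε.1).continuous.mul hL).aestronglyMeasurable
    · filter_upwards [hev] with ε hε
      filter_upwards [Measure.ae_ne volume (0 : Space d)] with x hx
      rw [norm_mul, norm_mul, norm_mul, ← add_mul]
      exact mul_le_mul_of_nonneg_right (abs_regCoulomb_le hε.1 hε.2 hx) (norm_nonneg _)
    · refine Integrable.add (Integrable.norm ?_) (Integrable.norm ?_)
      · have := (locallyIntegrable_coulomb hd).integrable_smul_right_of_hasCompactSupport hL hLc
        simpa using this
      · exact (((contDiff_regCoulomb (n := 0) one_pos).continuous.mul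
          hL).integrable_of_hasCompactSupport hLc.mul_left)
    · filter_upwards [Measure.ae_ne volume (0 : Space d)] with x hx
      exact (tendsto_regCoulomb hx).mul_const _
  -- In the rescaled variable y = x / ε the mollifier is fixed and the test function tends to the
  -- constant φ(0).
  have lim2 : Tendsto (fun ε : ℝ => ∫ y : Space d, (‖y‖ ^ 2 + 1) ^ (-(d : ℝ) / 2 - 1) * φ (ε • y))
      (𝓝[>] 0) (𝓝 ((volume (Metric.ball (0 : Space d) 1)).toReal * φ 0)) := by
    rw [← (integral_one_add_norm_sq_rpow hd).2, ← integral_mul_const]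
    obtain ⟨C, hC⟩ := hc.exists_bound_of_continuous hφ.continuous
    refine tendsto_integral_filter_of_dominated_convergence
      (fun y => (‖y‖ ^ 2 + 1) ^ (-(d : ℝ) / 2 - 1) * C) ?_ ?_ ?_ ?_
    · refine Eventually.of_forall fun ε => ?_
      exact ((integral_one_add_norm_sq_rpow hd).1.aestronglyMeasurable).mul
        (hφ.continuous.comp (by fun_prop)).aestronglyMeasurable
    · refine Eventually.of_forall fun ε => Eventually.of_forall fun y => ?_
      rw [norm_mul, Real.norm_of_nonneg (Real.rpow_nonneg (by positivity) _)]
      exact mul_le_mul_of_nonneg_left (hC _) (Real.rpow_nonneg (by positivity) _)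
    · exact (integral_one_add_norm_sq_rpow hd).1.mul_const C
    · refine Eventually.of_forall fun y => Tendsto.const_mul _ ?_
      have h1 : Continuous fun ε : ℝ => φ (ε • y) := hφ.continuous.comp (by fun_prop)
      have := h1.tendsto 0
      rw [zero_smul] at this
      exact this.mono_left nhdsWithin_le_nhds
  -- Green's identity moves the Laplacian onto the smooth kernel; then x = ε y is substituted.
  have heq : ∀ᶠ ε : ℝ in 𝓝[>] 0, ∫ x, regCoulomb ε x * Laplacian.laplacian φ x =
      -(kappa d * d) * ∫ y : Space d, (‖y‖ ^ 2 + 1) ^ (-(d : ℝ) / 2 - 1) * φ (ε • y) := by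
    filter_upwards [hev] with ε hε
    have hε0 := hε.1
    rw [integral_mul_laplacian (contDiff_regCoulomb (n := 2) hε.1) hφ hc]
    simp_rw [laplacian_regCoulomb hd hε.1]
    have hsub := Measure.integral_comp_smul_of_nonneg (volume : Measure (Space d))
      (fun x => ε ^ 2 * (‖x‖ ^ 2 + ε ^ 2) ^ (-(d : ℝ) / 2 - 1) * φ x) ε (hR := hε0.le)
    simp only [finrank_euclideanSpace, Fintype.card_fin, smul_eq_mul] at hsub
    have hpt : ∀ y : Space d, ε ^ 2 * (‖ε • y‖ ^ 2 + ε ^ 2) ^ (-(d : ℝ) / 2 - 1) * φ (ε • y) =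
        (ε ^ d)⁻¹ * ((‖y‖ ^ 2 + 1) ^ (-(d : ℝ) / 2 - 1) * φ (ε • y)) := fun y => by
      rw [← mul_assoc]
      congr 1
      have : ‖ε • y‖ ^ 2 + ε ^ 2 = ε ^ 2 * (‖y‖ ^ 2 + 1) := by
        rw [norm_smul, Real.norm_of_nonneg hε0.le]; ring
      rw [this, Real.mul_rpow (by positivity) (by positivity), ← mul_assoc]
      congr 1
      rw [← Real.rpow_natCast ε 2, ← Real.rpow_mul hε0.le, ← Real.rpow_add hε0,
        ← Real.rpow_natCast ε d, ← Real.rpow_neg hε0.le]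
      congr 1; push_cast; ring
    simp_rw [hpt] at hsub
    rw [integral_const_mul] at hsub
    have hsub' := mul_left_cancel₀ (inv_ne_zero (pow_ne_zero d hε0.ne')) hsub
    rw [hsub', ← integral_const_mul]
    refine integral_congr_ae (Eventually.of_forall fun x => ?_)
    simp only; ring
  have lim3 := (lim2.const_mul (-(kappa d * d))).congr' (heq.mono fun ε h => h.symm)
  rw [tendsto_nhds_unique lim1 lim3, coulombConst, kappa]
  ring

theorem map_unitBallMeasure {d : ℕ} (x : Space d) {r : ℝ} (hr : 0 < r) :
    (unitBallMeasure d).map (fun z => x + r • z) =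
      (volume (Metric.ball x r))⁻¹ • volume.restrict (Metric.ball x r) := by
  have hme : Measurable fun z : Space d => x + r • z := by fun_prop
  have hball : (fun z : Space d => x + r • z) ⁻¹' Metric.ball x r = Metric.ball 0 1 := by
    ext z
    simp [norm_smul, abs_of_pos hr, hr]
  have hpre : ∀ S : Set (Space d), volume ((fun z : Space d => x + r • z) ⁻¹' S) =
      ENNReal.ofReal ((r ^ d)⁻¹) * volume S := fun S => by
    have : (fun z : Space d => x + r • z) ⁻¹' S = (fun z => r • z) ⁻¹' ((fun z => x + z) ⁻¹' S) := rfl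
    rw [this, Measure.addHaar_preimage_smul _ hr.ne', measure_preimage_add]
    simp [abs_of_pos hr]
  ext A hA
  rw [Measure.map_apply hme hA, unitBallMeasure, Measure.smul_apply, Measure.smul_apply,
    Measure.restrict_apply (hme hA), Measure.restrict_apply hA, ← hball, ← Set.preimage_inter, hpre,
    hpre, smul_eq_mul, smul_eq_mul]
  have h0 : ENNReal.ofReal ((r ^ d)⁻¹) ≠ 0 := by
    simpa using pow_pos hr d
  rw [ENNReal.mul_inv (Or.inl h0) (Or.inl ENNReal.ofReal_ne_top)]
  rw [mul_mul_mul_comm, ENNReal.inv_mul_cancel h0 ENNReal.ofReal_ne_top, one_mul]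

theorem ballAvg_eq_average {d : ℕ} (f : Space d → ℝ) (x : Space d) {r : ℝ} (hr : 0 < r) :
    ballAvg r f x = ⨍ z in Metric.ball x r, f z := by
  have hme : MeasurableEmbedding fun z : Space d => x + r • z :=
    ((Homeomorph.smulOfNeZero r hr.ne').trans (Homeomorph.addLeft x)).measurableEmbedding
  rw [ballAvg, ← hme.integral_map (μ := unitBallMeasure d) f, map_unitBallMeasure x hr, average]
  simp

theorem integrable_comp_unitBallMeasure {d : ℕ} {f : Space d → ℝ} (hf : LocallyIntegrable f)
    (x : Space d) {r : ℝ} (hr : 0 < r) :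
    Integrable (fun z => f (x + r • z)) (unitBallMeasure d) := by
  have hme : MeasurableEmbedding fun z : Space d => x + r • z :=
    ((Homeomorph.smulOfNeZero r hr.ne').trans (Homeomorph.addLeft x)).measurableEmbedding
  have := hme.integrable_map_iff (μ := unitBallMeasure d) (g := f)
  rw [map_unitBallMeasure x hr] at this
  refine this.1 (Integrable.smul_measure ?_ (ENNReal.inv_ne_top.2
    (Metric.measure_ball_pos _ _ hr).ne'))
  exact (hf.integrableOn_isCompact (isCompact_closedBall x r)).mono_set Metric.ball_subset_closedBall

theorem ballAvg_comp_sub {d : ℕ} (f : Space d → ℝ) (r : ℝ) (w x : Space d) :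
    ballAvg r (fun z => f (z - w)) x = ballAvg r f (x - w) := by
  simp only [ballAvg]
  congr 1; ext z; congr 1; abel

theorem ae_add_smul_ne {d : ℕ} (hd : 2 ≤ d) (x w : Space d) {r : ℝ} (hr : 0 < r) :
    ∀ᵐ z ∂(unitBallMeasure d), x + r • z ≠ w := by
  have : Nontrivial (Space d) := Module.nontrivial_of_finrank_pos (R := ℝ) (by simp; omega)
  refine (unitBallMeasure_absolutelyContinuous d).ae_le ?_
  filter_upwards [Measure.ae_ne volume (r⁻¹ • (w - x))] with z hz h
  apply hz
  rw [← h]; simp [smul_smul, hr.ne']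

theorem ballAvg_regCoulomb_le {d : ℕ} (hd : 2 ≤ d) {ε : ℝ} (hε : 0 < ε) (x : Space d) {r : ℝ}
    (hr : 0 ≤ r) : ballAvg r (regCoulomb ε) x ≤ regCoulomb ε x :=
  ballAvg_le_of_laplacian_nonpos (contDiff_regCoulomb (n := 2) hε)
    (fun z => (laplacian_regCoulomb_neg hd hε z).le) x hr

theorem tendsto_ballAvg_regCoulomb {d : ℕ} (hd : 2 ≤ d) (x : Space d) {r : ℝ} (hr : 0 < r) :
    Tendsto (fun ε => ballAvg r (regCoulomb ε) x) (𝓝[>] 0) (𝓝 (ballAvg r coulomb x)) := by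
  have hev : ∀ᶠ ε : ℝ in 𝓝[>] 0, 0 < ε ∧ ε ≤ 1 := by
    filter_upwards [Ioc_mem_nhdsGT one_pos] with ε h using h
  refine tendsto_integral_filter_of_dominated_convergence
    (fun z => |coulomb (x + r • z)| + |regCoulomb 1 (x + r • z)|) ?_ ?_ ?_ ?_
  · filter_upwards [hev] with ε hε
    exact ((contDiff_regCoulomb (n := 0) hε.1).continuous.comp (by fun_prop)).aestronglyMeasurable
  · filter_upwards [hev] with ε hε
    filter_upwards [ae_add_smul_ne hd x 0 hr] with z hz
    exact abs_regCoulomb_le hε.1 hε.2 hz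
  · refine (integrable_comp_unitBallMeasure (locallyIntegrable_coulomb hd) x hr).abs.add ?_
    exact (integrable_unitBallMeasure
      ((contDiff_regCoulomb (n := 0) one_pos).continuous.comp (by fun_prop))).abs
  · filter_upwards [ae_add_smul_ne hd x 0 hr] with z hz
    exact tendsto_regCoulomb hz

theorem ballAvg_coulomb_le {d : ℕ} (hd : 2 ≤ d) {x : Space d} (hx : x ≠ 0) {r : ℝ} (hr : 0 < r) :
    ballAvg r coulomb x ≤ coulomb x := by
  refine le_of_tendsto_of_tendsto (tendsto_ballAvg_regCoulomb hd x hr) (tendsto_regCoulomb hx) ?_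
  filter_upwards [self_mem_nhdsWithin] with ε hε
  exact ballAvg_regCoulomb_le hd hε x hr.le

/-- On a ball at distance ρ > 0 from the origin the Laplacian of the regularized kernel is O(ε²), so
the second order expansion bounds the mean value defect by O(ε²), and ε → 0 gives exact equality. -/
theorem ballAvg_coulomb_eq {d : ℕ} (hd : 2 ≤ d) {x : Space d} {r : ℝ} (hr : 0 < r) (hx : r < ‖x‖) :
    ballAvg r coulomb x = coulomb x := by
  have hx0 : x ≠ 0 := norm_pos_iff.1 (hr.trans hx)
  set ρ := ‖x‖ - r with hρ
  have hρ0 : 0 < ρ := sub_pos.2 hx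
  have hp : (-(d : ℝ) / 2 - 1) ≤ 0 := by
    have : (0 : ℝ) ≤ d := Nat.cast_nonneg d
    linarith
  set C := kappa d * d * (ρ ^ 2) ^ (-(d : ℝ) / 2 - 1) with hC
  have hk := kappa_pos hd
  have key : ∀ ε > 0, |ballAvg r (regCoulomb ε) x - regCoulomb ε x| ≤
      ballConst d * r ^ 2 * (C * ε ^ 2) := fun ε hε => by
    have := abs_ballAvg_sub_le (contDiff_regCoulomb (d := d) (n := 2) hε) x (L := 0)
      (ε := C * ε ^ 2) hr.le fun z hz => by
        have hz' : ρ ≤ ‖z‖ := by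
          have h1 := norm_sub_norm_le x z
          rw [← dist_eq_norm, dist_comm] at h1
          have := Metric.mem_ball.1 hz
          rw [hρ]; linarith
        rw [sub_zero, laplacian_regCoulomb hd hε, abs_neg, abs_of_nonneg (by positivity), hC]
        have : (‖z‖ ^ 2 + ε ^ 2) ^ (-(d : ℝ) / 2 - 1) ≤ (ρ ^ 2) ^ (-(d : ℝ) / 2 - 1) := by
          refine Real.rpow_le_rpow_of_nonpos (by positivity) ?_ hp
          nlinarith [sq_nonneg ε]
        calc _ ≤ kappa d * d * (ε ^ 2 * (ρ ^ 2) ^ (-(d : ℝ) / 2 - 1)) := by gcongr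
          _ = _ := by ring
    simpa using this
  have l1 : Tendsto (fun ε => |ballAvg r (regCoulomb ε) x - regCoulomb ε x|) (𝓝[>] 0)
      (𝓝 |ballAvg r coulomb x - coulomb x|) :=
    ((tendsto_ballAvg_regCoulomb hd x hr).sub (tendsto_regCoulomb hx0)).abs
  have l2 : Tendsto (fun ε : ℝ => ballConst d * r ^ 2 * (C * ε ^ 2)) (𝓝[>] 0) (𝓝 0) := by
    have : Continuous fun ε : ℝ => ballConst d * r ^ 2 * (C * ε ^ 2) := by fun_prop
    have := this.tendsto 0
    simp only [ne_eq, OfNat.ofNat_ne_zero, not_false_eq_true, zero_pow, mul_zero] at this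
    exact this.mono_left nhdsWithin_le_nhds
  have := le_of_tendsto_of_tendsto l1 l2 (by filter_upwards [self_mem_nhdsWithin] with ε hε using key ε hε)
  exact sub_eq_zero.1 (abs_nonpos_iff.1 this)

/-! ### Duality and asymptotics of ball averages -/

theorem map_neg_unitBallMeasure (d : ℕ) :
    MeasurePreserving (fun z : Space d => -z) (unitBallMeasure d) (unitBallMeasure d) := by
  refine ⟨measurable_neg, ?_⟩
  ext A hA
  rw [Measure.map_apply measurable_neg hA, unitBallMeasure, Measure.smul_apply, Measure.smul_apply,
    Measure.restrict_apply (measurable_neg hA), Measure.restrict_apply hA]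
  congr 1
  have : (fun z : Space d => -z) ⁻¹' A ∩ Metric.ball 0 1 =
      (fun z : Space d => -z) ⁻¹' (A ∩ Metric.ball 0 1) := by
    ext z; simp
  rw [this]
  exact (Measure.measurePreserving_neg (volume : Measure (Space d))).measure_preimage
    (hA.inter measurableSet_ball).nullMeasurableSet

theorem measurable_ballAvg {d : ℕ} {f : Space d → ℝ} (hf : Measurable f) (r : ℝ) :
    Measurable (ballAvg r f) := by
  have : StronglyMeasurable fun p : Space d × Space d => f (p.1 + r • p.2) :=
    (hf.comp (by fun_prop)).stronglyMeasurable
  exact this.integral_prod_right.measurable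

/-- The ball average is symmetric. -/
theorem integral_mul_ballAvg {d : ℕ} {f χ : Space d → ℝ} (hf : LocallyIntegrable f)
    (hfm : Measurable f) (hχ : Continuous χ) (hχc : HasCompactSupport χ) (r : ℝ) :
    Integrable (fun x => f x * ballAvg r χ x) ∧ Integrable (fun x => ballAvg r f x * χ x) ∧
    ∫ x, f x * ballAvg r χ x = ∫ x, ballAvg r f x * χ x := by
  obtain ⟨C, hC⟩ := hχc.exists_bound_of_continuous hχ
  obtain ⟨R, hR⟩ := hχc.isCompact.isBounded.subset_closedBall 0
  have hχ0 : ∀ x, R < ‖x‖ → χ x = 0 := fun x hx => by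
    by_contra h
    have := hR (subset_tsupport _ h)
    simp at this; linarith
  set K := Metric.closedBall (0 : Space d) (R + |r|) with hK
  have hKi : IntegrableOn f K := hf.integrableOn_isCompact (isCompact_closedBall _ _)
  have hC0 : 0 ≤ C := (norm_nonneg _).trans (hC 0)
  -- A shift by at most |r| keeps everything inside the support ball enlarged by |r|, where f is
  -- integrable; this majorant justifies Fubini.
  have hbound : ∀ x z : Space d, ‖z‖ < 1 → ‖f x * χ (x + r • z)‖ ≤ C * K.indicator (fun x => ‖f x‖) x := by
    intro x z hz
    by_cases hx : x ∈ K
    · rw [Set.indicator_of_mem hx, norm_mul, mul_comm]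
      exact mul_le_mul_of_nonneg_right (hC _) (norm_nonneg _)
    · have : χ (x + r • z) = 0 := by
        apply hχ0
        simp only [hK, Metric.mem_closedBall, dist_zero_right, not_le] at hx
        have h1 : ‖r • z‖ ≤ |r| := by
          rw [norm_smul, Real.norm_eq_abs]
          exact mul_le_of_le_one_right (abs_nonneg r) hz.le
        have h2 := norm_sub_norm_le x (-(r • z))
        rw [norm_neg, sub_neg_eq_add] at h2
        linarith
      rw [this, mul_zero, norm_zero, Set.indicator_of_notMem hx, mul_zero]
  have hKi' : Integrable (fun x => C * K.indicator (fun x => ‖f x‖) x) :=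
    ((integrable_indicator_iff (isCompact_closedBall _ _).measurableSet).2 hKi.norm).const_mul C
  have hI1 : Integrable (fun p : Space d × Space d => f p.1 * χ (p.1 + r • p.2))
      (volume.prod (unitBallMeasure d)) := by
    refine Integrable.mono' (hKi'.comp_fst (unitBallMeasure d)) ?_ ?_
    · exact ((hfm.comp measurable_fst).mul
        (hχ.measurable.comp (by fun_prop))).aestronglyMeasurable
    · have : ∀ᵐ p : Space d × Space d ∂(volume.prod (unitBallMeasure d)), ‖p.2‖ < 1 :=
        Measure.quasiMeasurePreserving_snd.ae (ae_unitBallMeasure d)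
      filter_upwards [this] with p hp using hbound p.1 p.2 hp
  have hshift : ∀ z : Space d, ∀ h : Space d → ℝ,
      ∫ x, h (x + (-(r • z))) = ∫ x, h x := fun z h => integral_add_right_eq_self h _
  have hI2 : Integrable (fun p : Space d × Space d => f (p.1 + r • p.2) * χ p.1)
      (volume.prod (unitBallMeasure d)) := by
    have hm : StronglyMeasurable (fun p : Space d × Space d => f (p.1 + r • p.2) * χ p.1) :=
      ((hfm.comp (by fun_prop)).mul (hχ.measurable.comp measurable_fst)).stronglyMeasurable
    -- This is `hbound` at the shifted point x + r z with direction -z.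
    have hb : ∀ z x : Space d, ‖z‖ < 1 → ‖f (x + r • z) * χ x‖ ≤
        (fun x => C * K.indicator (fun x => ‖f x‖) x) (x + r • z) := fun z x hz => by
      have := hbound (x + r • z) (-z) (by simpa using hz)
      simpa using this
    have hsh : ∀ z : Space d, Integrable fun x =>
        (fun x => C * K.indicator (fun x => ‖f x‖) x) (x + r • z) :=
      fun z => hKi'.comp_add_right (r • z)
    rw [integrable_prod_iff' hm.aestronglyMeasurable]
    constructor
    · filter_upwards [ae_unitBallMeasure d] with z hz
      refine Integrable.mono' (hsh z) ?_ (Eventually.of_forall fun x => hb z x hz)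
      exact (hm.comp_measurable measurable_prodMk_right).aestronglyMeasurable
    · refine Integrable.mono' (integrable_const
        (∫ x, C * K.indicator (fun x => ‖f x‖) x)) ?_ ?_
      · exact (hm.norm.integral_prod_left).aestronglyMeasurable
      · filter_upwards [ae_unitBallMeasure d] with z hz
        rw [Real.norm_of_nonneg (integral_nonneg fun x => norm_nonneg _),
          ← integral_add_right_eq_self (fun x => C * K.indicator (fun x => ‖f x‖) x) (r • z)]
        exact integral_mono_of_nonneg (Eventually.of_forall fun _ => norm_nonneg _) (hsh z)
          (Eventually.of_forall fun x => hb z x hz)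
  have e1 : ∀ x, ∫ z, f x * χ (x + r • z) ∂(unitBallMeasure d) = f x * ballAvg r χ x := fun x =>
    integral_const_mul _ _
  have e2 : ∀ x, ∫ z, f (x + r • z) * χ x ∂(unitBallMeasure d) = ballAvg r f x * χ x := fun x =>
    integral_mul_const _ _
  refine ⟨by simpa only [e1] using hI1.integral_prod_left,
    by simpa only [e2] using hI2.integral_prod_left, ?_⟩
  simp_rw [← e1, ← e2]
  have s1 : ∫ x, ∫ z, f x * χ (x + r • z) ∂(unitBallMeasure d) =
    ∫ z, ∫ x, f x * χ (x + r • z) ∂volume ∂(unitBallMeasure d) := integral_integral_swap hI1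
  have s2 : ∫ x, ∫ z, f (x + r • z) * χ x ∂(unitBallMeasure d) =
    ∫ z, ∫ x, f (x + r • z) * χ x ∂volume ∂(unitBallMeasure d) := integral_integral_swap hI2
  -- For fixed z the two inner integrals differ by a translation and the sign of z, and the uniform
  -- measure on the unit ball is even.
  rw [s1, s2,
    ← (map_neg_unitBallMeasure d).integral_comp
      (Homeomorph.neg (Space d)).measurableEmbedding]
  congr 1; ext z
  rw [← hshift (-z) (fun x => f x * χ (x + r • -z))]
  congr 1; ext x
  simp

theorem exists_abs_ballAvg_sub_le {d : ℕ} {φ : Space d → ℝ} (hφ : ContDiff ℝ 2 φ)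
    (hc : HasCompactSupport φ) {ε : ℝ} (hε : 0 < ε) : ∃ δ > 0, ∀ r, 0 ≤ r → r ≤ δ → ∀ x,
      |ballAvg r φ x - φ x - ballConst d * r ^ 2 * Laplacian.laplacian φ x| ≤
        ballConst d * r ^ 2 * ε := by
  have hu : UniformContinuous (Laplacian.laplacian φ) :=
    (hasCompactSupport_laplacian hc).uniformContinuous_of_continuous (continuous_laplacian hφ)
  obtain ⟨δ, hδ, h⟩ := Metric.uniformContinuous_iff.1 hu ε hε
  refine ⟨δ, hδ, fun r hr hrδ x => abs_ballAvg_sub_le hφ x hr fun z hz => ?_⟩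
  have := h (show dist z x < δ from (Metric.mem_ball.1 hz).trans_le hrδ)
  exact this.le

/-- Ball averages test the distributional Laplacian of f: the expansion of φ is uniform in x, and
for r ≤ 1 everything happens in a fixed compact set where f is integrable. -/
theorem tendsto_integral_mul_ballAvg_sub {d : ℕ} {f φ : Space d → ℝ} (hf : LocallyIntegrable f)
    (hfm : Measurable f) (hφ : ContDiff ℝ 2 φ) (hc : HasCompactSupport φ) :
    Tendsto (fun r : ℝ => (r ^ 2)⁻¹ * ∫ x, f x * (ballAvg r φ x - φ x)) (𝓝[>] 0)
      (𝓝 (ballConst d * ∫ x, f x * Laplacian.laplacian φ x)) := by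
  obtain ⟨R, hR⟩ := hc.isCompact.isBounded.subset_closedBall 0
  have hφ0 : ∀ x, R < ‖x‖ → x ∉ tsupport φ := fun x hx h => by
    have := hR h
    simp at this; linarith
  set K := Metric.closedBall (0 : Space d) (R + 1) with hK
  have hKi : IntegrableOn f K := hf.integrableOn_isCompact (isCompact_closedBall _ _)
  set I := ∫ x in K, ‖f x‖ with hI
  have hI0 : 0 ≤ I := integral_nonneg fun x => norm_nonneg _
  have hm0 := ballConst_pos d
  rw [Metric.tendsto_nhds]
  intro ε hε
  -- The tolerance is chosen so that, after integration against |f|, the error is at most (I / (I +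
  -- 1)) · ε / 2.
  obtain ⟨δ, hδ, h⟩ := exists_abs_ballAvg_sub_le hφ hc
    (show 0 < ε / (2 * (ballConst d * (I + 1))) by positivity)
  filter_upwards [Ioc_mem_nhdsGT (lt_min hδ one_pos)] with r hr
  have hr0 : 0 < r := hr.1
  have hrδ : r ≤ δ := hr.2.trans (min_le_left _ _)
  have hr1 : r ≤ 1 := hr.2.trans (min_le_right _ _)
  have hi1 := (integral_mul_ballAvg hf hfm hφ.continuous hc r).1
  have hi2 : Integrable fun x => f x * φ x := by
    simpa using hf.integrable_smul_right_of_hasCompactSupport hφ.continuous hc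
  have hi3 : Integrable fun x => f x * Laplacian.laplacian φ x := by
    simpa using hf.integrable_smul_right_of_hasCompactSupport (continuous_laplacian hφ)
      (hasCompactSupport_laplacian hc)
  have hdiff : (r ^ 2)⁻¹ * (∫ x, f x * (ballAvg r φ x - φ x)) - ballConst d * ∫ x, f x *
      Laplacian.laplacian φ x = (r ^ 2)⁻¹ * ∫ x, f x *
        (ballAvg r φ x - φ x - ballConst d * r ^ 2 * Laplacian.laplacian φ x) := by
    have : ∀ x, f x * (ballAvg r φ x - φ x - ballConst d * r ^ 2 * Laplacian.laplacian φ x) =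
        f x * (ballAvg r φ x - φ x) - ballConst d * r ^ 2 * (f x * Laplacian.laplacian φ x) :=
      fun x => by ring
    simp_rw [this]
    have hi4 : Integrable fun x => f x * (ballAvg r φ x - φ x) := by
      refine (hi1.sub hi2).congr (Eventually.of_forall fun x => ?_)
      simp only [Pi.sub_apply, mul_sub]
    rw [integral_sub hi4 (hi3.const_mul _), integral_const_mul]
    field_simp
  rw [Real.dist_eq, hdiff, abs_mul, abs_of_pos (by positivity)]
  have hb : |∫ x, f x * (ballAvg r φ x - φ x - ballConst d * r ^ 2 * Laplacian.laplacian φ x)| ≤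
      ∫ x in K, ‖f x‖ * (ballConst d * r ^ 2 * (ε / (2 * (ballConst d * (I + 1))))) := by
    rw [← integral_indicator (isCompact_closedBall _ _).measurableSet, ← Real.norm_eq_abs]
    refine norm_integral_le_of_norm_le ?_ (Eventually.of_forall fun x => ?_)
    · exact (integrable_indicator_iff (isCompact_closedBall _ _).measurableSet).2
        (hKi.norm.mul_const _)
    · by_cases hx : x ∈ K
      · rw [Set.indicator_of_mem hx, norm_mul]
        exact mul_le_mul_of_nonneg_left (h r hr0.le hrδ x) (norm_nonneg _)
      · rw [Set.indicator_of_notMem hx]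
        simp only [hK, Metric.mem_closedBall, dist_zero_right, not_le] at hx
        have hφx : x ∉ tsupport φ := hφ0 x (by linarith)
        have h1 : ballAvg r φ x = 0 := by
          refine integral_eq_zero_of_ae ?_
          filter_upwards [ae_unitBallMeasure d] with z hz
          refine image_eq_zero_of_notMem_tsupport (hφ0 _ ?_)
          have h2 := norm_sub_norm_le x (-(r • z))
          rw [norm_neg, sub_neg_eq_add, norm_smul, Real.norm_of_nonneg hr0.le] at h2
          nlinarith [norm_nonneg z]
        rw [h1, image_eq_zero_of_notMem_tsupport hφx, laplacian_eq_zero_of_notMem_tsupport hφx]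
        simp
  rw [integral_mul_const] at hb
  have hlt : (r ^ 2)⁻¹ * (I * (ballConst d * r ^ 2 * (ε / (2 * (ballConst d * (I + 1)))))) < ε := by
    have : (r ^ 2)⁻¹ * (I * (ballConst d * r ^ 2 * (ε / (2 * (ballConst d * (I + 1)))))) =
        (I / (I + 1)) * (ε / 2) := by
      field_simp
    rw [this]
    have : I / (I + 1) ≤ 1 := (div_le_one (by linarith)).2 (by linarith)
    nlinarith
  exact (mul_le_mul_of_nonneg_left hb (by positivity)).trans_lt hlt

/-- The difference between the Coulomb kernel and its ball average. -/
noncomputable def coulombDefect {d : ℕ} (r : ℝ) (z : Space d) : ℝ := coulomb z - ballAvg r coulomb z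

theorem measurable_coulombDefect {d : ℕ} (r : ℝ) : Measurable (coulombDefect (d := d) r) :=
  measurable_coulomb.sub (measurable_ballAvg measurable_coulomb r)

theorem coulombDefect_eq_zero {d : ℕ} (hd : 2 ≤ d) {r : ℝ} (hr : 0 < r) {z : Space d}
    (hz : r < ‖z‖) : coulombDefect r z = 0 :=
  sub_eq_zero.2 (ballAvg_coulomb_eq hd hr hz).symm

theorem coulombDefect_nonneg {d : ℕ} (hd : 2 ≤ d) {r : ℝ} (hr : 0 < r) {z : Space d}
    (hz : z ≠ 0) : 0 ≤ coulombDefect r z :=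
  sub_nonneg.2 (ballAvg_coulomb_le hd hz hr)

theorem integrable_coulombDefect {d : ℕ} (hd : 2 ≤ d) {r : ℝ} (hr : 0 < r) :
    Integrable (coulombDefect (d := d) r) := by
  obtain ⟨χ, hχ, hχc, -, -, hχ1, -⟩ := exists_smooth_cutoff (d := d) hr
  have h1 : Integrable fun x : Space d => coulomb x * χ x := by
    simpa using (locallyIntegrable_coulomb hd).integrable_smul_right_of_hasCompactSupport
      hχ.continuous hχc
  have h2 := (integral_mul_ballAvg (locallyIntegrable_coulomb hd) measurable_coulomb hχ.continuous
    hχc r).2.1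
  refine (h1.sub h2).congr (Eventually.of_forall fun x => ?_)
  simp only [Pi.sub_apply, ← sub_mul]
  by_cases hx : ‖x‖ ≤ r
  · rw [hχ1 x (by simpa using hx), mul_one]; rfl
  · have := coulombDefect_eq_zero hd hr (not_le.1 hx)
    rw [this]; unfold coulombDefect at this; rw [this, zero_mul]

/-- The defect vanishes beyond radius r, so its integral equals its pairing with a cutoff equal to 1
near the origin. The preceding asymptotics and -Δg = c_d δ₀ then give the limit: the defect over r²
acts as an approximate multiple of δ₀. -/
theorem tendsto_integral_coulombDefect {d : ℕ} (hd : 2 ≤ d) :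
    Tendsto (fun r : ℝ => (r ^ 2)⁻¹ * ∫ z : Space d, coulombDefect r z) (𝓝[>] 0)
      (𝓝 (ballConst d * coulombConst d)) := by
  obtain ⟨χ, hχ, hχc, -, -, hχ1, -⟩ := exists_smooth_cutoff (d := d) one_pos
  have hχ2 : ContDiff ℝ 2 χ := contDiff_infty.1 hχ 2
  have h1 : Integrable fun x : Space d => coulomb x * χ x := by
    simpa using (locallyIntegrable_coulomb hd).integrable_smul_right_of_hasCompactSupport
      hχ.continuous hχc
  have lim := (tendsto_integral_mul_ballAvg_sub (locallyIntegrable_coulomb hd) measurable_coulomb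
    hχ2 hχc).neg
  rw [integral_coulomb_mul_laplacian hd hχ2 hχc, hχ1 0 (by simp)] at lim
  have e : -(ballConst d * -(coulombConst d * 1)) = ballConst d * coulombConst d := by ring
  rw [e] at lim
  refine lim.congr' ?_
  filter_upwards [Ioc_mem_nhdsGT one_pos] with r hr
  obtain ⟨i1, i2, e1⟩ := integral_mul_ballAvg (locallyIntegrable_coulomb hd) measurable_coulomb
    hχ.continuous hχc r
  rw [← mul_neg]
  congr 1
  simp_rw [mul_sub]
  rw [integral_sub i1 h1, e1, neg_sub, ← integral_sub h1 i2]
  refine integral_congr_ae (Eventually.of_forall fun x => ?_)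
  simp only [← sub_mul]
  by_cases hx : ‖x‖ ≤ 1
  · rw [hχ1 x (by simpa using hx), mul_one]; rfl
  · have := coulombDefect_eq_zero hd hr.1 (hr.2.trans_lt (not_le.1 hx))
    rw [this]; unfold coulombDefect at this; rw [this, zero_mul]

/-! ### Charge distributions and their potentials -/

/-- A compactly supported finite measure without atoms, all of whose potential integrals
converge. -/
structure IsCharge {d : ℕ} (ν : Measure (Space d)) : Prop where
  isFinite : IsFiniteMeasure ν
  compact : ∃ R : ℝ, ν (Metric.closedBall 0 R)ᶜ = 0
  noAtom : ∀ x, ν {x} = 0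
  integrable : ∀ x, Integrable (fun y => coulomb (x - y)) ν

theorem IsCharge.ae_norm_le {d : ℕ} {ν : Measure (Space d)} (h : IsCharge ν) :
    ∃ R : ℝ, 0 < R ∧ ∀ᵐ y ∂ν, ‖y‖ ≤ R := by
  obtain ⟨R, hR⟩ := h.compact
  refine ⟨max R 1, by positivity, ?_⟩
  have : ∀ᵐ y ∂ν, y ∈ Metric.closedBall (0 : Space d) R := hR
  filter_upwards [this] with y hy
  exact (by simpa using hy : ‖y‖ ≤ R).trans (le_max_left _ _)

theorem IsCharge.ae_ne {d : ℕ} {ν : Measure (Space d)} (h : IsCharge ν) (x : Space d) :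
    ∀ᵐ y ∂ν, x - y ≠ 0 := by
  filter_upwards [measure_eq_zero_iff_ae_notMem.1 (h.noAtom x)] with y hy h0
  exact hy (sub_eq_zero.1 h0).symm

theorem IsCharge.mono {d : ℕ} {ν ν' : Measure (Space d)} (h : IsCharge ν) (hle : ν' ≤ ν) :
    IsCharge ν' where
  isFinite := have := h.isFinite; isFiniteMeasure_of_le ν hle
  compact := h.compact.imp fun _ hR => le_antisymm ((hle _).trans hR.le) zero_le
  noAtom x := le_antisymm ((hle _).trans (h.noAtom x).le) zero_le
  integrable x := (h.integrable x).mono_measure hle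

theorem continuous_integral_comp_sub {d : ℕ} {ν : Measure (Space d)} [IsFiniteMeasure ν] {R : ℝ}
    (hR : ∀ᵐ y ∂ν, ‖y‖ ≤ R) {f : Space d → ℝ} (hf : Continuous f) :
    Continuous fun x => ∫ y, f (x - y) ∂ν := by
  have h1 : ν.restrict (Metric.closedBall 0 R) = ν :=
    Measure.restrict_eq_self_of_ae_mem (by simpa using hR)
  have := continuous_parametric_integral_of_continuous (μ := ν)
    (f := fun x y : Space d => f (x - y)) (hf.comp (by fun_prop)) (isCompact_closedBall 0 R)
  rwa [h1] at this

theorem IsCharge.integrable_continuous {d : ℕ} {ν : Measure (Space d)} (h : IsCharge ν)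
    {f : Space d → ℝ} (hf : Continuous f) : Integrable f ν := by
  have := h.isFinite
  obtain ⟨R, -, hR⟩ := h.ae_norm_le
  have h1 : ν.restrict (Metric.closedBall 0 R) = ν :=
    Measure.restrict_eq_self_of_ae_mem (by simpa using hR)
  rw [← h1]
  exact hf.continuousOn.integrableOn_compact (isCompact_closedBall _ _)

/-- The potential of the regularized kernel. -/
noncomputable def regPotential {d : ℕ} (ε : ℝ) (ν : Measure (Space d)) (x : Space d) : ℝ :=
  ∫ y, regCoulomb ε (x - y) ∂ν

theorem continuous_regCoulomb {d : ℕ} {ε : ℝ} (hε : 0 < ε) : Continuous (regCoulomb (d := d) ε) :=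
  (contDiff_regCoulomb (n := 0) hε).continuous

theorem IsCharge.integrable_reg {d : ℕ} {ν : Measure (Space d)} (h : IsCharge ν) {ε : ℝ}
    (hε : 0 < ε) (x : Space d) : Integrable (fun y => regCoulomb ε (x - y)) ν :=
  h.integrable_continuous ((continuous_regCoulomb hε).comp (by fun_prop))

theorem IsCharge.continuous_regPotential {d : ℕ} {ν : Measure (Space d)} (h : IsCharge ν) {ε : ℝ}
    (hε : 0 < ε) : Continuous (regPotential ε ν) := by
  have := h.isFinite
  obtain ⟨R, -, hR⟩ := h.ae_norm_le
  exact continuous_integral_comp_sub hR (continuous_regCoulomb hε)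

theorem IsCharge.regPotential_le {d : ℕ} {ν : Measure (Space d)} (h : IsCharge ν) {ε : ℝ}
    (hε : 0 < ε) (x : Space d) : regPotential ε ν x ≤ potential ν x := by
  refine integral_mono_ae (h.integrable_reg hε x) (h.integrable x) ?_
  filter_upwards [h.ae_ne x] with y hy using regCoulomb_le hε hy

theorem IsCharge.tendsto_regPotential {d : ℕ} {ν : Measure (Space d)} (h : IsCharge ν)
    (x : Space d) : Tendsto (fun ε => regPotential ε ν x) (𝓝[>] 0) (𝓝 (potential ν x)) := by
  have hev : ∀ᶠ ε : ℝ in 𝓝[>] 0, 0 < ε ∧ ε ≤ 1 := by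
    filter_upwards [Ioc_mem_nhdsGT one_pos] with ε h using h
  refine tendsto_integral_filter_of_dominated_convergence
    (fun y => |coulomb (x - y)| + |regCoulomb 1 (x - y)|) ?_ ?_ ?_ ?_
  · filter_upwards [hev] with ε hε using (h.integrable_reg hε.1 x).aestronglyMeasurable
  · filter_upwards [hev] with ε hε
    filter_upwards [h.ae_ne x] with y hy using abs_regCoulomb_le hε.1 hε.2 hy
  · exact (h.integrable x).abs.add (h.integrable_reg one_pos x).abs
  · filter_upwards [h.ae_ne x] with y hy using tendsto_regCoulomb hy

/-- The potential is the limit from below of the continuous potentials of the regularized kernels.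
-/
theorem IsCharge.lowerSemicontinuous_potential {d : ℕ} {ν : Measure (Space d)} (h : IsCharge ν) :
    LowerSemicontinuous (potential ν) := by
  intro x a ha
  have h1 := (h.tendsto_regPotential x).eventually (lt_mem_nhds ha)
  obtain ⟨ε, hε1, hε⟩ := (h1.and self_mem_nhdsWithin).exists
  filter_upwards [(h.continuous_regPotential hε).continuousAt.eventually (lt_mem_nhds hε1)] with y hy
  exact hy.trans_le (h.regPotential_le hε y)

/-- A charge with a continuous potential. -/
structure IsRegularCharge {d : ℕ} (ν : Measure (Space d)) : Prop extends IsCharge ν where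
  continuous : Continuous (potential ν)

theorem potential_add {d : ℕ} {ν₁ ν₂ : Measure (Space d)} (h₁ : IsCharge ν₁) (h₂ : IsCharge ν₂)
    (x : Space d) : potential (ν₁ + ν₂) x = potential ν₁ x + potential ν₂ x :=
  integral_add_measure (h₁.integrable x) (h₂.integrable x)

/-- The potential of ν' is lower semicontinuous, and it is also a continuous function minus the
lower semicontinuous potential of ν - ν', hence upper semicontinuous. -/
theorem IsRegularCharge.mono {d : ℕ} {ν ν' : Measure (Space d)} (h : IsRegularCharge ν)
    (hle : ν' ≤ ν) : IsRegularCharge ν' := by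
  have h1 : IsCharge ν' := h.toIsCharge.mono hle
  have := h.isFinite
  have := h1.isFinite
  have h2 : IsCharge (ν - ν') := h.toIsCharge.mono Measure.sub_le
  have hsum : ∀ x, potential ν' x = potential ν x - potential (ν - ν') x := fun x => by
    have := potential_add h2 h1 x
    rw [Measure.sub_add_cancel_of_le hle] at this
    linarith
  refine ⟨h1, continuous_iff_lower_upperSemicontinuous.2
    ⟨h1.lowerSemicontinuous_potential, ?_⟩⟩
  intro x a ha
  rw [hsum] at ha
  set δ := (a - (potential ν x - potential (ν - ν') x)) / 2 with hδ
  have hδ0 : 0 < δ := by rw [hδ]; linarith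
  filter_upwards [h.continuous.continuousAt.eventually
    (gt_mem_nhds (show potential ν x < potential ν x + δ by linarith)),
    h2.lowerSemicontinuous_potential x _
      (show potential (ν - ν') x - δ < potential (ν - ν') x by linarith)] with y hy1 hy2
  rw [hsum]
  linarith

/-- Joint integrability of the kernel against a compactly supported measure and a regular charge. -/
theorem IsRegularCharge.integrable_prod {d : ℕ} {ν m : Measure (Space d)} (h : IsRegularCharge ν)
    [IsFiniteMeasure m] {R : ℝ} (hR : ∀ᵐ z ∂m, ‖z‖ ≤ R) :
    Integrable (fun p : Space d × Space d => coulomb (p.1 - p.2)) (m.prod ν) := by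
  have := h.isFinite
  obtain ⟨R', -, hR'⟩ := h.ae_norm_le
  have hm : StronglyMeasurable fun p : Space d × Space d => coulomb (p.1 - p.2) :=
    (measurable_coulomb.comp (by fun_prop)).stronglyMeasurable
  rw [integrable_prod_iff hm.aestronglyMeasurable]
  refine ⟨Eventually.of_forall fun z => h.integrable z, ?_⟩
  have h1 : m.restrict (Metric.closedBall 0 R) = m :=
    Measure.restrict_eq_self_of_ae_mem (by simpa using hR)
  -- On bounded sets |g| ≤ g + 2 `coulombLower`, so the integral of |g(z - ·)| is bounded by the
  -- continuous potential plus a constant.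
  have h2 : Integrable (fun z => potential ν z + 2 * coulombLower (R + R') * ν.real Set.univ) m := by
    rw [← h1]
    exact (h.continuous.add continuous_const).continuousOn.integrableOn_compact
      (isCompact_closedBall _ _)
  refine h2.mono' hm.norm.integral_prod_right.aestronglyMeasurable ?_
  filter_upwards [hR] with z hz
  rw [Real.norm_of_nonneg (integral_nonneg fun _ => norm_nonneg _)]
  have h3 : ∫ y, (coulomb (z - y) + 2 * coulombLower (R + R')) ∂ν =
      potential ν z + 2 * coulombLower (R + R') * ν.real Set.univ := by
    rw [integral_add (h.integrable z) (integrable_const _), integral_const, potential]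
    simp [mul_comm]
  rw [← h3]
  refine integral_mono_ae (h.integrable z).norm ((h.integrable z).add (integrable_const _)) ?_
  filter_upwards [hR'] with y hy
  exact abs_coulomb_le ((norm_sub_le _ _).trans (add_le_add hz hy))

theorem IsRegularCharge.integral_potential {d : ℕ} {ν m : Measure (Space d)} (h : IsRegularCharge ν)
    [IsFiniteMeasure m] {R : ℝ} (hR : ∀ᵐ z ∂m, ‖z‖ ≤ R) :
    Integrable (fun y => ∫ z, coulomb (z - y) ∂m) ν ∧
      ∫ z, potential ν z ∂m = ∫ y, ∫ z, coulomb (z - y) ∂m ∂ν := by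
  have := h.isFinite
  have hi := h.integrable_prod hR
  exact ⟨hi.integral_prod_right, integral_integral_swap hi⟩

/-! ### Harmonicity off the support -/

/-- The expansion q(x) + `ballConst d` · r² · Δq(x) + o(r²) of the ball average forces Δq(x) = 0. It
suffices to know the mean value property for small radii. -/
theorem laplacian_eq_zero_of_ballAvg_eq {d : ℕ} {q : Space d → ℝ} (hq : ContDiff ℝ 2 q)
    {x : Space d} (h : ∀ᶠ r : ℝ in 𝓝[>] 0, ballAvg r q x = q x) : Laplacian.laplacian q x = 0 := by
  rw [← abs_eq_zero]
  refine le_antisymm (le_of_forall_pos_le_add fun ε hε => ?_) (abs_nonneg _)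
  obtain ⟨δ, hδ, hcont⟩ := Metric.continuousAt_iff.1 (continuous_laplacian hq).continuousAt ε hε
  obtain ⟨r, hr, hr2⟩ := (h.and (Ioo_mem_nhdsGT hδ)).exists
  have := abs_ballAvg_sub_le hq x (r := r) (ε := ε) (L := Laplacian.laplacian q x) hr2.1.le
    fun z hz => (hcont ((Metric.mem_ball.1 hz).trans hr2.2)).le
  rw [hr, sub_self, zero_sub, abs_neg, abs_mul] at this
  have hpos : 0 < ballConst d * r ^ 2 := mul_pos (ballConst_pos d) (pow_pos hr2.1 2)
  rw [abs_of_pos hpos] at this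
  rw [zero_add]
  exact le_of_mul_le_mul_left this hpos

theorem contDiffAt_coulomb {d : ℕ} {x : Space d} (hx : x ≠ 0) {n : WithTop ℕ∞} :
    ContDiffAt ℝ n (coulomb (d := d)) x := by
  have h1 : ContDiffAt ℝ n (fun y : Space d => ‖y‖) x := contDiffAt_norm ℝ hx
  have h2 : ‖x‖ ≠ 0 := norm_ne_zero_iff.2 hx
  unfold coulomb
  split_ifs
  · exact (h1.log h2).neg
  · exact (h1.pow _).inv (pow_ne_zero _ h2)

/-- Away from the charge the kernel may be replaced by this smooth compactly supported one, so that
smoothness of the potential comes from that of a convolution. -/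
theorem exists_smooth_eq_coulomb {d : ℕ} {δ R : ℝ} (hδ : 0 < δ) (hR : 0 < R) :
    ∃ g : Space d → ℝ, ContDiff ℝ ∞ g ∧ HasCompactSupport g ∧
      ∀ z, δ ≤ ‖z‖ → ‖z‖ ≤ R → g z = coulomb z := by
  obtain ⟨χ, hχ, -, -, -, hχ1, hχ0⟩ := exists_smooth_cutoff (d := d) (half_pos hδ)
  obtain ⟨η, hη, hηc, -, -, hη1, -⟩ := exists_smooth_cutoff (d := d) hR
  refine ⟨fun z => (1 - χ z) * η z * coulomb z, ?_, ?_, fun z hz hz' => ?_⟩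
  · rw [contDiff_iff_contDiffAt]
    intro x
    rcases eq_or_ne x 0 with rfl | hx
    · have : (fun z => (1 - χ z) * η z * coulomb z) =ᶠ[𝓝 (0 : Space d)] fun _ => 0 := by
        filter_upwards [Metric.closedBall_mem_nhds (0 : Space d) (half_pos hδ)] with z hz
        simp [hχ1 z hz]
      exact contDiffAt_const.congr_of_eventuallyEq this
    · exact (((contDiff_const.sub hχ).mul hη).contDiffAt).mul (contDiffAt_coulomb hx)
  · exact (hηc.mul_left).mul_right
  · simp only
    rw [hχ0 z (by simp; linarith), hη1 z (by simpa using hz')]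
    ring

/-- Near a point of Ω the potential coincides with a smooth convolution, and Fubini transfers to it
the mean value property of the kernel on balls that miss the singularity. -/
theorem IsCharge.harmonicOnNhd {d : ℕ} (hd : 2 ≤ d) {ν : Measure (Space d)} (h : IsCharge ν)
    {Ω : Set (Space d)} (hΩ : IsOpen Ω) (hν : ν Ω = 0) :
    InnerProductSpace.HarmonicOnNhd (potential ν) Ω := by
  have := h.isFinite
  intro x₀ hx₀
  obtain ⟨R, hR0, hR⟩ := h.ae_norm_le
  obtain ⟨δ', hδ', hball'⟩ := Metric.isOpen_iff.1 hΩ x₀ hx₀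
  -- Halving the radius keeps every point of the δ-ball at distance more than δ from the charge.
  set δ := δ' / 2 with hδd
  have hδ : 0 < δ := half_pos hδ'
  obtain ⟨g, hg, hgc, hgeq⟩ := exists_smooth_eq_coulomb (d := d) hδ
    (show 0 < ‖x₀‖ + δ + R by positivity)
  have hae : ∀ᵐ y ∂ν, ‖y‖ ≤ R ∧ 2 * δ ≤ dist y x₀ := by
    filter_upwards [hR, measure_eq_zero_iff_ae_notMem.1 hν] with y hy1 hy2
    refine ⟨hy1, not_lt.1 fun hlt => hy2 (hball' ?_)⟩
    rw [Metric.mem_ball]; linarith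
  have hfar : ∀ x ∈ Metric.ball x₀ δ, ∀ y : Space d, 2 * δ ≤ dist y x₀ → δ < ‖x - y‖ := by
    intro x hx y hy
    have h1 := dist_triangle y x x₀
    have h2 := Metric.mem_ball.1 hx
    rw [← dist_eq_norm, dist_comm]; linarith
  have hnear : ∀ x ∈ Metric.ball x₀ δ, ∀ y : Space d, ‖y‖ ≤ R → ‖x - y‖ ≤ ‖x₀‖ + δ + R := by
    intro x hx y hy
    have h1 := norm_sub_le x y
    have h2 := norm_sub_norm_le x x₀
    have h3 := Metric.mem_ball.1 hx
    rw [dist_eq_norm] at h3; linarith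
  set q : Space d → ℝ := fun x => ∫ y, g (x - y) ∂ν with hq
  have hqs : ContDiff ℝ 2 q := by
    have h1 : LocallyIntegrable (fun _ : Space d => (1 : ℝ)) ν := locallyIntegrable_const 1
    have := hgc.contDiff_convolution_right (n := 2) (ContinuousLinearMap.mul ℝ ℝ) h1
      (contDiff_infty.1 hg 2)
    have e : q = convolution (fun _ : Space d => (1 : ℝ)) g (ContinuousLinearMap.mul ℝ ℝ) ν := by
      ext x
      simp [hq, convolution]
    rw [e]
    exact_mod_cast this
  have hqeq : ∀ x ∈ Metric.ball x₀ δ, q x = potential ν x := fun x hx => by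
    refine integral_congr_ae ?_
    filter_upwards [hae] with y hy
    exact hgeq _ (hfar x hx y hy.2).le (hnear x hx y hy.1)
  have hqL : ∀ x ∈ Metric.ball x₀ δ, Laplacian.laplacian q x = 0 := fun x hx => by
    refine laplacian_eq_zero_of_ballAvg_eq hqs ?_
    have hx' : 0 < δ - dist x x₀ := sub_pos.2 (Metric.mem_ball.1 hx)
    filter_upwards [Ioo_mem_nhdsGT (lt_min hx' hδ)] with r hr
    have hr0 : 0 < r := hr.1
    have hrb : ∀ z : Space d, ‖z‖ < 1 → x + r • z ∈ Metric.ball x₀ δ := fun z hz => by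
      have h1 : dist (x + r • z) x ≤ r := by
        rw [dist_self_add_left, norm_smul, Real.norm_of_nonneg hr0.le]
        exact mul_le_of_le_one_right hr0.le hz.le
      have h2 := dist_triangle (x + r • z) x x₀
      have h3 := hr.2.trans_le (min_le_left _ _)
      rw [Metric.mem_ball]; linarith
    obtain ⟨C, hC⟩ := hgc.exists_bound_of_continuous hg.continuous
    have hint : Integrable (fun p : Space d × Space d => g (x + r • p.1 - p.2))
        ((unitBallMeasure d).prod ν) :=
      Integrable.of_bound (hg.continuous.comp (by fun_prop)).aestronglyMeasurable C
        (Eventually.of_forall fun p => hC _)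
    have e1 : ballAvg r q x = ∫ y, ∫ z, g (x + r • z - y) ∂(unitBallMeasure d) ∂ν :=
      integral_integral_swap hint
    rw [e1]
    refine integral_congr_ae ?_
    filter_upwards [hae] with y hy
    have e2 : ∫ z, g (x + r • z - y) ∂(unitBallMeasure d) = ballAvg r coulomb (x - y) := by
      refine integral_congr_ae ?_
      filter_upwards [ae_unitBallMeasure d] with z hz
      have hm := hrb z hz
      rw [hgeq _ (hfar _ hm y hy.2).le (hnear _ hm y hy.1)]
      congr 1; abel
    have h4 := hfar x hx y hy.2
    rw [e2, ballAvg_coulomb_eq hd hr0 ((hr.2.trans_le (min_le_right _ _)).trans h4),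
      hgeq _ h4.le (hnear x hx y hy.1)]
  have hev : potential ν =ᶠ[𝓝 x₀] q := by
    filter_upwards [Metric.ball_mem_nhds x₀ hδ] with x hx using (hqeq x hx).symm
  rw [InnerProductSpace.harmonicAt_congr_nhds hev]
  refine ⟨hqs.contDiffAt, ?_⟩
  filter_upwards [Metric.ball_mem_nhds x₀ hδ] with x hx using hqL x hx

/-! ### Maximum principle and harmonic measure -/

/-- If the second derivative along the coordinate line were negative, the minimum would also be a
local maximum; the restriction to the line would be locally constant and the second derivative zero.
-/
theorem partialDeriv_partialDeriv_nonneg_of_isLocalMin {d : ℕ} {ψ : Space d → ℝ} {x : Space d}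
    (hψ : ContDiffAt ℝ 2 ψ x) (hmin : IsLocalMin ψ x) (i : Fin d) :
    0 ≤ partialDeriv i (partialDeriv i ψ) x := by
  by_contra! hneg
  set l : ℝ → Space d := fun t => x + t • coordVec i with hl
  have hl0 : l 0 = x := by simp [hl]
  have hlc : Continuous l := by fun_prop
  have hld : ∀ t, HasDerivAt l (coordVec i) t := fun t => by
    simpa [hl] using ((hasDerivAt_id t).smul_const (coordVec i)).const_add x
  set f : ℝ → ℝ := fun t => ψ (l t) with hf
  have hlt : Tendsto l (𝓝 0) (𝓝 x) := by simpa [hl0] using hlc.tendsto 0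
  have hderiv : ∀ᶠ t in 𝓝 (0 : ℝ), HasDerivAt f (partialDeriv i ψ (l t)) t := by
    have h1 : ∀ᶠ y in 𝓝 x, ContDiffAt ℝ 2 ψ y := hψ.eventually (by simp)
    filter_upwards [hlt.eventually h1] with t ht
    exact ((ht.differentiableAt (by norm_num)).hasFDerivAt).comp_hasDerivAt t (hld t)
  have hfmin : IsLocalMin f 0 := by
    have : ∀ᶠ t in 𝓝 (0 : ℝ), ψ x ≤ ψ (l t) := hlt.eventually hmin
    simpa [IsLocalMin, IsMinFilter, hf, hl0] using this
  have hd1 : deriv f =ᶠ[𝓝 0] fun t => partialDeriv i ψ (l t) := by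
    filter_upwards [hderiv] with t ht using ht.deriv
  have hp : DifferentiableAt ℝ (partialDeriv i ψ) x := by
    have h1 : ContDiffAt ℝ 1 (fderiv ℝ ψ) x := hψ.fderiv_right (by norm_num)
    exact (h1.differentiableAt (by norm_num)).clm_apply (differentiableAt_const _)
  have hd2 : deriv (deriv f) 0 = partialDeriv i (partialDeriv i ψ) x := by
    rw [hd1.deriv_eq]
    have h1 : HasFDerivAt (partialDeriv i ψ) (fderiv ℝ (partialDeriv i ψ) x) (l 0) := by
      rw [hl0]; exact hp.hasFDerivAt
    exact (h1.comp_hasDerivAt (0 : ℝ) (hld 0)).deriv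
  have hmax : IsLocalMax f 0 :=
    isLocalMax_of_deriv_deriv_neg (by rw [hd2]; exact hneg) hfmin.deriv_eq_zero
      hderiv.self_of_nhds.continuousAt
  have hconst : f =ᶠ[𝓝 0] fun _ => f 0 := by
    filter_upwards [hfmin, hmax] with t h1 h2 using le_antisymm h2 h1
  have hd3 : deriv (deriv f) 0 = 0 := by
    have : deriv f =ᶠ[𝓝 0] fun _ => 0 := by
      simpa using hconst.deriv
    rw [this.deriv_eq, deriv_const]
  rw [hd3] at hd2
  exact hneg.ne hd2.symm

/-- The minimum principle for functions with negative Laplacian. -/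
theorem nonneg_of_laplacian_neg {d : ℕ} {Ω : Set (Space d)} (hΩ : IsOpen Ω)
    (hb : Bornology.IsBounded Ω) {ψ : Space d → ℝ} (hψ : ∀ x ∈ Ω, ContDiffAt ℝ 2 ψ x)
    (hc : ContinuousOn ψ (closure Ω)) (hL : ∀ x ∈ Ω, Laplacian.laplacian ψ x < 0)
    (hbd : ∀ x ∈ frontier Ω, 0 ≤ ψ x) : ∀ x ∈ Ω, 0 ≤ ψ x := by
  intro x hx
  obtain ⟨y, hy, hmin⟩ := hb.isCompact_closure.exists_isMinOn ⟨x, subset_closure hx⟩ hc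
  refine le_trans ?_ (hmin (subset_closure hx))
  by_cases hyf : y ∈ frontier Ω
  · exact hbd y hyf
  have hyΩ : y ∈ Ω := by
    rw [frontier, hΩ.interior_eq] at hyf
    by_contra h; exact hyf ⟨hy, h⟩
  have hloc : IsLocalMin ψ y := by
    filter_upwards [hΩ.mem_nhds hyΩ] with z hz using hmin (subset_closure hz)
  have h1 := hL y hyΩ
  rw [laplacian_eq_sum_partialDeriv (hψ y hyΩ)] at h1
  exact absurd (Finset.sum_nonneg fun i _ =>
    partialDeriv_partialDeriv_nonneg_of_isLocalMin (hψ y hyΩ) hloc i) (not_le.2 h1)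

theorem IsRegularDomain.isHarmonicMeasureAt {d : ℕ} {Ω : Set (Space d)} (hΩ : IsRegularDomain Ω)
    {x : Space d} (hx : x ∈ Ω) : IsHarmonicMeasureAt Ω x (harmonicMeasure Ω x) := by
  obtain ⟨m, hm, -⟩ := hΩ.exists_harmonicMeasure x hx
  have h : ∃ m, IsHarmonicMeasureAt Ω x m := ⟨m, hm⟩
  rw [harmonicMeasure, if_pos hx, dif_pos h]
  exact h.choose_spec

theorem IsHarmonicMeasureAt.ae_mem_frontier {d : ℕ} {Ω : Set (Space d)} {x : Space d}
    {m : Measure (Space d)} (hm : IsHarmonicMeasureAt Ω x m) : ∀ᵐ z ∂m, z ∈ frontier Ω :=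
  hm.frontier_compl

theorem IsHarmonicMeasureAt.ae_norm_le {d : ℕ} {Ω : Set (Space d)} (hb : Bornology.IsBounded Ω)
    {x : Space d} {m : Measure (Space d)} (hm : IsHarmonicMeasureAt Ω x m) :
    ∃ R : ℝ, ∀ᵐ z ∂m, ‖z‖ ≤ R := by
  obtain ⟨R, hR⟩ := hb.closure.subset_closedBall 0
  refine ⟨R, ?_⟩
  filter_upwards [hm.ae_mem_frontier] with z hz
  simpa using hR (frontier_subset_closure hz)

theorem IsHarmonicMeasureAt.integrable {d : ℕ} {Ω : Set (Space d)} (hb : Bornology.IsBounded Ω)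
    {x : Space d} {m : Measure (Space d)} (hm : IsHarmonicMeasureAt Ω x m) {f : Space d → ℝ}
    (hf : ContinuousOn f (frontier Ω)) : Integrable f m := by
  have := hm.isProbabilityMeasure
  have h1 : m.restrict (frontier Ω) = m := Measure.restrict_eq_self_of_ae_mem hm.ae_mem_frontier
  rw [← h1]
  exact hf.integrableOn_compact
    (hb.isCompact_closure.of_isClosed_subset isClosed_frontier frontier_subset_closure)

theorem IsHarmonicMeasureAt.dirichletSolution_eq {d : ℕ} {Ω : Set (Space d)}
    (hΩ : IsRegularDomain Ω) {x : Space d} {m : Measure (Space d)} (hm : IsHarmonicMeasureAt Ω x m)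
    {f : Space d → ℝ} (hf : ContinuousOn f (frontier Ω)) :
    dirichletSolution Ω f x = ∫ z, f z ∂m := by
  have h := hΩ.solvable f hf
  rw [dirichletSolution, dif_pos h]
  exact hm.represents _ _ h.choose_spec

theorem continuousOn_coulomb_sub {d : ℕ} {Ω : Set (Space d)} (hΩ : IsOpen Ω) {y : Space d}
    (hy : y ∈ Ω) : ContinuousOn (fun z => coulomb (z - y)) (frontier Ω) := by
  intro z hz
  have hzy : z - y ≠ 0 := fun h => by
    rw [sub_eq_zero.1 h, frontier, hΩ.interior_eq] at hz
    exact hz.2 hy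
  exact ((continuousAt_coulomb hzy).comp (f := fun z : Space d => z - y)
    (by fun_prop)).continuousWithinAt

theorem IsHarmonicMeasureAt.green_eq {d : ℕ} {Ω : Set (Space d)}
    (hΩ : IsRegularDomain Ω) {x : Space d} {m : Measure (Space d)} (hm : IsHarmonicMeasureAt Ω x m)
    {y : Space d} (hy : y ∈ Ω) :
    green Ω x y = coulomb (x - y) - ∫ z, coulomb (z - y) ∂m := by
  rw [green, hm.dirichletSolution_eq hΩ (continuousOn_coulomb_sub hΩ.isOpen hy)]

/-- Harmonic measure averages the regularized kernel to something smaller. -/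
theorem IsHarmonicMeasureAt.integral_regCoulomb_le {d : ℕ} (hd : 2 ≤ d) {Ω : Set (Space d)}
    (hΩ : IsRegularDomain Ω) {x : Space d} (hx : x ∈ Ω) {m : Measure (Space d)}
    (hm : IsHarmonicMeasureAt Ω x m) {ε : ℝ} (hε : 0 < ε) (w : Space d) :
    ∫ z, regCoulomb ε (z - w) ∂m ≤ regCoulomb ε (x - w) := by
  have hs : ContDiff ℝ 2 fun z : Space d => regCoulomb ε (z - w) :=
    (contDiff_regCoulomb (n := 2) hε).comp (contDiff_id.sub contDiff_const)
  obtain ⟨u, hu⟩ := hΩ.solvable _ hs.continuous.continuousOn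
  rw [← hm.represents _ u hu]
  -- The kernel minus its harmonic replacement vanishes on the boundary and has negative Laplacian,
  -- so it is nonnegative inside.
  have h := nonneg_of_laplacian_neg hΩ.isOpen hΩ.isBounded
    (ψ := (fun z : Space d => regCoulomb ε (z - w)) - u)
    (fun y hy => hs.contDiffAt.sub (hu.harmonic y hy).1)
    (hs.continuous.continuousOn.sub hu.continuousOn)
    (fun y hy => by
      rw [ContDiffAt.laplacian_sub hs.contDiffAt (hu.harmonic y hy).1,
        (hu.harmonic y hy).2.eq_of_nhds,
        laplacian_comp_sub_const (contDiff_regCoulomb (n := 2) hε)]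
      simpa using laplacian_regCoulomb_neg hd hε (y - w))
    (fun y hy => by simp [hu.boundary y hy]) x hx
  simpa using h

/-- The Riesz decomposition of the potential of a regular charge in a regular domain. -/
theorem IsRegularCharge.integral_green {d : ℕ} (hd : 2 ≤ d) {Ω : Set (Space d)}
    (hΩ : IsRegularDomain Ω) {x : Space d} {m : Measure (Space d)}
    (hm : IsHarmonicMeasureAt Ω x m) {ν : Measure (Space d)} (h : IsRegularCharge ν) :
    IntegrableOn (green Ω x) Ω ν ∧
      ∫ y in Ω, green Ω x y ∂ν = potential ν x - ∫ z, potential ν z ∂m := by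
  have := hm.isProbabilityMeasure
  obtain ⟨R, hR⟩ := hm.ae_norm_le hΩ.isBounded
  have hin : IsRegularCharge (ν.restrict Ω) := h.mono Measure.restrict_le_self
  have hout : IsRegularCharge (ν.restrict Ωᶜ) := h.mono Measure.restrict_le_self
  have hsum : ∀ z, potential ν z = potential (ν.restrict Ω) z + potential (ν.restrict Ωᶜ) z :=
    fun z => by
      rw [← potential_add hin.toIsCharge hout.toIsCharge,
        Measure.restrict_add_restrict_compl hΩ.isOpen.measurableSet]
  -- The potential of the charge outside Ω is its own Dirichlet solution, so x and the harmonic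
  -- measure see the same value and this part drops out of the right-hand side.
  have hd1 : IsDirichletSolution Ω (potential (ν.restrict Ωᶜ)) (potential (ν.restrict Ωᶜ)) :=
    ⟨hout.harmonicOnNhd hd hΩ.isOpen (by
      rw [Measure.restrict_apply hΩ.isOpen.measurableSet]; simp),
      hout.continuous.continuousOn, fun _ _ => rfl⟩
  have e1 := hm.represents _ _ hd1
  obtain ⟨i2, e2⟩ := hin.integral_potential hR
  have hae : ∀ᵐ y ∂(ν.restrict Ω), green Ω x y = coulomb (x - y) - ∫ z, coulomb (z - y) ∂m := by
    filter_upwards [ae_restrict_mem hΩ.isOpen.measurableSet] with y hy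
    exact hm.green_eq hΩ hy
  refine ⟨((hin.integrable x).sub i2).congr (hae.mono fun y hy => hy.symm), ?_⟩
  rw [integral_congr_ae hae, integral_sub (hin.integrable x) i2, ← e2]
  have i3 : Integrable (potential (ν.restrict Ω)) m :=
    hm.integrable hΩ.isBounded hin.continuous.continuousOn
  have i4 : Integrable (potential (ν.restrict Ωᶜ)) m :=
    hm.integrable hΩ.isBounded hout.continuous.continuousOn
  simp_rw [hsum]
  rw [integral_add i3 i4, ← e1]
  simp only [potential]
  ring

/-! ### Charges with bounded densities -/

theorem eq_integral_coulomb_mul_laplacian {d : ℕ} (hd : 2 ≤ d) {W : Space d → ℝ}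
    (hW : ContDiff ℝ 2 W) (hc : HasCompactSupport W) (x : Space d) :
    W x = -((coulombConst d)⁻¹ * ∫ y, coulomb (x - y) * Laplacian.laplacian W y) := by
  have hW' : ContDiff ℝ 2 fun z => W (x - z) := hW.comp (contDiff_const.sub contDiff_id)
  have hc' : HasCompactSupport fun z => W (x - z) :=
    hc.comp_homeomorph (Homeomorph.subLeft x)
  have h := integral_coulomb_mul_laplacian hd hW' hc'
  simp_rw [laplacian_comp_const_sub hW] at h
  have h2 := integral_sub_left_eq_self (fun y => coulomb (x - y) * Laplacian.laplacian W y)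
    (volume : Measure (Space d)) x
  simp only [sub_sub_cancel, sub_zero] at h2 h
  rw [h] at h2
  rw [← h2]
  field_simp [(coulombConst_pos hd).ne']

theorem isCharge_withDensity {d : ℕ} (hd : 2 ≤ d) {ρ : Space d → ℝ} (hρ : Measurable ρ)
    (h0 : ∀ x, 0 ≤ ρ x) {C R : ℝ} (hC : ∀ x, ρ x ≤ C) (hR : ∀ x, R < ‖x‖ → ρ x = 0) :
    IsCharge (volume.withDensity fun x => ENNReal.ofReal (ρ x)) where
  isFinite := by
    refine isFiniteMeasure_withDensity ?_
    have : ∫⁻ x, ENNReal.ofReal (ρ x) ≤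
        ∫⁻ x in Metric.closedBall (0 : Space d) R, ENNReal.ofReal C := by
      rw [← lintegral_indicator measurableSet_closedBall]
      refine lintegral_mono fun x => ?_
      by_cases hx : x ∈ Metric.closedBall (0 : Space d) R
      · rw [Set.indicator_of_mem hx]; exact ENNReal.ofReal_le_ofReal (hC x)
      · rw [Set.indicator_of_notMem hx, hR x (by simpa using hx)]; simp
    refine (this.trans_lt ?_).ne
    rw [lintegral_const]
    exact ENNReal.mul_lt_top ENNReal.ofReal_lt_top (by simp [measure_closedBall_lt_top])
  compact := ⟨R, by
    rw [withDensity_apply _ measurableSet_closedBall.compl, setLIntegral_eq_zero_iff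
      measurableSet_closedBall.compl (by fun_prop)]
    refine Eventually.of_forall fun x hx => ?_
    rw [hR x (by simpa using hx)]; simp⟩
  noAtom x := by
    have : Nontrivial (Space d) := Module.nontrivial_of_finrank_pos (R := ℝ) (by simp; omega)
    exact withDensity_absolutelyContinuous _ _ (measure_singleton x)
  integrable x := by
    rw [integrable_withDensity_iff_integrable_smul₀' (by fun_prop) (by simp)]
    have h1 : IntegrableOn (fun y => coulomb (x - y)) (Metric.closedBall (0 : Space d) R) := by
      have h2 : LocallyIntegrable fun y : Space d => coulomb (x - y) := by
        rw [locallyIntegrable_iff]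
        intro K hK
        have hK' : IsCompact ((fun y => x - y) '' K) := hK.image (by fun_prop)
        have := (locallyIntegrable_coulomb hd).integrableOn_isCompact hK'
        have hmp := Measure.measurePreserving_sub_left (volume : Measure (Space d)) x
        have := (hmp.integrableOn_comp_preimage
          (Homeomorph.subLeft x).measurableEmbedding).2 this
        exact this.mono_set (Set.subset_preimage_image _ _)
      exact h2.integrableOn_isCompact (isCompact_closedBall _ _)
    have h3 : Integrable ((Metric.closedBall (0 : Space d) R).indicator fun y =>
        |C| * |coulomb (x - y)|) :=
      (integrable_indicator_iff measurableSet_closedBall).2 (h1.abs.const_mul _)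
    refine h3.mono' (by fun_prop) (Eventually.of_forall fun y => ?_)
    rw [ENNReal.toReal_ofReal (h0 y), smul_eq_mul, norm_mul, Real.norm_of_nonneg (h0 y)]
    by_cases hy : y ∈ Metric.closedBall (0 : Space d) R
    · rw [Set.indicator_of_mem hy]
      exact mul_le_mul_of_nonneg_right ((hC y).trans (le_abs_self C)) (abs_nonneg _)
    · rw [Set.indicator_of_notMem hy, hR y (by simpa using hy), zero_mul]

theorem integral_withDensity_ofReal {d : ℕ} {ρ : Space d → ℝ} (hρ : Measurable ρ)
    (h0 : ∀ x, 0 ≤ ρ x) (s : Set (Space d)) (hs : MeasurableSet s) (f : Space d → ℝ) :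
    ∫ y in s, f y ∂(volume.withDensity fun x => ENNReal.ofReal (ρ x)) = ∫ y in s, f y * ρ y := by
  rw [restrict_withDensity hs, integral_withDensity_eq_integral_toReal_smul (by fun_prop)
    (Eventually.of_forall fun _ => ENNReal.ofReal_lt_top)]
  refine integral_congr_ae (Eventually.of_forall fun y => ?_)
  simp [ENNReal.toReal_ofReal (h0 y), mul_comm]

/-- A bounded density with bounded support is dominated by a multiple of a smooth cutoff, whose
potential is the convolution of a continuous compactly supported function with a locally integrable
kernel. Continuity passes to smaller charges by `IsRegularCharge.mono`. -/
theorem isRegularCharge_withDensity {d : ℕ} (hd : 2 ≤ d) {ρ : Space d → ℝ}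
    (h0 : ∀ x, 0 ≤ ρ x) {C R : ℝ} (hC : ∀ x, ρ x ≤ C) (hR : ∀ x, R < ‖x‖ → ρ x = 0) :
    IsRegularCharge (volume.withDensity fun x => ENNReal.ofReal (ρ x)) := by
  obtain ⟨χ, hχ, hχc, hχ0, hχle, hχ1, hχz⟩ := exists_smooth_cutoff (d := d)
    (show 0 < max R 1 by positivity)
  have hC0 : 0 ≤ C := (h0 0).trans (hC 0)
  have hch : IsCharge (volume.withDensity fun x => ENNReal.ofReal (C * χ x)) := by
    refine isCharge_withDensity hd (hχ.continuous.measurable.const_mul C)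
      (fun x => mul_nonneg hC0 (hχ0 x)) (C := C)
      (R := 2 * max R 1) (fun x => mul_le_of_le_one_right hC0 (hχle x)) fun x hx => ?_
    rw [hχz x (by simp; linarith), mul_zero]
  have hreg : IsRegularCharge (volume.withDensity fun x => ENNReal.ofReal (C * χ x)) := by
    refine ⟨hch, ?_⟩
    have hcc : HasCompactSupport fun x => C * χ x := hχc.mul_left
    have h1 := hcc.continuous_convolution_left (ContinuousLinearMap.mul ℝ ℝ)
      (continuous_const.mul hχ.continuous) (locallyIntegrable_coulomb hd)
    have e : potential (volume.withDensity fun x => ENNReal.ofReal (C * χ x)) =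
        convolution (fun x => C * χ x) coulomb (ContinuousLinearMap.mul ℝ ℝ) volume := by
      ext x
      have := integral_withDensity_ofReal (hχ.continuous.measurable.const_mul C)
        (fun x => mul_nonneg hC0 (hχ0 x)) Set.univ MeasurableSet.univ fun y => coulomb (x - y)
      simp only [Measure.restrict_univ] at this
      rw [potential, this, convolution]
      simp [mul_comm]
    rw [e]; exact h1
  refine hreg.mono (withDensity_mono (Eventually.of_forall fun x => ENNReal.ofReal_le_ofReal ?_))
  by_cases hx : ‖x‖ ≤ max R 1
  · rw [hχ1 x (by simpa using hx), mul_one]; exact hC x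
  · rw [hR x ((le_max_left _ _).trans_lt (not_le.1 hx))]
    exact mul_nonneg hC0 (hχ0 x)

/-- The Riesz decomposition of a `C²` function in a regular domain. -/
theorem dirichletPotential_laplacian {d : ℕ} (hd : 2 ≤ d) {Ω : Set (Space d)}
    (hΩ : IsRegularDomain Ω) {x : Space d} (hx : x ∈ Ω) {m : Measure (Space d)}
    (hm : IsHarmonicMeasureAt Ω x m) {V : Space d → ℝ} (hV : ContDiff ℝ 2 V) :
    dirichletPotential Ω volume (fun z => (coulombConst d)⁻¹ * Laplacian.laplacian V z) x =
      -V x + ∫ z, V z ∂m := by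
  obtain ⟨R₀, hR₀⟩ := hΩ.isBounded.closure.subset_closedBall 0
  set R := |R₀| + 1 with hRdef
  have hR0 : 0 < R := by positivity
  have hlt : ∀ z ∈ closure Ω, ‖z‖ < R := fun z hz => by
    have : ‖z‖ ≤ R₀ := by simpa using hR₀ hz
    rw [hRdef]; linarith [le_abs_self R₀]
  obtain ⟨χ, hχ, hχc, -, -, hχ1, -⟩ := exists_smooth_cutoff (d := d) hR0
  -- W agrees with V near the closure of Ω, and its compact support allows it to be recovered from
  -- its Laplacian.
  set W : Space d → ℝ := fun z => χ z * V z with hWd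
  have hW : ContDiff ℝ 2 W := (contDiff_infty.1 hχ 2).mul hV
  have hWc : HasCompactSupport W := hχc.mul_right
  have hWV : ∀ z, ‖z‖ < R → W =ᶠ[𝓝 z] V := fun z hz => by
    filter_upwards [(isOpen_lt continuous_norm continuous_const).mem_nhds hz] with y hy
    have : ‖y‖ ≤ R := le_of_lt hy
    simp [hWd, hχ1 y (by simpa using this)]
  have hL := continuous_laplacian hW
  have hLc := hasCompactSupport_laplacian hWc
  obtain ⟨C, hC⟩ := hLc.exists_bound_of_continuous hL
  obtain ⟨R', hR'⟩ := hLc.isCompact.isBounded.subset_closedBall 0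
  have hL0 : ∀ z, R' < ‖z‖ → Laplacian.laplacian W z = 0 := fun z hz => by
    by_contra h
    have := hR' (subset_tsupport _ h)
    simp at this; linarith
  -- The signs s = 1 and s = -1 give the positive and negative parts of ΔW, two regular charges to
  -- which the Riesz decomposition applies separately.
  have hreg : ∀ s : ℝ, |s| = 1 → IsRegularCharge
      (volume.withDensity fun z => ENNReal.ofReal (max (s * Laplacian.laplacian W z) 0)) := by
    intro s hs
    refine isRegularCharge_withDensity hd (fun z => le_max_right _ _) (C := C)
      (R := R') (fun z => ?_) fun z hz => by simp [hL0 z hz]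
    refine max_le ?_ ((norm_nonneg _).trans (hC z))
    refine (le_abs_self _).trans ?_
    rw [abs_mul, hs, one_mul]; exact hC z
  have hp := hreg 1 (by norm_num)
  have hn := hreg (-1) (by norm_num)
  have hden : ∀ s : ℝ, ∀ t : Set (Space d), MeasurableSet t → ∀ f : Space d → ℝ,
      ∫ y in t, f y ∂(volume.withDensity fun z =>
        ENNReal.ofReal (max (s * Laplacian.laplacian W z) 0)) =
      ∫ y in t, f y * max (s * Laplacian.laplacian W y) 0 := fun s t ht f =>
    integral_withDensity_ofReal (by fun_prop) (fun z => le_max_right _ _) t ht f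
  have hpm : ∀ z, max (1 * Laplacian.laplacian W z) 0 - max (-1 * Laplacian.laplacian W z) 0 =
      Laplacian.laplacian W z := fun z => by
    rw [one_mul, neg_one_mul, max_zero_sub_max_neg_zero_eq_self]
  have hintd : ∀ s : ℝ, ∀ t : Set (Space d), MeasurableSet t → ∀ f : Space d → ℝ,
      IntegrableOn f t (volume.withDensity fun z =>
        ENNReal.ofReal (max (s * Laplacian.laplacian W z) 0)) →
      IntegrableOn (fun y => f y * max (s * Laplacian.laplacian W y) 0) t := fun s t ht f hf => by
    rw [IntegrableOn, restrict_withDensity ht,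
      integrable_withDensity_iff_integrable_smul₀' (by fun_prop) (by simp)] at hf
    refine hf.congr (Eventually.of_forall fun y => ?_)
    simp only
    rw [ENNReal.toReal_ofReal (le_max_right _ _), smul_eq_mul, mul_comm]
  have hWpot : ∀ z, W z = -((coulombConst d)⁻¹ * (potential (volume.withDensity fun z =>
        ENNReal.ofReal (max (1 * Laplacian.laplacian W z) 0)) z - potential
        (volume.withDensity fun z => ENNReal.ofReal (max (-1 * Laplacian.laplacian W z) 0)) z)) :=
    fun z => by
      rw [eq_integral_coulomb_mul_laplacian hd hW hWc z]
      have h1 := hden 1 Set.univ MeasurableSet.univ fun y => coulomb (z - y)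
      have h2 := hden (-1) Set.univ MeasurableSet.univ fun y => coulomb (z - y)
      have i1 := hintd 1 Set.univ MeasurableSet.univ _ (hp.integrable z).integrableOn
      have i2 := hintd (-1) Set.univ MeasurableSet.univ _ (hn.integrable z).integrableOn
      rw [integrableOn_univ] at i1 i2
      simp only [Measure.restrict_univ] at h1 h2
      unfold potential
      rw [h1, h2, ← integral_sub i1 i2]
      simp_rw [← mul_sub, hpm]
  obtain ⟨g1, e1⟩ := hp.integral_green hd hΩ hm
  obtain ⟨g2, e2⟩ := hn.integral_green hd hΩ hm
  rw [hden _ _ hΩ.isOpen.measurableSet] at e1 e2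
  have j1 := hintd 1 _ hΩ.isOpen.measurableSet _ g1
  have j2 := hintd (-1) _ hΩ.isOpen.measurableSet _ g2
  have hWm : ∫ z, W z ∂m = ∫ z, V z ∂m := by
    refine integral_congr_ae ?_
    filter_upwards [hm.ae_mem_frontier] with z hz
    exact (hWV z (hlt z (frontier_subset_closure hz))).eq_of_nhds
  have hm1 : Integrable _ m := hm.integrable hΩ.isBounded hp.continuous.continuousOn
  have hm2 : Integrable _ m := hm.integrable hΩ.isBounded hn.continuous.continuousOn
  rw [← hWm, ← (hWV x (hlt x (subset_closure hx))).eq_of_nhds, dirichletPotential, if_pos hx]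
  have hLV : ∀ y ∈ Ω, green Ω x y * ((coulombConst d)⁻¹ * Laplacian.laplacian V y) =
      (coulombConst d)⁻¹ * (green Ω x y * max (1 * Laplacian.laplacian W y) 0 -
        green Ω x y * max (-1 * Laplacian.laplacian W y) 0) := fun y hy => by
    rw [← mul_sub, hpm, (InnerProductSpace.laplacian_congr_nhds
      (hWV y (hlt y (subset_closure hy)))).eq_of_nhds]
    ring
  rw [setIntegral_congr_fun hΩ.isOpen.measurableSet hLV, integral_const_mul, integral_sub j1 j2,
    e1, e2]
  simp_rw [hWpot]
  rw [integral_neg, integral_const_mul, integral_sub hm1 hm2]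
  ring

/-! ### Jensen's inequality for Boltzmann factors -/

open scoped Classical in
/-- The pair Boltzmann factor `e^{-β g}`, with its true value `0` at the origin. -/
noncomputable def coulombExp {d : ℕ} (β : ℝ) (x : Space d) : ℝ :=
  if x = 0 then 0 else Real.exp (-β * coulomb x)

theorem coulombExp_of_ne {d : ℕ} (β : ℝ) {x : Space d} (hx : x ≠ 0) :
    coulombExp β x = Real.exp (-β * coulomb x) := if_neg hx

theorem coulombExp_zero {d : ℕ} (β : ℝ) : coulombExp β (0 : Space d) = 0 := if_pos rfl

theorem coulombExp_nonneg {d : ℕ} (β : ℝ) (x : Space d) : 0 ≤ coulombExp β x := by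
  unfold coulombExp; split_ifs <;> positivity

theorem tendsto_coulomb_zero {d : ℕ} (hd : 2 ≤ d) :
    Tendsto (coulomb (d := d)) (𝓝[≠] 0) atTop := by
  refine (tendsto_coulombProfile_zero hd).comp ?_
  exact tendsto_norm_nhdsNE_zero

/-- Repulsion removes the singularity: g tends to +∞ at the origin and β > 0, so the pair factor
tends to its assigned value 0 there. -/
theorem continuous_coulombExp {d : ℕ} (hd : 2 ≤ d) {β : ℝ} (hβ : 0 < β) :
    Continuous (coulombExp (d := d) β) := by
  rw [continuous_iff_continuousAt]
  intro x
  rcases eq_or_ne x 0 with rfl | hx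
  · rw [← continuousWithinAt_compl_self, ContinuousWithinAt, coulombExp_zero]
    have h1 : Tendsto (fun x : Space d => Real.exp (-β * coulomb x)) (𝓝[≠] 0) (𝓝 0) := by
      refine Real.tendsto_exp_atBot.comp ?_
      exact (tendsto_coulomb_zero hd).const_mul_atTop_of_neg (neg_lt_zero.2 hβ)
    refine h1.congr' ?_
    filter_upwards [self_mem_nhdsWithin] with y hy using (coulombExp_of_ne β hy).symm
  · have h1 : ContinuousAt (fun x : Space d => Real.exp (-β * coulomb x)) x :=
      (continuousAt_const.mul (continuousAt_coulomb hx)).rexp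
    refine h1.congr ?_
    filter_upwards [isOpen_compl_singleton.mem_nhds hx] with y hy
    exact (coulombExp_of_ne β hy).symm

theorem tendsto_exp_regCoulomb {d : ℕ} (hd : 2 ≤ d) {β : ℝ} (hβ : 0 < β) (x : Space d) :
    Tendsto (fun ε => Real.exp (-β * regCoulomb ε x)) (𝓝[>] 0) (𝓝 (coulombExp β x)) := by
  rcases eq_or_ne x 0 with rfl | hx
  · rw [coulombExp_zero]
    exact Real.tendsto_exp_atBot.comp
      ((tendsto_regCoulomb_zero hd).const_mul_atTop_of_neg (neg_lt_zero.2 hβ))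
  · rw [coulombExp_of_ne β hx]
    exact (Real.continuous_exp.tendsto _).comp ((tendsto_regCoulomb hx).const_mul _)

/-- `m` averages every regularized Coulomb kernel to at most its value at `x`. -/
structure IsSuperAveraging {d : ℕ} (m : Measure (Space d)) (x : Space d) : Prop where
  isProbabilityMeasure : IsProbabilityMeasure m
  compact : ∃ R : ℝ, ∀ᵐ z ∂m, ‖z‖ ≤ R
  integral_le : ∀ ε > 0, ∀ w, ∫ z, regCoulomb ε (z - w) ∂m ≤ regCoulomb ε (x - w)

theorem IsSuperAveraging.integrable {d : ℕ} {m : Measure (Space d)} {x : Space d}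
    (hm : IsSuperAveraging m x) {f : Space d → ℝ} (hf : Continuous f) : Integrable f m := by
  have := hm.isProbabilityMeasure
  obtain ⟨R, hR⟩ := hm.compact
  have h1 : m.restrict (Metric.closedBall 0 R) = m :=
    Measure.restrict_eq_self_of_ae_mem (by simpa using hR)
  rw [← h1]
  exact hf.continuousOn.integrableOn_compact (isCompact_closedBall _ _)

/-- Jensen's inequality is applied to β (U - ∑ g_ε(· - q_i)): the m-average of this exponent is at
least β ∫ U dm - β ∑ g_ε(x - q_i), because each kernel is averaged to at most its value at x. Then ε
→ 0. The prefactor depends on U and a only, not on the charges q_i. -/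
theorem IsSuperAveraging.exp_mul_prod_le {d : ℕ} (hd : 2 ≤ d) {m : Measure (Space d)}
    {x : Space d} (hm : IsSuperAveraging m x) {β : ℝ} (hβ : 0 < β) {U : Space d → ℝ}
    (hU : AEStronglyMeasurable U m) {C : ℝ} (hC : ∀ᵐ z ∂m, |U z| ≤ C) (a : ℝ) {ι : Type*}
    (s : Finset ι) (q : ι → Space d) :
    ENNReal.ofReal (Real.exp (β * a) * ∏ i ∈ s, coulombExp β (x - q i)) ≤
      ENNReal.ofReal (Real.exp (β * (a - ∫ z, U z ∂m))) *
        ∫⁻ z, ENNReal.ofReal (Real.exp (β * U z) * ∏ i ∈ s, coulombExp β (z - q i)) ∂m := by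
  have := hm.isProbabilityMeasure
  by_cases hx : ∃ i ∈ s, x - q i = 0
  · obtain ⟨i, hi, h0⟩ := hx
    rw [Finset.prod_eq_zero hi (by rw [h0, coulombExp_zero])]
    simp
  push Not at hx
  have hev : ∀ᶠ ε : ℝ in 𝓝[>] 0, 0 < ε ∧ ε ≤ 1 := by
    filter_upwards [Ioc_mem_nhdsGT one_pos] with ε h using h
  have hUi : Integrable U m := Integrable.of_bound hU C hC
  have hregi : ∀ ε > 0, ∀ w, Integrable (fun z => regCoulomb ε (z - w)) m := fun ε hε w =>
    hm.integrable ((continuous_regCoulomb hε).comp (by fun_prop))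
  set P : ℝ → Space d → ℝ := fun ε z => ∏ i ∈ s, Real.exp (-β * regCoulomb ε (z - q i)) with hP
  have hPc : ∀ ε > 0, Continuous (P ε) := fun ε hε => by
    refine continuous_finsetProd _ fun i _ => ?_
    exact (continuous_const.mul ((continuous_regCoulomb hε).comp (by fun_prop))).rexp
  have hP0 : ∀ ε z, 0 ≤ P ε z := fun ε z => Finset.prod_nonneg fun i _ => (Real.exp_pos _).le
  -- Decreasing ε increases the kernels and decreases the pair factors, so ε = 1 dominates the whole
  -- family.
  have hPmono : ∀ ε, 0 < ε → ε ≤ 1 → ∀ z, P ε z ≤ P 1 z := fun ε h0 h1 z => by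
    refine Finset.prod_le_prod (fun i _ => (Real.exp_pos _).le) fun i _ => ?_
    refine Real.exp_le_exp.2 ?_
    have := regCoulomb_anti h0 h1 (z - q i)
    nlinarith
  have hdom : Integrable (fun z => Real.exp (β * C) * P 1 z) m :=
    (hm.integrable (hPc 1 one_pos)).const_mul _
  have hexpU : ∀ᵐ z ∂m, Real.exp (β * U z) ≤ Real.exp (β * C) := by
    filter_upwards [hC] with z hz
    exact Real.exp_le_exp.2 (mul_le_mul_of_nonneg_left ((le_abs_self _).trans hz) hβ.le)
  have hUexp : AEStronglyMeasurable (fun z => Real.exp (β * U z)) m :=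
    Real.continuous_exp.comp_aestronglyMeasurable (hU.const_mul β)
  have hint : ∀ ε, 0 < ε → ε ≤ 1 → Integrable (fun z => Real.exp (β * U z) * P ε z) m :=
    fun ε h0 h1 => by
      refine hdom.mono' (hUexp.mul (hPc ε h0).aestronglyMeasurable) ?_
      filter_upwards [hexpU] with z hz
      rw [norm_mul, Real.norm_of_nonneg (Real.exp_pos _).le, Real.norm_of_nonneg (hP0 _ _)]
      exact mul_le_mul hz (hPmono ε h0 h1 z) (hP0 _ _) (Real.exp_pos _).le
  have hlim0 : ∀ z, Tendsto (fun ε => P ε z) (𝓝[>] 0) (𝓝 (∏ i ∈ s, coulombExp β (z - q i))) :=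
    fun z => tendsto_finsetProd _ fun i _ => tendsto_exp_regCoulomb hd hβ _
  have hint0 : Integrable (fun z => Real.exp (β * U z) * ∏ i ∈ s, coulombExp β (z - q i)) m := by
    refine hdom.mono' (hUexp.mul (continuous_finsetProd _ fun i _ =>
      (continuous_coulombExp hd hβ).comp (by fun_prop)).aestronglyMeasurable) ?_
    filter_upwards [hexpU] with z hz
    have h1 : ∏ i ∈ s, coulombExp β (z - q i) ≤ P 1 z :=
      le_of_tendsto (hlim0 z) (hev.mono fun ε h => hPmono ε h.1 h.2 z)
    have h2 : 0 ≤ ∏ i ∈ s, coulombExp β (z - q i) :=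
      Finset.prod_nonneg fun i _ => coulombExp_nonneg _ _
    rw [norm_mul, Real.norm_of_nonneg (Real.exp_pos _).le, Real.norm_of_nonneg h2]
    exact mul_le_mul hz h1 h2 (Real.exp_pos _).le
  have hlim : Tendsto (fun ε => ∫ z, Real.exp (β * U z) * P ε z ∂m) (𝓝[>] 0)
      (𝓝 (∫ z, Real.exp (β * U z) * ∏ i ∈ s, coulombExp β (z - q i) ∂m)) := by
    refine tendsto_integral_filter_of_dominated_convergence _ ?_ ?_ hdom ?_
    · filter_upwards [hev] with ε hε using (hint ε hε.1 hε.2).aestronglyMeasurable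
    · filter_upwards [hev] with ε hε
      filter_upwards [hexpU] with z hz
      rw [norm_mul, Real.norm_of_nonneg (Real.exp_pos _).le, Real.norm_of_nonneg (hP0 _ _)]
      exact mul_le_mul hz (hPmono ε hε.1 hε.2 z) (hP0 _ _) (Real.exp_pos _).le
    · exact Eventually.of_forall fun z => (hlim0 z).const_mul _
  have hPe : ∀ ε z, P ε z = Real.exp (∑ i ∈ s, -β * regCoulomb ε (z - q i)) := fun ε z =>
    (Real.exp_sum _ _).symm
  have hexp : ∀ ε z, Real.exp (β * U z) * P ε z =
      Real.exp (β * U z - β * ∑ i ∈ s, regCoulomb ε (z - q i)) := fun ε z => by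
    rw [hPe, ← Real.exp_add, Finset.mul_sum]
    simp only [neg_mul, Finset.sum_neg_distrib]
    rw [← sub_eq_add_neg]
  have hjensen : ∀ ε, 0 < ε → ε ≤ 1 → Real.exp (β * a) * P ε x ≤
      Real.exp (β * (a - ∫ z, U z ∂m)) * ∫ z, Real.exp (β * U z) * P ε z ∂m := fun ε h0 h1 => by
    have hT : Integrable (fun z => β * U z - β * ∑ i ∈ s, regCoulomb ε (z - q i)) m :=
      (hUi.const_mul β).sub ((integrable_finsetSum _ fun i _ => hregi ε h0 (q i)).const_mul β)
    have hj := convexOn_exp.map_integral_le (μ := m) (f := fun z => β * U z - β *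
      ∑ i ∈ s, regCoulomb ε (z - q i)) Real.continuous_exp.continuousOn isClosed_univ
      (by simp) hT ((hint ε h0 h1).congr (Eventually.of_forall fun z => hexp ε z))
    have hcalc : ∫ z, (β * U z - β * ∑ i ∈ s, regCoulomb ε (z - q i)) ∂m ≥
        β * ∫ z, U z ∂m - β * ∑ i ∈ s, regCoulomb ε (x - q i) := by
      rw [integral_sub (hUi.const_mul β)
        ((integrable_finsetSum _ fun i _ => hregi ε h0 (q i)).const_mul β), integral_const_mul,
        integral_const_mul, integral_finsetSum _ fun i _ => hregi ε h0 (q i)]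
      have := Finset.sum_le_sum fun i (_ : i ∈ s) => hm.integral_le ε h0 (q i)
      have := mul_le_mul_of_nonneg_left this hβ.le
      linarith
    have hj2 := (Real.exp_le_exp.2 hcalc).trans hj
    simp_rw [hexp]
    have e : Real.exp (β * a) * P ε x = Real.exp (β * (a - ∫ z, U z ∂m)) *
        Real.exp (β * ∫ z, U z ∂m - β * ∑ i ∈ s, regCoulomb ε (x - q i)) := by
      rw [hPe, ← Real.exp_add, ← Real.exp_add, Finset.mul_sum]
      simp only [neg_mul, Finset.sum_neg_distrib]
      congr 1; ring
    rw [e]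
    exact mul_le_mul_of_nonneg_left hj2 (Real.exp_pos _).le
  have hfinal := le_of_tendsto_of_tendsto ((hlim0 x).const_mul (Real.exp (β * a)))
    (hlim.const_mul _) (hev.mono fun ε h => hjensen ε h.1 h.2)
  refine (ENNReal.ofReal_le_ofReal hfinal).trans ?_
  rw [ENNReal.ofReal_mul (Real.exp_pos _).le, ofReal_integral_eq_lintegral_ofReal hint0
    (Eventually.of_forall fun z => mul_nonneg (Real.exp_pos _).le
      (Finset.prod_nonneg fun i _ => coulombExp_nonneg _ _))]

theorem IsHarmonicMeasureAt.isSuperAveraging {d : ℕ} (hd : 2 ≤ d) {Ω : Set (Space d)}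
    (hΩ : IsRegularDomain Ω) {x : Space d} (hx : x ∈ Ω) {m : Measure (Space d)}
    (hm : IsHarmonicMeasureAt Ω x m) : IsSuperAveraging m x :=
  ⟨hm.isProbabilityMeasure, hm.ae_norm_le hΩ.isBounded,
    fun _ hε w => hm.integral_regCoulomb_le hd hΩ hx hε w⟩

/-- The uniform probability measure on the ball of radius `r` around `x`. -/
noncomputable def ballMeasure {d : ℕ} (x : Space d) (r : ℝ) : Measure (Space d) :=
  (unitBallMeasure d).map fun z => x + r • z

theorem integral_ballMeasure {d : ℕ} (x : Space d) {r : ℝ} (hr : 0 < r) (f : Space d → ℝ) :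
    ∫ z, f z ∂(ballMeasure x r) = ballAvg r f x :=
  ((Homeomorph.smulOfNeZero r hr.ne').trans
    (Homeomorph.addLeft x)).measurableEmbedding.integral_map (μ := unitBallMeasure d) f

theorem isSuperAveraging_ballMeasure {d : ℕ} (hd : 2 ≤ d) (x : Space d) {r : ℝ} (hr : 0 < r) :
    IsSuperAveraging (ballMeasure x r) x where
  isProbabilityMeasure := Measure.isProbabilityMeasure_map (by fun_prop)
  compact := by
    refine ⟨‖x‖ + r, ?_⟩
    rw [ballMeasure, ae_map_iff (by fun_prop) (measurableSet_le measurable_norm measurable_const)]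
    filter_upwards [ae_unitBallMeasure d] with z hz
    refine (norm_add_le _ _).trans (add_le_add le_rfl ?_)
    rw [norm_smul, Real.norm_of_nonneg hr.le]
    exact mul_le_of_le_one_right hr.le hz.le
  integral_le ε hε w := by
    rw [integral_ballMeasure x hr, ballAvg_comp_sub]
    exact ballAvg_regCoulomb_le hd hε _ hr.le

/-! ### Splitting configurations -/

/-- The index equivalence underlying `joinConfig`. -/
def joinEquiv {N k : ℕ} (hk : k ≤ N) : Fin k ⊕ Fin (N - k) ≃ Fin N :=
  finSumFinEquiv.trans (finCongr (Nat.add_sub_cancel' hk))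

theorem joinConfig_joinEquiv_inl {d N k : ℕ} (hk : k ≤ N) (y : Fin k → Space d)
    (w : Fin (N - k) → Space d) (a : Fin k) : joinConfig y w (joinEquiv hk (Sum.inl a)) = y a := by
  simp [joinConfig, joinEquiv]

theorem joinConfig_joinEquiv_inr {d N k : ℕ} (hk : k ≤ N) (y : Fin k → Space d)
    (w : Fin (N - k) → Space d) (b : Fin (N - k)) :
    joinConfig y w (joinEquiv hk (Sum.inr b)) = w b := by
  simp [joinConfig, joinEquiv]

theorem measurePreserving_joinConfig {d N k : ℕ} (hk : k ≤ N) :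
    MeasurePreserving (fun p : (Fin k → Space d) × (Fin (N - k) → Space d) =>
      (joinConfig p.1 p.2 : Fin N → Space d)) (volume.prod volume) volume := by
  have h1 := volume_measurePreserving_sumPiEquivProdPi_symm
    (fun _ : Fin k ⊕ Fin (N - k) => Space d)
  have h2 := volume_measurePreserving_piCongrLeft (fun _ : Fin N => Space d) (joinEquiv hk)
  have h3 := h2.comp h1
  have e : (fun p : (Fin k → Space d) × (Fin (N - k) → Space d) =>
      (joinConfig p.1 p.2 : Fin N → Space d)) =
      (MeasurableEquiv.piCongrLeft (fun _ : Fin N => Space d) (joinEquiv hk)) ∘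
        (MeasurableEquiv.sumPiEquivProdPi (fun _ : Fin k ⊕ Fin (N - k) => Space d)).symm := by
    ext1 p
    funext i
    obtain ⟨a, rfl⟩ := (joinEquiv hk).surjective i
    rw [Function.comp_apply, MeasurableEquiv.coe_piCongrLeft, Equiv.piCongrLeft_apply_apply]
    rcases a with a | b
    · rw [joinConfig_joinEquiv_inl]; rfl
    · rw [joinConfig_joinEquiv_inr]; rfl
  rw [e]
  exact h3

theorem joinConfig_apply_castLE {d N k : ℕ} (hk : k ≤ N) (y : Fin k → Space d)
    (w : Fin (N - k) → Space d) : (fun i => (joinConfig y w : Fin N → Space d) (Fin.castLE hk i)) = y := by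
  funext i
  simp [joinConfig]

theorem lintegral_joinConfig {d N k : ℕ} (hk : k ≤ N) {F : (Fin N → Space d) → ℝ≥0∞}
    (hF : Measurable F) :
    ∫⁻ X, F X = ∫⁻ y : Fin k → Space d, ∫⁻ w : Fin (N - k) → Space d, F (joinConfig y w) := by
  have h := measurePreserving_joinConfig (d := d) hk
  rw [← h.lintegral_comp hF]
  exact lintegral_prod (fun p : (Fin k → Space d) × (Fin (N - k) → Space d) =>
    F (joinConfig p.1 p.2)) (hF.comp h.measurable).aemeasurable

theorem measurable_joinConfig {d N k : ℕ} (hk : k ≤ N) :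
    Measurable (fun p : (Fin k → Space d) × (Fin (N - k) → Space d) =>
      (joinConfig p.1 p.2 : Fin N → Space d)) :=
  (measurePreserving_joinConfig hk).measurable

/-- The inserted particle comes first in `Fin.cons x y`, but it occupies position m when one more
particle is integrated out of the marginal at y. The cyclic shift of the first m + 1 indices relates
the two orders. -/
theorem joinConfig_cons_cycleRange {d N m : ℕ} (hm : m < N) (x : Space d) (y : Fin m → Space d)
    (w : Fin (N - (m + 1)) → Space d) :
    (joinConfig (Fin.cons x y : Fin (m + 1) → Space d) w : Fin N → Space d) ∘
      (Fin.cycleRange ⟨m, hm⟩) =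
      joinConfig y (joinConfig (N := N - m) (k := 1) (fun _ => x) w) := by
  have : NeZero N := ⟨by omega⟩
  funext i
  rw [Function.comp_apply]
  rcases lt_trichotomy i ⟨m, hm⟩ with h | h | h
  · have hi : (i : ℕ) < m := h
    have hv : ((Fin.cycleRange ⟨m, hm⟩ i : Fin N) : ℕ) = i + 1 := Fin.coe_cycleRange_of_lt h
    have e : ∀ v : ℕ, v = i + 1 → ∀ hv' : v < m + 1,
        (Fin.cons x y : Fin (m + 1) → Space d) ⟨v, hv'⟩ = y ⟨i, hi⟩ := by
      rintro v rfl hv'; rfl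
    simp only [joinConfig]
    rw [dif_pos (by omega), dif_pos hi, e _ hv]
  · subst h
    rw [Fin.cycleRange_self]
    simp [joinConfig]
  · have hi : m < (i : ℕ) := h
    rw [Fin.cycleRange_of_gt h]
    simp only [joinConfig]
    rw [dif_neg (by omega), dif_neg (by omega), dif_neg (by omega)]
    congr 1

/-! ### Boltzmann factors -/

theorem measurable_energy {d N : ℕ} {V : Space d → ℝ} (hV : Measurable V) :
    Measurable (energy (N := N) V) := by
  unfold energy
  refine Measurable.add (Measurable.const_mul (Finset.measurable_fun_sum _ fun i _ =>
    Finset.measurable_fun_sum _ fun j _ => ?_) _) (Finset.measurable_fun_sum _ fun i _ => ?_)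
  · exact measurable_coulomb.comp (by fun_prop)
  · exact hV.comp (measurable_pi_apply i)

theorem isOpen_injective {d N : ℕ} : IsOpen {X : Fin N → Space d | Function.Injective X} := by
  have : {X : Fin N → Space d | Function.Injective X} =
      ⋂ i, ⋂ j, ⋂ (_ : i ≠ j), {X : Fin N → Space d | X i ≠ X j} := by
    ext X
    simp only [Set.mem_ofPred_eq, Set.mem_iInter]
    exact ⟨fun h i j hij he => hij (h he), fun h i j he => by
      by_contra hij; exact h i j hij he⟩
  rw [this]
  refine isOpen_iInter_of_finite fun i => isOpen_iInter_of_finite fun j =>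
    isOpen_iInter_of_finite fun _ => ?_
  exact isOpen_ne_fun (continuous_apply i) (continuous_apply j)

theorem measurable_boltzmann {d N : ℕ} (β : ℝ) {V : Space d → ℝ} (hV : Measurable V) :
    Measurable (boltzmann (N := N) β V) := by
  unfold boltzmann
  exact Measurable.ite isOpen_injective.measurableSet
    ((Real.measurable_exp.comp ((measurable_energy hV).const_mul _)).ennreal_ofReal)
    measurable_const

theorem boltzmann_comp_perm {d N : ℕ} (β : ℝ) (V : Space d → ℝ) (X : Fin N → Space d)
    (e : Equiv.Perm (Fin N)) : boltzmann β V (X ∘ e) = boltzmann β V X := by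
  have h1 : energy V (X ∘ e) = energy V X := by
    unfold energy
    congr 1
    · congr 1
      rw [← Equiv.sum_comp e (fun i => ∑ j ∈ Finset.univ.erase i, coulomb (X i - X j))]
      refine Finset.sum_congr rfl fun i _ => ?_
      refine Finset.sum_equiv e (fun j => by simp) fun j _ => rfl
    · exact Equiv.sum_comp e fun i => V (X i)
  unfold boltzmann
  by_cases h : Function.Injective X
  · rw [if_pos ((e.injective_comp X).2 h), if_pos h, h1]
  · rw [if_neg fun h' => h ((e.injective_comp X).1 h'), if_neg h]

open scoped Classical in
/-- The part of the Boltzmann factor not involving the particle `i₀`. -/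
noncomputable def restFactor {d N : ℕ} (β : ℝ) (V : Space d → ℝ) (X : Fin N → Space d)
    (i₀ : Fin N) : ℝ≥0∞ :=
  if Set.InjOn X {i | i ≠ i₀} then
    ENNReal.ofReal (Real.exp (-β * ((1 / 2) * ∑ i ∈ Finset.univ.erase i₀,
      ∑ j ∈ (Finset.univ.erase i).erase i₀, coulomb (X i - X j) +
        ∑ i ∈ Finset.univ.erase i₀, V (X i))))
  else 0

/-- Every pair containing `i₀` occurs twice in the double sum, once in the row of `i₀` (`h1`) and
once in the row of the other particle (`h2`), which cancels the factor ½. -/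
theorem energy_update {d N : ℕ} (V : Space d → ℝ) (X : Fin N → Space d) (i₀ : Fin N)
    (x : Space d) : energy V (Function.update X i₀ x) =
      V x + ∑ i ∈ Finset.univ.erase i₀, coulomb (x - X i) + ((1 / 2) * ∑ i ∈ Finset.univ.erase i₀,
      ∑ j ∈ (Finset.univ.erase i).erase i₀, coulomb (X i - X j) +
        ∑ i ∈ Finset.univ.erase i₀, V (X i)) := by
  have hup : ∀ i ∈ Finset.univ.erase i₀, Function.update X i₀ x i = X i := fun i hi =>
    Function.update_of_ne (Finset.ne_of_mem_erase hi) _ _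
  rw [energy, ← Finset.add_sum_erase _ _ (Finset.mem_univ i₀),
    ← Finset.add_sum_erase (a := i₀) _ (fun i => V (Function.update X i₀ x i)) (Finset.mem_univ i₀)]
  have h1 : ∑ j ∈ Finset.univ.erase i₀, coulomb (Function.update X i₀ x i₀ -
      Function.update X i₀ x j) = ∑ i ∈ Finset.univ.erase i₀, coulomb (x - X i) :=
    Finset.sum_congr rfl fun i hi => by rw [hup i hi, Function.update_self]
  have h2 : ∑ i ∈ Finset.univ.erase i₀, ∑ j ∈ Finset.univ.erase i,
      coulomb (Function.update X i₀ x i - Function.update X i₀ x j) =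
      ∑ i ∈ Finset.univ.erase i₀, coulomb (x - X i) + ∑ i ∈ Finset.univ.erase i₀,
      ∑ j ∈ (Finset.univ.erase i).erase i₀, coulomb (X i - X j) := by
    rw [← Finset.sum_add_distrib]
    refine Finset.sum_congr rfl fun i hi => ?_
    rw [← Finset.add_sum_erase _ _ (Finset.mem_erase.2
      ⟨(Finset.ne_of_mem_erase hi).symm, Finset.mem_univ i₀⟩), hup i hi, Function.update_self,
      coulomb_sub_comm]
    congr 1
    refine Finset.sum_congr rfl fun j hj => ?_
    rw [hup j (Finset.mem_erase.2 ⟨Finset.ne_of_mem_erase hj, Finset.mem_univ _⟩)]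
  have h3 : ∑ i ∈ Finset.univ.erase i₀, V (Function.update X i₀ x i) =
      ∑ i ∈ Finset.univ.erase i₀, V (X i) := Finset.sum_congr rfl fun i hi => by rw [hup i hi]
  rw [h1, h2, h3, Function.update_self]
  ring

/-- This factorization isolates the dependence on one particle. The convention that `coulombExp`
vanishes at the origin makes it an identity also when particles coincide. -/
theorem boltzmann_update {d N : ℕ} (β : ℝ) (V : Space d → ℝ) (X : Fin N → Space d) (i₀ : Fin N)
    (x : Space d) : boltzmann β V (Function.update X i₀ x) =
      ENNReal.ofReal (Real.exp (-β * V x) * ∏ i ∈ Finset.univ.erase i₀, coulombExp β (x - X i)) *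
        restFactor β V X i₀ := by
  by_cases hx : ∃ i ∈ Finset.univ.erase i₀, x - X i = 0
  · obtain ⟨i, hi, h0⟩ := hx
    rw [Finset.prod_eq_zero hi (by rw [h0, coulombExp_zero]), boltzmann, if_neg]
    · simp
    · intro hinj
      refine Finset.ne_of_mem_erase hi (hinj ?_)
      rw [Function.update_self, Function.update_of_ne (Finset.ne_of_mem_erase hi)]
      exact (sub_eq_zero.1 h0).symm
  push Not at hx
  have hne : ∀ i, i ≠ i₀ → x ≠ X i := fun i hi h =>
    hx i (Finset.mem_erase.2 ⟨hi, Finset.mem_univ i⟩) (sub_eq_zero.2 h)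
  have hiff : Function.Injective (Function.update X i₀ x) ↔ Set.InjOn X {i | i ≠ i₀} := by
    constructor
    · intro h i hi j hj hij
      exact h (by rwa [Function.update_of_ne hi, Function.update_of_ne hj])
    · intro h i j hij
      by_cases hi : i = i₀ <;> by_cases hj : j = i₀
      · rw [hi, hj]
      · subst hi
        rw [Function.update_self, Function.update_of_ne hj] at hij
        exact absurd hij (hne j hj)
      · subst hj
        rw [Function.update_self, Function.update_of_ne hi] at hij
        exact absurd hij.symm (hne i hi)
      · rw [Function.update_of_ne hi, Function.update_of_ne hj] at hij
        exact h hi hj hij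
  rw [boltzmann, restFactor]
  by_cases hinj : Set.InjOn X {i | i ≠ i₀}
  · rw [if_pos (hiff.2 hinj), if_pos hinj, ← ENNReal.ofReal_mul
      (mul_nonneg (Real.exp_pos _).le (Finset.prod_nonneg fun i _ => coulombExp_nonneg _ _)),
      Finset.prod_congr rfl fun i hi => coulombExp_of_ne β (hx i hi), ← Real.exp_sum,
      ← Real.exp_add, ← Real.exp_add, energy_update, ← Finset.mul_sum]
    congr 2; ring
  · rw [if_neg (fun h => hinj (hiff.1 h)), if_neg hinj, mul_zero]

/-- The factor of the Boltzmann weight of `joinConfig (Fin.cons x y) w` not depending on `x`. -/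
noncomputable def joinRest {d m : ℕ} {N : ℕ} (hm : m + 1 ≤ N) (β : ℝ) (V : Space d → ℝ)
    (y : Fin m → Space d) (w : Fin (N - (m + 1)) → Space d) : ℝ≥0∞ :=
  restFactor β V (joinConfig (Fin.cons 0 y : Fin (m + 1) → Space d) w : Fin N → Space d)
    (joinEquiv hm (Sum.inl 0))

theorem joinConfig_cons_eq_update {d m N : ℕ} (hm : m + 1 ≤ N) (x : Space d) (y : Fin m → Space d)
    (w : Fin (N - (m + 1)) → Space d) :
    (joinConfig (Fin.cons x y : Fin (m + 1) → Space d) w : Fin N → Space d) =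
      Function.update (joinConfig (Fin.cons 0 y : Fin (m + 1) → Space d) w)
        (joinEquiv hm (Sum.inl 0)) x := by
  funext i
  obtain ⟨a, rfl⟩ := (joinEquiv hm).surjective i
  by_cases ha : a = Sum.inl 0
  · subst ha
    rw [Function.update_self, joinConfig_joinEquiv_inl, Fin.cons_zero]
  · rw [Function.update_of_ne (fun h => ha ((joinEquiv hm).injective h))]
    rcases a with a | b
    · rw [joinConfig_joinEquiv_inl, joinConfig_joinEquiv_inl]
      obtain ⟨j, rfl⟩ := Fin.exists_succ_eq.2 (fun h : a = 0 => ha (by rw [h]))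
      simp
    · rw [joinConfig_joinEquiv_inr, joinConfig_joinEquiv_inr]

theorem boltzmann_joinConfig_cons {d m N : ℕ} (hm : m + 1 ≤ N) (β : ℝ) (V : Space d → ℝ)
    (x : Space d) (y : Fin m → Space d) (w : Fin (N - (m + 1)) → Space d) :
    boltzmann β V (joinConfig (Fin.cons x y : Fin (m + 1) → Space d) w : Fin N → Space d) =
      ENNReal.ofReal (Real.exp (-β * V x) * ((∏ i, coulombExp β (x - y i)) *
        ∏ j, coulombExp β (x - w j))) * joinRest hm β V y w := by
  rw [joinConfig_cons_eq_update hm, boltzmann_update, joinRest]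
  congr 3
  set i₀ := joinEquiv hm (Sum.inl 0) with hi₀
  set X : Fin N → Space d := joinConfig (Fin.cons 0 y : Fin (m + 1) → Space d) w with hX
  have h1 : ∏ i ∈ Finset.univ.erase i₀, coulombExp β (x - X i) =
      ∏ i, if i = i₀ then 1 else coulombExp β (x - X i) := by
    rw [← Finset.mul_prod_erase Finset.univ (fun i => if i = i₀ then 1 else coulombExp β (x - X i))
      (Finset.mem_univ i₀), if_pos rfl, one_mul]
    exact Finset.prod_congr rfl fun i hi => (if_neg (Finset.ne_of_mem_erase hi)).symm
  rw [h1, ← (joinEquiv hm).prod_comp, Fintype.prod_sum_type, Fin.prod_univ_succ]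
  rw [if_pos rfl, one_mul]
  congr 1
  · refine Finset.prod_congr rfl fun i _ => ?_
    rw [if_neg, hX, joinConfig_joinEquiv_inl, Fin.cons_succ]
    intro h
    have := (joinEquiv hm).injective h
    simp at this
  · refine Finset.prod_congr rfl fun i _ => ?_
    rw [if_neg, hX, joinConfig_joinEquiv_inr]
    intro h
    have := (joinEquiv hm).injective h
    simp at this

/-! ### The unnormalized conditional one-point function -/

/-- The Boltzmann weight of the configurations with particles at `x` and `y`, integrated over the
remaining particles. -/
noncomputable def insertionWeight {d m : ℕ} (N : ℕ) (β : ℝ) (V : Space d → ℝ)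
    (y : Fin m → Space d) (x : Space d) : ℝ≥0∞ :=
  ∫⁻ w : Fin (N - (m + 1)) → Space d,
    boltzmann β V (joinConfig (Fin.cons x y : Fin (m + 1) → Space d) w : Fin N → Space d)

/-- The Boltzmann weight of the configurations with particles at `y`, integrated over the
remaining particles. -/
noncomputable def marginalWeight {d m : ℕ} (N : ℕ) (β : ℝ) (V : Space d → ℝ)
    (y : Fin m → Space d) : ℝ≥0∞ :=
  ∫⁻ w : Fin (N - m) → Space d, boltzmann β V (joinConfig y w : Fin N → Space d)

theorem measurable_boltzmann_cons {d m N : ℕ} (hm : m + 1 ≤ N) (β : ℝ) {V : Space d → ℝ}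
    (hV : Measurable V) (y : Fin m → Space d) :
    Measurable fun p : (Fin (N - (m + 1)) → Space d) × Space d =>
      boltzmann β V (joinConfig (Fin.cons p.2 y : Fin (m + 1) → Space d) p.1 : Fin N → Space d) := by
  suffices h : Measurable fun p : (Fin (N - (m + 1)) → Space d) × Space d =>
      (Fin.cons p.2 y : Fin (m + 1) → Space d) from
    (measurable_boltzmann β hV).comp ((measurable_joinConfig hm).comp (h.prodMk measurable_fst))
  rw [measurable_pi_iff]
  intro i
  refine Fin.cases ?_ (fun j => ?_) i
  · simpa using measurable_snd
  · simp

theorem measurable_insertionWeight {d m N : ℕ} (hm : m + 1 ≤ N) (β : ℝ) {V : Space d → ℝ}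
    (hV : Measurable V) (y : Fin m → Space d) : Measurable (insertionWeight N β V y) :=
  (measurable_boltzmann_cons hm β hV y).lintegral_prod_left'

theorem insertionWeight_eq_zero {d m N : ℕ} (hm : m + 1 ≤ N) (β : ℝ) (V : Space d → ℝ)
    (y : Fin m → Space d) {x : Space d} {i : Fin m} (hx : x = y i) :
    insertionWeight N β V y x = 0 := by
  have h : ∀ w, boltzmann β V (joinConfig (Fin.cons x y : Fin (m + 1) → Space d) w :
      Fin N → Space d) = 0 := fun w => by
    rw [boltzmann_joinConfig_cons hm, Finset.prod_eq_zero (Finset.mem_univ i)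
      (by rw [hx, sub_self, coulombExp_zero])]
    simp
  simp [insertionWeight, h]

/-- This is the consistency of the marginals. Tonelli splits off the next particle, and the symmetry
of the Boltzmann weight moves it to the front. -/
theorem lintegral_insertionWeight {d m N : ℕ} (hm : m + 1 ≤ N) (β : ℝ) {V : Space d → ℝ}
    (hV : Measurable V) (y : Fin m → Space d) :
    ∫⁻ x, insertionWeight N β V y x = marginalWeight N β V y := by
  have hF : Measurable fun w : Fin (N - m) → Space d =>
      boltzmann β V (joinConfig y w : Fin N → Space d) :=
    (measurable_boltzmann β hV).comp
      ((measurable_joinConfig (by omega)).comp (Measurable.prodMk measurable_const measurable_id))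
  have h1 := lintegral_joinConfig (k := 1) (N := N - m) (by omega) hF
  have h2 := (volume_preserving_funUnique (Fin 1) (Space d)).symm
  have h3 : ∀ x w, boltzmann β V (joinConfig y (joinConfig (N := N - m) (k := 1) (fun _ => x) w) :
      Fin N → Space d) = boltzmann β V
        (joinConfig (Fin.cons x y : Fin (m + 1) → Space d) w : Fin N → Space d) := fun x w => by
    have h := joinConfig_cons_cycleRange hm x y w
    rw [← boltzmann_comp_perm β V (joinConfig (Fin.cons x y : Fin (m + 1) → Space d) w :
      Fin N → Space d) (Fin.cycleRange ⟨m, hm⟩), h]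
  have h4 := h2.lintegral_comp_emb (MeasurableEquiv.measurableEmbedding _)
    (fun y₁ : Fin 1 → Space d => ∫⁻ w : Fin (N - m - 1) → Space d,
      boltzmann β V (joinConfig y (joinConfig (N := N - m) y₁ w) : Fin N → Space d))
  rw [marginalWeight, h1]
  refine Eq.trans (lintegral_congr fun x => ?_) h4
  rw [insertionWeight]
  refine lintegral_congr fun w => ?_
  rw [← h3]
  rfl

/-- The charges indexed by S are moved into the exponent U and averaged exactly, provided m does not
charge their positions; all other particles are only super-averaged. Balls use S = ∅, harmonic
measure uses the charges inside the domain. -/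
theorem exp_mul_boltzmann_cons_le {d n N : ℕ} (hd : 2 ≤ d) (hn : n + 1 ≤ N) {β : ℝ} (hβ : 0 < β)
    {V φ : Space d → ℝ} (hV : Measurable V) (hφ : Measurable φ) (y : Fin n → Space d)
    (w : Fin (N - (n + 1)) → Space d)
    {m : Measure (Space d)} {x : Space d} (hm : IsSuperAveraging m x) (S : Finset (Fin n))
    {C : ℝ} (hC : ∀ᵐ z ∂m, |φ z - V z - ∑ i ∈ S, coulomb (z - y i)| ≤ C)
    (hx : ∀ i ∈ S, x ≠ y i) (hS : ∀ᵐ z ∂m, ∀ i ∈ S, z ≠ y i) :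
    ENNReal.ofReal (Real.exp (β * φ x)) *
      boltzmann β V (joinConfig (Fin.cons x y : Fin (n + 1) → Space d) w : Fin N → Space d) ≤
      ENNReal.ofReal (Real.exp (β * ((φ x - V x - ∑ i ∈ S, coulomb (x - y i)) -
        ∫ z, (φ z - V z - ∑ i ∈ S, coulomb (z - y i)) ∂m))) *
        ∫⁻ z, ENNReal.ofReal (Real.exp (β * φ z)) * boltzmann β V
          (joinConfig (Fin.cons z y : Fin (n + 1) → Space d) w : Fin N → Space d) ∂m := by
  have := hm.isProbabilityMeasure
  set U : Space d → ℝ := fun z => φ z - V z - ∑ i ∈ S, coulomb (z - y i) with hU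
  have hUm : Measurable U := (hφ.sub hV).sub (Finset.measurable_fun_sum _ fun i _ =>
    measurable_coulomb.comp (by fun_prop))
  set T : Finset (Fin n ⊕ Fin (N - (n + 1))) := (Sᶜ).disjSum Finset.univ with hT
  set q : Fin n ⊕ Fin (N - (n + 1)) → Space d := Sum.elim y w with hq
  have hid : ∀ z, (∀ i ∈ S, z ≠ y i) → ENNReal.ofReal (Real.exp (β * φ z)) *
      boltzmann β V (joinConfig (Fin.cons z y : Fin (n + 1) → Space d) w : Fin N → Space d) =
      ENNReal.ofReal (Real.exp (β * U z) * ∏ i ∈ T, coulombExp β (z - q i)) *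
        joinRest hn β V y w := fun z hz => by
    rw [boltzmann_joinConfig_cons hn, ← mul_assoc, ← ENNReal.ofReal_mul (Real.exp_pos _).le]
    congr 2
    have h1 : ∏ i ∈ S, coulombExp β (z - y i) =
        Real.exp (∑ i ∈ S, -β * coulomb (z - y i)) := by
      rw [Real.exp_sum]
      exact Finset.prod_congr rfl fun i hi => coulombExp_of_ne β (sub_ne_zero.2 (hz i hi))
    rw [← Finset.prod_mul_prod_compl S, h1, hT, Finset.prod_disjSum]
    simp only [hq, Sum.elim_inl, Sum.elim_inr]
    have h2 : Real.exp (β * U z) = Real.exp (β * φ z) * Real.exp (-β * V z) *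
        Real.exp (∑ i ∈ S, -β * coulomb (z - y i)) := by
      rw [← Real.exp_add, ← Real.exp_add, ← Finset.mul_sum, hU]
      congr 1; ring
    rw [h2]; ring
  have hae : ∀ᵐ z ∂m, ENNReal.ofReal (Real.exp (β * φ z)) *
      boltzmann β V (joinConfig (Fin.cons z y : Fin (n + 1) → Space d) w : Fin N → Space d) =
      ENNReal.ofReal (Real.exp (β * U z) * ∏ i ∈ T, coulombExp β (z - q i)) *
        joinRest hn β V y w := hS.mono fun z hz => hid z hz
  have hce : Measurable (coulombExp (d := d) β) := (continuous_coulombExp hd hβ).measurable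
  rw [hid x hx, lintegral_congr_ae hae, lintegral_mul_const _ (by
    refine (Measurable.mul (Real.measurable_exp.comp (hUm.const_mul β)) ?_).ennreal_ofReal
    exact Finset.measurable_fun_prod _ fun i _ => hce.comp (by fun_prop)), ← mul_assoc]
  exact mul_le_mul_left (hm.exp_mul_prod_le hd hβ hUm.aestronglyMeasurable hC (U x) T q) _

/-- The prefactor is independent of the remaining particles w, so the pointwise bound can be
integrated over w and the integrals exchanged by Tonelli. -/
theorem exp_mul_insertionWeight_le {d n N : ℕ} (hd : 2 ≤ d) (hn : n + 1 ≤ N) {β : ℝ} (hβ : 0 < β)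
    {V φ : Space d → ℝ} (hV : Measurable V) (hφ : Measurable φ) (y : Fin n → Space d)
    {m : Measure (Space d)} {x : Space d} (hm : IsSuperAveraging m x) (S : Finset (Fin n))
    {C : ℝ} (hC : ∀ᵐ z ∂m, |φ z - V z - ∑ i ∈ S, coulomb (z - y i)| ≤ C)
    (hx : ∀ i ∈ S, x ≠ y i) (hS : ∀ᵐ z ∂m, ∀ i ∈ S, z ≠ y i) :
    ENNReal.ofReal (Real.exp (β * φ x)) * insertionWeight N β V y x ≤
      ENNReal.ofReal (Real.exp (β * ((φ x - V x - ∑ i ∈ S, coulomb (x - y i)) -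
        ∫ z, (φ z - V z - ∑ i ∈ S, coulomb (z - y i)) ∂m))) *
      ∫⁻ z, ENNReal.ofReal (Real.exp (β * φ z)) * insertionWeight N β V y z ∂m := by
  set U : Space d → ℝ := fun z => φ z - V z - ∑ i ∈ S, coulomb (z - y i) with hU
  have := hm.isProbabilityMeasure
  have hmeas := measurable_boltzmann_cons hn β hV y
  have hexp : Measurable fun z => ENNReal.ofReal (Real.exp (β * φ z)) :=
    (Real.measurable_exp.comp (hφ.const_mul β)).ennreal_ofReal
  have hmeas2 : Measurable fun p : (Fin (N - (n + 1)) → Space d) × Space d =>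
      ENNReal.ofReal (Real.exp (β * φ p.2)) * boltzmann β V
        (joinConfig (Fin.cons p.2 y : Fin (n + 1) → Space d) p.1 : Fin N → Space d) :=
    (hexp.comp measurable_snd).mul hmeas
  have hpt : ∀ w, ENNReal.ofReal (Real.exp (β * φ x)) *
      boltzmann β V (joinConfig (Fin.cons x y : Fin (n + 1) → Space d) w : Fin N → Space d) ≤
      ENNReal.ofReal (Real.exp (β * (U x - ∫ z, U z ∂m))) *
        ∫⁻ z, ENNReal.ofReal (Real.exp (β * φ z)) * boltzmann β V
          (joinConfig (Fin.cons z y : Fin (n + 1) → Space d) w : Fin N → Space d) ∂m := fun w =>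
    exp_mul_boltzmann_cons_le hd hn hβ hV hφ y w hm S hC hx hS
  have hsec : ∀ z, Measurable fun w : Fin (N - (n + 1)) → Space d => boltzmann β V
      (joinConfig (Fin.cons z y : Fin (n + 1) → Space d) w : Fin N → Space d) := fun z =>
    hmeas.comp (measurable_id.prodMk measurable_const)
  calc _ = ∫⁻ w : Fin (N - (n + 1)) → Space d, ENNReal.ofReal (Real.exp (β * φ x)) *
      boltzmann β V (joinConfig (Fin.cons x y : Fin (n + 1) → Space d) w : Fin N → Space d) := by
        rw [insertionWeight, lintegral_const_mul _ (hsec x)]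
    _ ≤ ∫⁻ w : Fin (N - (n + 1)) → Space d, ENNReal.ofReal (Real.exp (β * (U x - ∫ z, U z ∂m))) *
        ∫⁻ z, ENNReal.ofReal (Real.exp (β * φ z)) * boltzmann β V
          (joinConfig (Fin.cons z y : Fin (n + 1) → Space d) w : Fin N → Space d) ∂m :=
        lintegral_mono hpt
    _ = ENNReal.ofReal (Real.exp (β * (U x - ∫ z, U z ∂m))) *
        ∫⁻ w : Fin (N - (n + 1)) → Space d, ∫⁻ z, ENNReal.ofReal (Real.exp (β * φ z)) * boltzmann β V
          (joinConfig (Fin.cons z y : Fin (n + 1) → Space d) w : Fin N → Space d) ∂m := by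
        rw [lintegral_const_mul _ hmeas2.lintegral_prod_right']
    _ = _ := by
        congr 1
        rw [lintegral_lintegral_swap hmeas2.aemeasurable]
        refine lintegral_congr fun z => ?_
        rw [insertionWeight, lintegral_const_mul _ (hsec z)]

/-! ### Normalization -/

theorem partitionFunction_ne_zero {d : ℕ} (hd : 2 ≤ d) (N : ℕ) (β : ℝ) {V : Space d → ℝ}
    (hV : Measurable V) : partitionFunction N β V ≠ 0 := by
  have : Nonempty (Fin d) := ⟨⟨0, by omega⟩⟩
  have : Infinite (Space d) := Module.Free.infinite ℝ (Space d)
  rw [partitionFunction, ← pos_iff_ne_zero, lintegral_pos_iff_support (measurable_boltzmann β hV)]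
  have hsub : {X : Fin N → Space d | Function.Injective X} ⊆
      Function.support (boltzmann (N := N) β V) := fun X hX => by
    rw [Function.mem_support, boltzmann, if_pos (show Function.Injective X from hX)]
    exact (ENNReal.ofReal_pos.2 (Real.exp_pos _)).ne'
  have hne : {X : Fin N → Space d | Function.Injective X}.Nonempty :=
    ⟨fun i => Infinite.natEmbedding (Space d) i, fun i j h =>
      Fin.ext ((Infinite.natEmbedding (Space d)).injective h)⟩
  exact (isOpen_injective.measure_pos volume hne).trans_le (measure_mono hsub)

theorem measurable_marginalWeight {d m N : ℕ} (hm : m ≤ N) (β : ℝ) {V : Space d → ℝ}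
    (hV : Measurable V) : Measurable (marginalWeight (m := m) N β V) :=
  ((measurable_boltzmann β hV).comp (measurable_joinConfig hm)).lintegral_prod_right'

theorem lintegral_boltzmann_mul {d m N : ℕ} (hm : m ≤ N) (β : ℝ) {V : Space d → ℝ}
    (hV : Measurable V) {h : (Fin m → Space d) → ℝ≥0∞} (hh : Measurable h) :
    ∫⁻ X : Fin N → Space d, boltzmann β V X * h (fun i => X (Fin.castLE hm i)) =
      ∫⁻ y, marginalWeight N β V y * h y := by
  have hr : Measurable fun X : Fin N → Space d => fun i => X (Fin.castLE hm i) :=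
    measurable_pi_lambda _ fun i => measurable_pi_apply _
  have hbm : Measurable fun X : Fin N → Space d =>
      boltzmann β V X * h (fun i => X (Fin.castLE hm i)) :=
    (measurable_boltzmann β hV).mul (hh.comp hr)
  rw [lintegral_joinConfig hm hbm]
  refine lintegral_congr fun y => ?_
  have hsec : Measurable fun w : Fin (N - m) → Space d =>
      boltzmann β V (joinConfig y w : Fin N → Space d) := (measurable_boltzmann β hV).comp
    ((measurable_joinConfig hm).comp (measurable_const.prodMk measurable_id))
  rw [marginalWeight, ← lintegral_mul_const _ hsec]
  refine lintegral_congr fun w => ?_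
  rw [joinConfig_apply_castLE]

theorem lintegral_marginalWeight {d m N : ℕ} (hm : m ≤ N) (β : ℝ) {V : Space d → ℝ}
    (hV : Measurable V) : ∫⁻ y : Fin m → Space d, marginalWeight N β V y =
      partitionFunction N β V := by
  have h := lintegral_boltzmann_mul hm β hV (h := fun _ => 1) measurable_const
  simpa [partitionFunction] using h.symm

/-- The marginal law has a density proportional to `marginalWeight`, so it does not charge the zero
set of that weight. The weight is infinite only on a Lebesgue null set, since its integral is the
finite partition function. -/
theorem ae_marginalWeight {d m N : ℕ} (hm : m ≤ N) (β : ℝ) {V : Space d → ℝ}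
    (hV : Measurable V) (hZ : partitionFunction N β V ≠ ⊤) :
    ∀ᵐ y ∂(marginal N β V hm), marginalWeight N β V y ≠ 0 ∧ marginalWeight N β V y ≠ ⊤ := by
  have hr : Measurable fun X : Fin N → Space d => fun i => X (Fin.castLE hm i) :=
    measurable_pi_lambda _ fun i => measurable_pi_apply _
  have hI := measurable_marginalWeight (d := d) hm β hV
  have hB : MeasurableSet {y : Fin m → Space d | marginalWeight N β V y ≠ 0 ∧
      marginalWeight N β V y ≠ ⊤} :=
    (hI (measurableSet_singleton 0).compl).inter (hI (measurableSet_singleton ⊤).compl)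
  rw [marginal, ae_map_iff hr.aemeasurable hB, gibbs]
  refine Measure.ae_smul_measure ?_ _
  rw [ae_withDensity_iff (measurable_boltzmann β hV)]
  -- The indicator of the bad set serves as a test function in `lintegral_boltzmann_mul`.
  set h : (Fin m → Space d) → ℝ≥0∞ := Set.indicator {y : Fin m → Space d |
    marginalWeight N β V y ≠ 0 ∧ marginalWeight N β V y ≠ ⊤}ᶜ 1 with hh
  have hhm : Measurable h := measurable_one.indicator hB.compl
  have h0 : ∫⁻ X : Fin N → Space d, boltzmann β V X * h (fun i => X (Fin.castLE hm i)) = 0 := by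
    rw [lintegral_boltzmann_mul hm β hV hhm]
    have hfin : ∀ᵐ y : Fin m → Space d, marginalWeight N β V y < ⊤ :=
      ae_lt_top hI (by rwa [lintegral_marginalWeight hm β hV])
    rw [lintegral_congr_ae (g := 0), Pi.zero_def, lintegral_zero]
    filter_upwards [hfin] with y hy
    by_cases hy0 : marginalWeight N β V y = 0
    · simp [hy0]
    · simp [hh, hy0, hy.ne]
  have hbm : Measurable fun X : Fin N → Space d =>
      boltzmann β V X * h (fun i => X (Fin.castLE hm i)) :=
    (measurable_boltzmann β hV).mul (hhm.comp hr)
  rw [lintegral_eq_zero_iff hbm] at h0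
  filter_upwards [h0] with X hX hb
  by_contra hcon
  have h1 : h (fun i => X (Fin.castLE hm i)) = 1 := Set.indicator_of_mem hcon _
  simp only [h1, mul_one, Pi.zero_apply] at hX
  exact hb hX

/-- `F` is a finite multiple of the insertion weight at `y`, vanishing if the latter has infinite
mass. -/
def IsInsertionDensity {d m : ℕ} (N : ℕ) (β : ℝ) (V : Space d → ℝ) (y : Fin m → Space d)
    (F : Space d → ℝ≥0∞) : Prop :=
  ∃ C : ℝ≥0∞, C ≠ ⊤ ∧ (∀ x, F x = C * insertionWeight N β V y x) ∧
    (C = 0 ∨ ∫⁻ x, insertionWeight N β V y x ≠ ⊤)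

theorem isInsertionDensity_onePoint {d : ℕ} (hd : 2 ≤ d) {N : ℕ} (hN : 1 ≤ N) (β : ℝ)
    {V : Space d → ℝ} (hV : Measurable V) :
    IsInsertionDensity N β V (Fin.elim0 : Fin 0 → Space d) (onePoint N β V) := by
  refine ⟨N.descFactorial 1 / partitionFunction N β V, ENNReal.div_ne_top (by simp)
    (partitionFunction_ne_zero hd N β hV), fun x => ?_, ?_⟩
  · have hx : (fun _ : Fin 1 => x) = (Fin.cons x Fin.elim0 : Fin (0 + 1) → Space d) := by
      funext i; fin_cases i; rfl
    rw [onePoint, corr, ENNReal.div_eq_inv_mul, ENNReal.div_eq_inv_mul, mul_assoc, hx]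
    rfl
  · by_cases hZ : partitionFunction N β V = ⊤
    -- Division by ⊤ is zero in `ℝ≥0∞`, so the constant vanishes.
    · left; simp [hZ]
    · right
      rw [lintegral_insertionWeight (m := 0) hN β hV]
      have h := lintegral_marginalWeight (d := d) (m := 0) (Nat.zero_le N) β hV
      have h2 : ∀ y : Fin 0 → Space d, marginalWeight N β V y =
        marginalWeight N β V (Fin.elim0 : Fin 0 → Space d) := fun y => by
          rw [Subsingleton.elim y Fin.elim0]
      simp only [h2, lintegral_const] at h
      have h3 : (volume (Set.univ : Set (Fin 0 → Space d))) = 1 := by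
        simp [volume_pi]
      rw [h3, mul_one] at h
      rwa [h]

theorem ae_isInsertionDensity_condOnePoint {d m : ℕ} (hd : 2 ≤ d) {N : ℕ} (hm : m + 1 ≤ N) (β : ℝ)
    {V : Space d → ℝ} (hV : Measurable V) :
    ∀ᵐ y ∂(marginal N β V (Nat.le_of_succ_le hm)),
      IsInsertionDensity N β V y (condOnePoint N β V y) := by
  by_cases hZ : partitionFunction N β V = ⊤
  -- When the partition function is ⊤, every correlation density is 0 by convention, and 0 / 0 = 0
  -- in `ℝ≥0∞`.
  · refine Eventually.of_forall fun y => ⟨0, by simp, fun x => ?_, Or.inl rfl⟩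
    simp [condOnePoint, corr, hZ]
  filter_upwards [ae_marginalWeight (Nat.le_of_succ_le hm) β hV hZ] with y hy
  have hZ0 := partitionFunction_ne_zero hd N β hV
  refine ⟨N.descFactorial (m + 1) / partitionFunction N β V / corr N β V y,
    ENNReal.div_ne_top (ENNReal.div_ne_top (ENNReal.natCast_ne_top _) hZ0) ?_, fun x => ?_, Or.inr ?_⟩
  · have hD : (N.descFactorial m : ℝ≥0∞) ≠ 0 := by
      rw [Nat.cast_ne_zero, Ne, Nat.descFactorial_eq_zero_iff_lt]; omega
    exact (ENNReal.div_pos (mul_ne_zero hD hy.1) hZ).ne'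
  · rw [condOnePoint]
    nth_rewrite 1 [corr]
    simp only [ENNReal.div_eq_inv_mul]
    rw [insertionWeight]
    ring
  · rw [lintegral_insertionWeight hm β hV]
    exact hy.2

theorem IsInsertionDensity.exp_mul_le {d n N : ℕ} (hd : 2 ≤ d) (hn : n + 1 ≤ N) {β : ℝ}
    (hβ : 0 < β) {V φ : Space d → ℝ} (hV : Measurable V) (hφ : Measurable φ) {y : Fin n → Space d}
    {F : Space d → ℝ≥0∞} (hF : IsInsertionDensity N β V y F)
    {m : Measure (Space d)} {x : Space d} (hm : IsSuperAveraging m x) (S : Finset (Fin n))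
    {C : ℝ} (hC : ∀ᵐ z ∂m, |φ z - V z - ∑ i ∈ S, coulomb (z - y i)| ≤ C)
    (hx : ∀ i ∈ S, x ≠ y i) (hS : ∀ᵐ z ∂m, ∀ i ∈ S, z ≠ y i) :
    ENNReal.ofReal (Real.exp (β * φ x)) * F x ≤
      ENNReal.ofReal (Real.exp (β * ((φ x - V x - ∑ i ∈ S, coulomb (x - y i)) -
        ∫ z, (φ z - V z - ∑ i ∈ S, coulomb (z - y i)) ∂m))) *
      ∫⁻ z, ENNReal.ofReal (Real.exp (β * φ z)) * F z ∂m := by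
  obtain ⟨A, -, hA, -⟩ := hF
  have h := exp_mul_insertionWeight_le hd hn hβ hV hφ y hm S hC hx hS
  have hmeas : Measurable fun z => ENNReal.ofReal (Real.exp (β * φ z)) *
      insertionWeight N β V y z :=
    (Real.measurable_exp.comp (hφ.const_mul β)).ennreal_ofReal.mul
      (measurable_insertionWeight hn β hV y)
  have e : ∀ z, ENNReal.ofReal (Real.exp (β * φ z)) * F z =
      A * (ENNReal.ofReal (Real.exp (β * φ z)) * insertionWeight N β V y z) := fun z => by
    rw [hA]; ring
  rw [e x, lintegral_congr e, lintegral_const_mul _ hmeas, mul_left_comm _ A]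
  exact mul_le_mul_right h A

theorem IsInsertionDensity.eq_zero {d n N : ℕ} (hn : n + 1 ≤ N) {β : ℝ} {V : Space d → ℝ}
    {y : Fin n → Space d} {F : Space d → ℝ≥0∞} (hF : IsInsertionDensity N β V y F) (i : Fin n) :
    F (y i) = 0 := by
  obtain ⟨A, -, hA, -⟩ := hF
  rw [hA, insertionWeight_eq_zero hn β V y rfl, mul_zero]

/-! ### Continuity of the one-point functions -/

theorem ballMeasure_eq {d : ℕ} (x : Space d) {r : ℝ} (hr : 0 < r) : ballMeasure x r =
    (volume (Metric.ball x r))⁻¹ • volume.restrict (Metric.ball x r) :=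
  map_unitBallMeasure x hr

theorem ae_mem_ballMeasure {d : ℕ} (x : Space d) {r : ℝ} (hr : 0 < r) :
    ∀ᵐ z ∂(ballMeasure x r), z ∈ Metric.ball x r := by
  rw [ballMeasure_eq x hr]
  exact Measure.ae_smul_measure (ae_restrict_mem Metric.isOpen_ball.measurableSet) _

theorem joinRest_ne_top {d m N : ℕ} (hm : m + 1 ≤ N) (β : ℝ) (V : Space d → ℝ)
    (y : Fin m → Space d) (w : Fin (N - (m + 1)) → Space d) : joinRest hm β V y w ≠ ⊤ := by
  rw [joinRest, restFactor]
  split_ifs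
  · exact ENNReal.ofReal_ne_top
  · exact ENNReal.zero_ne_top

theorem continuous_boltzmann_cons {d m N : ℕ} (hd : 2 ≤ d) (hm : m + 1 ≤ N) {β : ℝ} (hβ : 0 < β)
    {V : Space d → ℝ} (hV : Continuous V) (y : Fin m → Space d)
    (w : Fin (N - (m + 1)) → Space d) : Continuous fun x => boltzmann β V
      (joinConfig (Fin.cons x y : Fin (m + 1) → Space d) w : Fin N → Space d) := by
  simp only [boltzmann_joinConfig_cons hm]
  have hc := continuous_coulombExp hd hβ
  refine ENNReal.continuous_mul_const (joinRest_ne_top hm β V y w) |>.comp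
    (ENNReal.continuous_ofReal.comp ?_)
  refine Continuous.mul (Real.continuous_exp.comp (by fun_prop)) (Continuous.mul ?_ ?_)
  · exact continuous_finsetProd _ fun i _ => hc.comp (by fun_prop)
  · exact continuous_finsetProd _ fun i _ => hc.comp (by fun_prop)

/-- Jensen on the unit ball around x bounds the weight at x by its local average, with a constant
independent of w and uniform for x near x₀. This is the majorant behind the continuity of the
densities. -/
theorem boltzmann_cons_le_lintegral {d m N : ℕ} (hd : 2 ≤ d) (hm : m + 1 ≤ N) {β : ℝ} (hβ : 0 < β)
    {V : Space d → ℝ} (hV : Continuous V) (y : Fin m → Space d) (x₀ : Space d) :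
    ∃ K : ℝ≥0∞, K ≠ ⊤ ∧ ∀ x ∈ Metric.ball x₀ 1, ∀ w : Fin (N - (m + 1)) → Space d, boltzmann β V
      (joinConfig (Fin.cons x y : Fin (m + 1) → Space d) w : Fin N → Space d) ≤ K * ∫⁻ z, boltzmann β V
      (joinConfig (Fin.cons z y : Fin (m + 1) → Space d) w : Fin N → Space d) := by
  obtain ⟨M, hM⟩ := (isCompact_closedBall x₀ 2).exists_bound_of_continuousOn hV.continuousOn
  have hvol : ∀ x : Space d, volume (Metric.ball x (1 : ℝ)) = volume (Metric.ball (0 : Space d) 1) :=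
    fun x => Measure.addHaar_ball_center volume x 1
  -- The exponent is β times the average of V minus V(x), and |V| ≤ M on the ball of radius 2 around
  -- x₀, which contains the unit ball around x. The inverse volume converts the uniform measure to
  -- Lebesgue measure.
  refine ⟨ENNReal.ofReal (Real.exp (β * (2 * M))) * (volume (Metric.ball (0 : Space d) 1))⁻¹,
    ENNReal.mul_ne_top ENNReal.ofReal_ne_top (ENNReal.inv_ne_top.2
      (Metric.measure_ball_pos volume _ one_pos).ne'), fun x hx w => ?_⟩
  have hin : ∀ z ∈ Metric.ball x 1, |V z| ≤ M := fun z hz => by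
    refine hM z (Metric.mem_closedBall.2 ?_)
    have h1 := Metric.mem_ball.1 hz
    have h2 := Metric.mem_ball.1 hx
    linarith [dist_triangle z x x₀]
  have hae : ∀ᵐ z ∂(ballMeasure x 1), |V z| ≤ M :=
    (ae_mem_ballMeasure x one_pos).mono hin
  have hsa := isSuperAveraging_ballMeasure hd x one_pos
  have := hsa.isProbabilityMeasure
  have h := exp_mul_boltzmann_cons_le (φ := fun _ => 0) hd hm hβ hV.measurable measurable_const y w
    hsa ∅ (C := M) (by simpa using hae) (by simp) (by simp)
  simp only [mul_zero, Real.exp_zero, ENNReal.ofReal_one, one_mul, Finset.sum_empty, sub_zero,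
    zero_sub] at h
  refine h.trans ?_
  rw [mul_assoc]
  refine mul_le_mul' (ENNReal.ofReal_le_ofReal (Real.exp_le_exp.2
    (mul_le_mul_of_nonneg_left ?_ hβ.le))) ?_
  · have h1 := abs_le.1 (hin x (Metric.mem_ball_self one_pos))
    have h2 : |∫ z, -V z ∂(ballMeasure x 1)| ≤ M := by
      have := norm_integral_le_of_norm_le_const (μ := ballMeasure x 1) (f := fun z => -V z) (C := M)
        (by simpa using hae)
      simpa using this
    linarith [abs_le.1 h2]
  · rw [ballMeasure_eq x one_pos, lintegral_smul_measure, hvol]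
    exact mul_le_mul_right (setLIntegral_le_lintegral _ _) _

/-- Dominated convergence in w, with the majorant of `boltzmann_cons_le_lintegral`; by Tonelli its
integral is K times the total insertion mass, which is finite. -/
theorem continuous_insertionWeight {d m N : ℕ} (hd : 2 ≤ d) (hm : m + 1 ≤ N) {β : ℝ} (hβ : 0 < β)
    {V : Space d → ℝ} (hV : Continuous V) (y : Fin m → Space d)
    (hfin : ∫⁻ x, insertionWeight N β V y x ≠ ⊤) :
    Continuous (insertionWeight N β V y) ∧ ∀ x, insertionWeight N β V y x ≠ ⊤ := by
  have hmeas := measurable_boltzmann_cons hm β hV.measurable y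
  have hsec : ∀ z, Measurable fun w : Fin (N - (m + 1)) → Space d => boltzmann β V
      (joinConfig (Fin.cons z y : Fin (m + 1) → Space d) w : Fin N → Space d) := fun z =>
    hmeas.comp (measurable_id.prodMk measurable_const)
  have hswap : ∫⁻ w : Fin (N - (m + 1)) → Space d, ∫⁻ z, boltzmann β V
      (joinConfig (Fin.cons z y : Fin (m + 1) → Space d) w : Fin N → Space d) =
      ∫⁻ x, insertionWeight N β V y x := lintegral_lintegral_swap hmeas.aemeasurable
  have hD : Measurable fun w : Fin (N - (m + 1)) → Space d => ∫⁻ z, boltzmann β V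
      (joinConfig (Fin.cons z y : Fin (m + 1) → Space d) w : Fin N → Space d) :=
    hmeas.lintegral_prod_right'
  have hb : ∀ K : ℝ≥0∞, K ≠ ⊤ → ∫⁻ w : Fin (N - (m + 1)) → Space d, K * ∫⁻ z, boltzmann β V
      (joinConfig (Fin.cons z y : Fin (m + 1) → Space d) w : Fin N → Space d) ≠ ⊤ := by
    intro K hK
    rw [lintegral_const_mul _ hD, hswap]
    exact ENNReal.mul_ne_top hK hfin
  refine ⟨continuous_iff_continuousAt.2 fun x₀ => ?_, fun x₀ => ?_⟩
  all_goals obtain ⟨K, hK, hle⟩ := boltzmann_cons_le_lintegral hd hm hβ hV y x₀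
  · refine tendsto_lintegral_filter_of_dominated_convergence _ (Eventually.of_forall hsec)
      ((eventually_mem_set.2 (Metric.ball_mem_nhds x₀ one_pos)).mono fun x hx =>
        Eventually.of_forall (hle x hx)) (hb K hK) (Eventually.of_forall fun w => ?_)
    exact (continuous_boltzmann_cons hd hm hβ hV y w).tendsto x₀
  · exact ((lintegral_mono (hle x₀ (Metric.mem_ball_self one_pos))).trans_lt (hb K hK).lt_top).ne

theorem IsInsertionDensity.continuous {d n N : ℕ} (hd : 2 ≤ d) (hn : n + 1 ≤ N) {β : ℝ}
    (hβ : 0 < β) {V : Space d → ℝ} (hV : Continuous V) {y : Fin n → Space d}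
    {F : Space d → ℝ≥0∞} (hF : IsInsertionDensity N β V y F) :
    Continuous F ∧ ∀ x, F x ≠ ⊤ := by
  obtain ⟨A, hA, hF, hfin⟩ := hF
  rcases hfin with rfl | hfin
  · have : F = fun _ => 0 := funext fun x => by rw [hF, zero_mul]
    rw [this]
    exact ⟨continuous_const, fun _ => ENNReal.zero_ne_top⟩
  · have h := continuous_insertionWeight hd hn hβ hV y hfin
    rw [funext hF]
    exact ⟨(ENNReal.continuous_const_mul hA).comp h.1, fun x => ENNReal.mul_ne_top hA (h.2 x)⟩

/-! ### Regularity of the equilibrium measure -/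

theorem measurable_coulombPos {d : ℕ} : Measurable (coulombPos (d := d)) :=
  Measurable.ite (measurableSet_singleton 0) measurable_const measurable_coulomb.ennreal_ofReal

theorem HasFinitePotential.measure_singleton {d : ℕ} {μ : Measure (Space d)}
    (h : HasFinitePotential μ) (x : Space d) : μ {x} = 0 := by
  by_contra hne
  refine (h x).1 (top_le_iff.1 ?_)
  calc ⊤ = ∫⁻ y in {x}, coulombPos (x - y) ∂μ := by
        rw [lintegral_singleton, sub_self, coulombPos, if_pos rfl, ENNReal.top_mul hne]
    _ ≤ _ := setLIntegral_le_lintegral _ _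

/-- Restricting μ to the set where its positive potential is at most n, intersected with the ball of
radius n, yields a compactly supported measure of finite energy, which cannot charge A. These sets
exhaust the space because the potential is finite everywhere. -/
theorem HasFinitePotential.measure_eq_zero_of_capacityZero {d : ℕ} {μ : Measure (Space d)}
    [IsFiniteMeasure μ] (h : HasFinitePotential μ) {A : Set (Space d)} (hA : CapacityZero A) :
    μ A = 0 := by
  have hmeas : Measurable fun x => ∫⁻ y, coulombPos (x - y) ∂μ :=
    (measurable_coulombPos.comp (measurable_fst.sub measurable_snd)).lintegral_prod_right'
  set B : ℕ → Set (Space d) := fun n => {x | ∫⁻ y, coulombPos (x - y) ∂μ ≤ n} ∩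
    Metric.closedBall 0 n with hB
  have hBm : ∀ n, MeasurableSet (B n) := fun n =>
    (measurableSet_le hmeas measurable_const).inter Metric.isClosed_closedBall.measurableSet
  have hz : ∀ n, μ (A ∩ B n) = 0 := fun n => by
    rw [← Measure.restrict_apply' (hBm n)]
    refine hA _ inferInstance ⟨Metric.closedBall 0 n, isCompact_closedBall _ _, ?_⟩ (ne_of_lt ?_)
    · rw [Measure.restrict_apply' (hBm n)]
      refine measure_mono_null (t := ∅) (fun x hx => hx.1 hx.2.2) (by simp)
    · calc ∫⁻ x in B n, ∫⁻ y in B n, coulombPos (x - y) ∂μ ∂μ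
          ≤ ∫⁻ x in B n, (n : ℝ≥0∞) ∂μ := by
            refine setLIntegral_mono measurable_const fun x hx =>
              (setLIntegral_le_lintegral _ _).trans hx.1
        _ < ⊤ := by
            rw [lintegral_const]
            exact ENNReal.mul_lt_top (ENNReal.natCast_lt_top n) (measure_lt_top _ _)
  refine measure_mono_null (t := ⋃ n, A ∩ B n) (fun x hx => ?_) (measure_iUnion_null hz)
  obtain ⟨n, hn⟩ := ENNReal.exists_nat_gt (h x).1
  obtain ⟨k, hk⟩ := exists_nat_ge ‖x‖
  refine Set.mem_iUnion.2 ⟨max n k, hx, hn.le.trans (by simp), ?_⟩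
  rw [mem_closedBall_zero_iff]
  exact hk.trans (by simp)

/-- For d = 2 this follows from log|x - y| ≤ log|x| + log(1 + |y|) for |x| ≥ 1 and the integrability
of log|y|. Otherwise the potential is nonnegative while the kernel is at most 1 outside the unit
ball. -/
theorem exists_coulomb_sub_le_potential {d : ℕ} {μ : Measure (Space d)}
    [IsProbabilityMeasure μ] (h : HasFinitePotential μ) :
    ∃ L : ℝ, ∀ x : Space d, 1 ≤ ‖x‖ → coulomb x - L ≤ potential μ x := by
  by_cases hd : d = 2
  · have hi : Integrable (fun y : Space d => |coulomb y|) μ := by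
      have := (h 0).2.abs
      simpa [coulomb_neg] using this
    have hi2 : Integrable (fun y : Space d => Real.log 2 + |coulomb y|) μ :=
      (integrable_const _).add hi
    refine ⟨∫ y, (Real.log 2 + |coulomb y|) ∂μ, fun x hx => ?_⟩
    have h1 : ∫ y, (coulomb x - (Real.log 2 + |coulomb y|)) ∂μ ≤ potential μ x := by
      refine integral_mono ((integrable_const _).sub hi2) (h x).2 fun y => ?_
      simp only [coulomb, if_pos hd, abs_neg]
      have hxp : 0 < ‖x‖ := by linarith
      have hb : Real.log (1 + ‖y‖) ≤ Real.log 2 + |Real.log ‖y‖| := by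
        rcases le_total ‖y‖ 1 with hy | hy
        · have := Real.log_le_log (by positivity) (show 1 + ‖y‖ ≤ 2 by linarith)
          linarith [abs_nonneg (Real.log ‖y‖)]
        · have := Real.log_le_log (by positivity) (show 1 + ‖y‖ ≤ 2 * ‖y‖ by linarith)
          rw [Real.log_mul (by norm_num) (by linarith)] at this
          linarith [le_abs_self (Real.log ‖y‖)]
      have ha : Real.log ‖x - y‖ ≤ Real.log ‖x‖ + Real.log (1 + ‖y‖) := by
        rcases eq_or_ne (x - y) 0 with h0 | h0
        · rw [h0, norm_zero, Real.log_zero]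
          have := Real.log_nonneg hx
          have := Real.log_nonneg (show 1 ≤ 1 + ‖y‖ by linarith [norm_nonneg y])
          linarith
        · rw [← Real.log_mul hxp.ne' (by positivity)]
          refine Real.log_le_log (norm_pos_iff.2 h0) ((norm_sub_le _ _).trans ?_)
          nlinarith [norm_nonneg y]
      linarith
    rw [integral_sub (integrable_const _) hi2] at h1
    simpa using h1
  · refine ⟨1, fun x hx => ?_⟩
    have h0 : 0 ≤ potential μ x := integral_nonneg fun y => by
      simp only [coulomb, if_neg hd]; positivity
    have h1 : coulomb x ≤ 1 := by
      simp only [coulomb, if_neg hd]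
      exact inv_le_one_of_one_le₀ (one_le_pow₀ hx)
    linarith

theorem IsEquilibriumMeasure.ae_eq_zero {d : ℕ} {V₁ : Space d → ℝ} {μ₁ : Measure (Space d)} {c₁ : ℝ}
    (h : IsEquilibriumMeasure V₁ μ₁ c₁) : ∀ᵐ x ∂μ₁, effPotentialOne V₁ μ₁ c₁ x = 0 := by
  have := h.isProbabilityMeasure
  filter_upwards [measure_eq_zero_iff_ae_notMem.1
    (h.hasFinitePotential.measure_eq_zero_of_capacityZero h.eq_zero_qe),
    (Measure.support_mem_ae : μ₁.support ∈ ae μ₁)] with x hx hs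
  by_contra hne
  exact hx ⟨hs, hne⟩

theorem IsEquilibriumMeasure.isCharge {d : ℕ} {V₁ : Space d → ℝ} {θ : ℝ}
    (hV : AdmissiblePotential V₁ θ) {μ₁ : Measure (Space d)} {c₁ : ℝ}
    (h : IsEquilibriumMeasure V₁ μ₁ c₁) : IsCharge μ₁ where
  isFinite := have := h.isProbabilityMeasure; inferInstance
  compact := by
    have := h.isProbabilityMeasure
    obtain ⟨L, hL⟩ := exists_coulomb_sub_le_potential h.hasFinitePotential
    -- Far out, ζ₁ ≥ g + V₁ - L - c₁ > 0, whereas ζ₁ vanishes μ₁-almost everywhere; hence no mass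
    -- lies there.
    have hev := hV.growth.eventually (eventually_gt_atTop (L + c₁))
    obtain ⟨R, hR⟩ := (Metric.hasBasis_cobounded_compl_closedBall (0 : Space d)).eventually_iff.1
      (Metric.cobounded_eq_cocompact (α := Space d) ▸ hev)
    refine ⟨max R 1, measure_mono_null ?_ (ae_iff.1 h.ae_eq_zero)⟩
    intro x hx
    have hx' : max R 1 < ‖x‖ := by simpa using hx
    have h1 := hR.2 (show x ∈ (Metric.closedBall 0 R)ᶜ by
      simpa using (le_max_left _ _).trans_lt hx')
    have h2 := hL x ((le_max_right _ _).trans hx'.le)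
    show effPotentialOne V₁ μ₁ c₁ x ≠ 0
    rw [effPotentialOne]
    linarith
  noAtom := h.hasFinitePotential.measure_singleton
  integrable x := (h.hasFinitePotential x).2

/-- ζ₁ is lower semicontinuous, so positivity at a support point would persist on a neighbourhood.
That neighbourhood has positive mass, contradicting the almost everywhere vanishing. The exceptional
set of capacity zero is therefore empty. -/
theorem IsEquilibriumMeasure.eq_zero {d : ℕ} {V₁ : Space d → ℝ} {θ : ℝ}
    (hV : AdmissiblePotential V₁ θ) {μ₁ : Measure (Space d)} {c₁ : ℝ}
    (h : IsEquilibriumMeasure V₁ μ₁ c₁) {x : Space d} (hx : x ∈ μ₁.support) :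
    effPotentialOne V₁ μ₁ c₁ x = 0 := by
  by_contra hne
  have hpos : 0 < effPotentialOne V₁ μ₁ c₁ x := lt_of_le_of_ne (h.nonneg x) (Ne.symm hne)
  have hls : LowerSemicontinuous (effPotentialOne V₁ μ₁ c₁) := by
    have h1 := (h.isCharge hV).lowerSemicontinuous_potential.add
      (hV.contDiff.continuous.sub (continuous_const (y := c₁))).lowerSemicontinuous
    have e : effPotentialOne V₁ μ₁ c₁ = fun z => potential μ₁ z + (V₁ - fun _ : Space d => c₁ : Space d → ℝ) z := by
      funext z
      simp only [effPotentialOne, Pi.sub_apply]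
      ring
    rwa [e]
  have hev : ∀ᶠ z in 𝓝 x, 0 < effPotentialOne V₁ μ₁ c₁ z := hls x 0 hpos
  have h1 := (Measure.mem_support_iff_forall x).1 hx _ hev
  have h2 : μ₁ {z | 0 < effPotentialOne V₁ μ₁ c₁ z} = 0 :=
    measure_mono_null (fun z hz => (ne_of_gt hz : _ ≠ (0 : ℝ))) (ae_iff.1 h.ae_eq_zero)
  exact h1.ne' h2

/-! ### The Evans–Vasilesco continuity principle -/

/-- If x' is a point of the support nearest to x, then |x' - y| ≤ 2 |x - y| for every y in the
support. This estimate then bounds the potential at x by the one at x'. -/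
theorem exists_coulomb_doubling (d : ℕ) : ∃ K L : ℝ, 0 ≤ K ∧ 0 ≤ L ∧ ∀ a b : Space d, a ≠ 0 → b ≠ 0 →
    ‖b‖ ≤ 2 * ‖a‖ → coulomb a ≤ K * coulomb b + L := by
  by_cases hd : d = 2
  · refine ⟨1, Real.log 2, zero_le_one, Real.log_nonneg (by norm_num), fun a b ha hb hab => ?_⟩
    have h := Real.log_le_log (norm_pos_iff.2 hb) hab
    rw [Real.log_mul two_ne_zero (norm_ne_zero_iff.2 ha)] at h
    simp only [coulomb, if_pos hd]
    linarith
  · refine ⟨2 ^ (d - 2), 0, by positivity, le_rfl, fun a b ha hb hab => ?_⟩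
    have hb' := norm_pos_iff.2 hb
    have ha' := norm_pos_iff.2 ha
    simp only [coulomb, if_neg hd, add_zero]
    rw [← div_eq_mul_inv, inv_eq_one_div, div_le_div_iff₀ (by positivity) (by positivity), one_mul,
      ← mul_pow]
    exact pow_le_pow_left₀ hb'.le hab _

theorem IsCharge.tendsto_setIntegral_closedBall {d : ℕ} {ν : Measure (Space d)} (h : IsCharge ν)
    (x₀ : Space d) {f : Space d → ℝ} (hf : Integrable f ν) :
    Tendsto (fun n : ℕ => ∫ y in Metric.closedBall x₀ (1 / ((n : ℝ) + 1)), f y ∂ν) atTop (𝓝 0) := by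
  have hanti : Antitone fun n : ℕ => Metric.closedBall x₀ (1 / ((n : ℝ) + 1)) := fun m n hmn =>
    Metric.closedBall_subset_closedBall (one_div_le_one_div_of_le (by positivity)
      (by have : (m : ℝ) ≤ n := Nat.cast_le.2 hmn; linarith))
  have h1 := tendsto_setIntegral_of_antitone (μ := ν) (f := f)
    (fun n : ℕ => Metric.isClosed_closedBall.measurableSet) hanti ⟨0, hf.integrableOn⟩
  have h2 : ν (⋂ n : ℕ, Metric.closedBall x₀ (1 / ((n : ℝ) + 1))) = 0 := by
    refine measure_mono_null (fun y hy => ?_) (h.noAtom x₀)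
    rw [Set.mem_iInter] at hy
    have h3 : dist y x₀ ≤ 0 := ge_of_tendsto' tendsto_one_div_add_atTop_nhds_zero_nat
      fun n => Metric.mem_closedBall.1 (hy n)
    exact dist_le_zero.1 h3
  rwa [setIntegral_measure_zero _ h2] at h1

/-- Off the support the potential is harmonic. At a support point x₀, split off the charge in a
small ball B. The far part is continuous near x₀. The near part at x is controlled by K times its
value at the nearest support point x', plus L times the mass of B; on the support it equals q minus
the far part, hence is close to its value at x₀, which is small because there are no atoms. -/
theorem IsCharge.isRegularCharge_of_continuousOn_support {d : ℕ} (hd : 2 ≤ d)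
    {ν : Measure (Space d)} (h : IsCharge ν) {q : Space d → ℝ} (hq : Continuous q)
    (heq : ∀ x ∈ ν.support, potential ν x = q x) : IsRegularCharge ν := by
  have := h.isFinite
  refine ⟨h, continuous_iff_continuousAt.2 fun x₀ => ?_⟩
  by_cases hx₀ : x₀ ∈ ν.support
  swap
  · have hopen : IsOpen ν.supportᶜ := Measure.isClosed_support.isOpen_compl
    have := (h.harmonicOnNhd hd hopen Measure.measure_compl_support) x₀ hx₀
    exact this.1.continuousAt
  refine continuousAt_iff_lower_upperSemicontinuousAt.2
    ⟨h.lowerSemicontinuous_potential x₀, fun a ha => ?_⟩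
  obtain ⟨K, L, hK, hL, hdb⟩ := exists_coulomb_doubling d
  -- The errors below add up to at most (K + 2) ε, which leaves room for the strict inequality.
  set ε := (a - potential ν x₀) / (K + 3) with hε
  have hε0 : 0 < ε := div_pos (by linarith) (by linarith)
  have hεeq : (K + 3) * ε = a - potential ν x₀ := by rw [hε]; field_simp
  obtain ⟨n, hn⟩ := ((h.tendsto_setIntegral_closedBall x₀
    (((h.integrable x₀).const_mul K).add (integrable_const L))).eventually
      (gt_mem_nhds hε0)).exists
  set δ : ℝ := 1 / ((n : ℝ) + 1) with hδ
  have hδ0 : 0 < δ := by positivity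
  -- Radius at most 1 makes the kernel centred at x₀ nonnegative on B, also for the logarithm.
  have hδ1 : δ ≤ 1 := by
    rw [hδ, div_le_one (by positivity)]; linarith [Nat.cast_nonneg (α := ℝ) n]
  set B := Metric.closedBall x₀ δ with hB
  have hBm : MeasurableSet B := Metric.isClosed_closedBall.measurableSet
  have h1 : IsCharge (ν.restrict B) := h.mono Measure.restrict_le_self
  have h2 : IsCharge (ν.restrict Bᶜ) := h.mono Measure.restrict_le_self
  have hadd : ∀ x, potential ν x = potential (ν.restrict B) x + potential (ν.restrict Bᶜ) x :=
    fun x => by rw [← potential_add h1 h2, Measure.restrict_add_restrict_compl hBm]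
  have hcont : ContinuousAt (potential (ν.restrict Bᶜ)) x₀ := by
    have hz : (ν.restrict Bᶜ) (Metric.ball x₀ δ) = 0 := by
      rw [Measure.restrict_apply' hBm.compl]
      exact measure_mono_null (t := ∅)
        (fun y hy => hy.2 (Metric.ball_subset_closedBall hy.1)) (by simp)
    exact (h2.harmonicOnNhd hd Metric.isOpen_ball hz x₀ (Metric.mem_ball_self hδ0)).1.continuousAt
  have hnn : 0 ≤ potential (ν.restrict B) x₀ := by
    refine setIntegral_nonneg hBm fun y hy => ?_
    have h3 : ‖x₀ - y‖ ≤ 1 := by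
      rw [← dist_eq_norm, dist_comm]; exact (Metric.mem_closedBall.1 hy).trans hδ1
    have := neg_coulombLower_le h3
    simpa [coulombLower] using this
  have hsmall : K * potential (ν.restrict B) x₀ + L * (ν.restrict B).real Set.univ < ε := by
    have e : ∫ y in B, (K * coulomb (x₀ - y) + L) ∂ν = K * potential (ν.restrict B) x₀ +
        L * (ν.restrict B).real Set.univ := by
      rw [integral_add ((h1.integrable x₀).const_mul K) (integrable_const L), integral_const_mul,
        integral_const, smul_eq_mul, mul_comm L]
      rfl
    rw [← e]; exact hn
  have hq' : ContinuousAt (fun x => q x - potential (ν.restrict Bᶜ) x) x₀ :=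
    hq.continuousAt.sub hcont
  obtain ⟨η, hη, hηb⟩ := Metric.eventually_nhds_iff.1 (hq'.eventually
    (gt_mem_nhds (show q x₀ - potential (ν.restrict Bᶜ) x₀ <
      potential (ν.restrict B) x₀ + ε by rw [← heq x₀ hx₀, hadd x₀]; linarith)))
  filter_upwards [hcont.eventually (gt_mem_nhds (show potential (ν.restrict Bᶜ) x₀ <
    potential (ν.restrict Bᶜ) x₀ + ε by linarith)),
    Metric.ball_mem_nhds x₀ (half_pos hη)] with x hx1 hx2
  obtain ⟨x', hx's, hx'd⟩ := Measure.isClosed_support.exists_infDist_eq_dist ⟨x₀, hx₀⟩ x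
  have hd1 : dist x x' ≤ dist x x₀ := hx'd ▸ Metric.infDist_le_dist_of_mem hx₀
  have hd2 : dist x' x₀ < η := by
    have := dist_triangle x' x x₀
    rw [dist_comm x' x] at this
    have := Metric.mem_ball.1 hx2
    linarith
  have hb1 : potential (ν.restrict B) x' < potential (ν.restrict B) x₀ + ε := by
    have := hηb hd2
    rw [← heq x' hx's, hadd x'] at this
    linarith
  have hb2 : potential (ν.restrict B) x ≤ K * potential (ν.restrict B) x' +
      L * (ν.restrict B).real Set.univ := by
    have e : ∫ y in B, (K * coulomb (x' - y) + L) ∂ν = K * potential (ν.restrict B) x' +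
        L * (ν.restrict B).real Set.univ := by
      rw [integral_add ((h1.integrable x').const_mul K) (integrable_const L), integral_const_mul,
        integral_const, smul_eq_mul, mul_comm L]
      rfl
    rw [← e]
    refine integral_mono_ae (h1.integrable x) (((h1.integrable x').const_mul K).add
      (integrable_const L)) ?_
    filter_upwards [h1.ae_ne x, h1.ae_ne x', ae_restrict_of_ae
      (Measure.support_mem_ae : ν.support ∈ ae ν)] with y hy1 hy2 hy3
    refine hdb _ _ hy1 hy2 ?_
    rw [← dist_eq_norm, ← dist_eq_norm]
    have h3 : dist x x' ≤ dist x y := hx'd ▸ Metric.infDist_le_dist_of_mem hy3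
    have := dist_triangle x' x y
    rw [dist_comm x' x] at this
    linarith
  have hb3 : K * potential (ν.restrict B) x' ≤ K * (potential (ν.restrict B) x₀ + ε) :=
    mul_le_mul_of_nonneg_left hb1.le hK
  rw [hadd x]
  have := hadd x₀
  nlinarith

theorem IsEquilibriumMeasure.isRegularCharge {d : ℕ} (hd : 2 ≤ d) {V₁ : Space d → ℝ} {θ : ℝ}
    (hV : AdmissiblePotential V₁ θ) {μ₁ : Measure (Space d)} {c₁ : ℝ}
    (h : IsEquilibriumMeasure V₁ μ₁ c₁) : IsRegularCharge μ₁ := by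
  refine (h.isCharge hV).isRegularCharge_of_continuousOn_support hd
    (q := fun x => c₁ - V₁ x) (continuous_const.sub hV.contDiff.continuous) fun x hx => ?_
  have := h.eq_zero hV hx
  rw [effPotentialOne] at this
  linarith

/-! ### Rescaling -/

/-- For d = 2 the kernel scales by an additive constant, otherwise by the factor a = s^(2-d) with s
= N^(1/d). The product N a is the energy scale N^(2/d), and b ends up in the additive constant of ζ.
-/
theorem exists_coulomb_smul {d N : ℕ} (hd : 2 ≤ d) (hN : 1 ≤ N) : ∃ a b : ℝ,
    N * a = (N : ℝ) ^ ((2 : ℝ) / d) ∧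
    ∀ z : Space d, z ≠ 0 → coulomb ((N : ℝ) ^ ((1 : ℝ) / d) • z) = a * coulomb z + b := by
  have hN0 : (0 : ℝ) < N := by exact_mod_cast hN
  have hs : 0 < (N : ℝ) ^ ((1 : ℝ) / d) := Real.rpow_pos_of_pos hN0 _
  have hd0 : (d : ℝ) ≠ 0 := by positivity
  by_cases hd2 : d = 2
  · refine ⟨1, -Real.log ((N : ℝ) ^ ((1 : ℝ) / d)), by simp [hd2], fun z hz => ?_⟩
    simp only [coulomb, if_pos hd2]
    rw [norm_smul, Real.norm_of_nonneg hs.le, Real.log_mul hs.ne' (norm_ne_zero_iff.2 hz)]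
    ring
  · refine ⟨(((N : ℝ) ^ ((1 : ℝ) / d)) ^ (d - 2))⁻¹, 0, ?_, fun z hz => ?_⟩
    · rw [← Real.rpow_natCast, ← Real.rpow_mul hN0.le, ← div_eq_mul_inv, Nat.cast_sub hd]
      nth_rewrite 1 [← Real.rpow_one (N : ℝ)]
      rw [← Real.rpow_sub hN0]
      congr 1
      push_cast
      field_simp
      ring
    · simp only [coulomb, if_neg hd2, add_zero]
      rw [norm_smul, Real.norm_of_nonneg hs.le, mul_pow, mul_inv]

theorem IsRegularCharge.rescaleMeasure {d N : ℕ} (hd : 2 ≤ d) (hN : 1 ≤ N) {μ₁ : Measure (Space d)}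
    (h : IsRegularCharge μ₁) : IsRegularCharge (rescaleMeasure N μ₁) ∧ ∃ b : ℝ, ∀ x,
      potential (CoulombGas.rescaleMeasure N μ₁) x = (N : ℝ) ^ ((2 : ℝ) / d) *
        potential μ₁ (((N : ℝ) ^ ((1 : ℝ) / d))⁻¹ • x) + b := by
  have := h.isFinite
  have hN0 : (0 : ℝ) < N := by exact_mod_cast hN
  set s : ℝ := (N : ℝ) ^ ((1 : ℝ) / d) with hsd
  have hs : 0 < s := Real.rpow_pos_of_pos hN0 _
  obtain ⟨a, b, hab, hcs⟩ := exists_coulomb_smul (d := d) hd hN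
  rw [← hsd] at hcs
  have hemb : MeasurableEmbedding fun x : Space d => s • x :=
    (Homeomorph.smulOfNeZero s hs.ne').measurableEmbedding
  have hN' : (N : ℝ≥0∞) ≠ ⊤ := ENNReal.natCast_ne_top N
  -- The scaling law may fail at the singularity, which is null because μ₁ has no atoms.
  have hker : ∀ x, (fun y => coulomb (x - s • y)) =ᵐ[μ₁]
      fun y => a * coulomb (s⁻¹ • x - y) + b := fun x => by
    filter_upwards [h.ae_ne (s⁻¹ • x)] with y hy
    rw [← hcs _ hy, smul_sub, smul_inv_smul₀ hs.ne']
  have hint : ∀ x, Integrable (fun y => a * coulomb (s⁻¹ • x - y) + b) μ₁ := fun x =>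
    ((h.integrable (s⁻¹ • x)).const_mul a).add (integrable_const b)
  have hpot : ∀ x, potential (CoulombGas.rescaleMeasure N μ₁) x = (N : ℝ) ^ ((2 : ℝ) / d) *
        potential μ₁ (s⁻¹ • x) + N * (b * μ₁.real Set.univ) := fun x => by
    rw [potential, CoulombGas.rescaleMeasure, integral_smul_measure, hemb.integral_map,
      integral_congr_ae (hker x), integral_add ((h.integrable _).const_mul a) (integrable_const b),
      integral_const_mul, integral_const, ← hab]
    simp only [smul_eq_mul, ENNReal.toReal_natCast, potential]
    ring
  refine ⟨⟨⟨?_, ?_, ?_, ?_⟩, ?_⟩, _, hpot⟩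
  · exact ⟨by
      rw [CoulombGas.rescaleMeasure, Measure.smul_apply, smul_eq_mul]
      exact ENNReal.mul_lt_top hN'.lt_top (measure_lt_top _ _)⟩
  · obtain ⟨R, hR⟩ := h.compact
    refine ⟨s * R, ?_⟩
    rw [CoulombGas.rescaleMeasure, Measure.smul_apply, hemb.map_apply]
    have : (fun x : Space d => s • x) ⁻¹' (Metric.closedBall 0 (s * R))ᶜ ⊆
        (Metric.closedBall 0 R)ᶜ := fun x hx => by
      simp only [Set.mem_preimage, Set.mem_compl_iff, mem_closedBall_zero_iff, norm_smul,
        Real.norm_of_nonneg hs.le, mul_le_mul_iff_right₀ hs] at hx ⊢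
      exact hx
    rw [measure_mono_null this hR, smul_zero]
  · intro x
    rw [CoulombGas.rescaleMeasure, Measure.smul_apply, hemb.map_apply]
    have : (fun x : Space d => s • x) ⁻¹' {x} ⊆ {s⁻¹ • x} := fun z hz => by
      rw [Set.mem_singleton_iff, ← (hz : s • z = x), inv_smul_smul₀ hs.ne']
    rw [measure_mono_null this (h.noAtom _), smul_zero]
  · intro x
    rw [CoulombGas.rescaleMeasure]
    refine Integrable.smul_measure ?_ hN'
    rw [hemb.integrable_map_iff]
    exact (hint x).congr (hker x).symm
  · rw [funext hpot]
    have := h.continuous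
    fun_prop

theorem exists_effPotential_eq {d N : ℕ} (hd : 2 ≤ d) (hN : 1 ≤ N) {V₁ : Space d → ℝ} {θ : ℝ}
    (hV : AdmissiblePotential V₁ θ) {μ₁ : Measure (Space d)} {c₁ : ℝ}
    (h : IsEquilibriumMeasure V₁ μ₁ c₁) : IsRegularCharge (rescaleMeasure N μ₁) ∧
      ∃ c : ℝ, ∀ x, effPotential N V₁ μ₁ c₁ x =
        potential (rescaleMeasure N μ₁) x + rescale N V₁ x - c := by
  obtain ⟨h1, b, hb⟩ := (h.isRegularCharge hd hV).rescaleMeasure hd hN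
  refine ⟨h1, b + (N : ℝ) ^ ((2 : ℝ) / d) * c₁, fun x => ?_⟩
  rw [hb, effPotential, rescale, rescale, effPotentialOne]
  ring

theorem contDiff_rescale {d : ℕ} (N : ℕ) {f : Space d → ℝ} {n : WithTop ℕ∞} (hf : ContDiff ℝ n f) :
    ContDiff ℝ n (rescale N f) :=
  contDiff_const.mul (hf.comp (contDiff_const_smul _))

/-! ### From ball averages to distributional inequalities -/

/-- After Fubini the defect centred at y sees only |x - y| ≤ r. It is nonnegative off the centre, so
uniform continuity allows ψ(x) to be replaced by ψ(y) + ε. -/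
theorem integral_mul_coulombDefect_le {d : ℕ} (hd : 2 ≤ d) {μ : Measure (Space d)}
    [IsFiniteMeasure μ] {ψ : Space d → ℝ} (hψ : Continuous ψ) (hc : HasCompactSupport ψ)
    {ε : ℝ} (hε : 0 < ε) : ∀ᶠ r : ℝ in 𝓝[>] 0,
      Integrable (fun x => ψ x * ∫ y, coulombDefect r (x - y) ∂μ) ∧
      ∫ x, ψ x * ∫ y, coulombDefect r (x - y) ∂μ ≤
        (∫ y, ψ y ∂μ + ε * μ.real Set.univ) * ∫ z : Space d, coulombDefect r z := by
  have : Nontrivial (Space d) := Module.nontrivial_of_finrank_pos (R := ℝ) (by simp; omega)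
  obtain ⟨C, hC⟩ := hc.exists_bound_of_continuous hψ
  have huc := hc.uniformContinuous_of_continuous hψ
  obtain ⟨δ, hδ, hδu⟩ := Metric.uniformContinuous_iff.1 huc ε hε
  filter_upwards [Ioo_mem_nhdsGT hδ] with r hr
  have hD := integrable_coulombDefect hd hr.1
  have hDm := measurable_coulombDefect (d := d) r
  have hyint : ∀ y, Integrable fun x => ψ x * coulombDefect r (x - y) := fun y =>
    (hD.comp_sub_right y).bdd_mul (c := C) hψ.aestronglyMeasurable (Eventually.of_forall hC)
  have hprod : Integrable (fun p : Space d × Space d => ψ p.2 * coulombDefect r (p.2 - p.1))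
      (μ.prod volume) := by
    have hm : StronglyMeasurable fun p : Space d × Space d => ψ p.2 * coulombDefect r (p.2 - p.1) :=
      ((hψ.measurable.comp measurable_snd).mul
        (hDm.comp (measurable_snd.sub measurable_fst))).stronglyMeasurable
    rw [integrable_prod_iff hm.aestronglyMeasurable]
    refine ⟨Eventually.of_forall hyint, ?_⟩
    refine (integrable_const (C * ∫ z : Space d, ‖coulombDefect r z‖)).mono'
      hm.norm.integral_prod_right.aestronglyMeasurable (Eventually.of_forall fun y => ?_)
    rw [Real.norm_of_nonneg (integral_nonneg fun _ => norm_nonneg _)]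
    rw [← integral_sub_right_eq_self (fun z : Space d => ‖coulombDefect r z‖) y,
      ← integral_const_mul]
    refine integral_mono (hyint y).norm ((hD.norm.comp_sub_right y).const_mul C) fun x => ?_
    rw [norm_mul]
    exact mul_le_mul_of_nonneg_right (hC x) (norm_nonneg _)
  have hpull : ∀ x, ∫ y, ψ x * coulombDefect r (x - y) ∂μ =
      ψ x * ∫ y, coulombDefect r (x - y) ∂μ := fun x => integral_const_mul _ _
  refine ⟨hprod.integral_prod_right.congr (Eventually.of_forall hpull), ?_⟩
  have hψμ : Integrable ψ μ :=
    (integrable_const C).mono' hψ.aestronglyMeasurable (Eventually.of_forall hC)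
  calc ∫ x, ψ x * ∫ y, coulombDefect r (x - y) ∂μ
      = ∫ x, ∫ y, ψ x * coulombDefect r (x - y) ∂μ := by simp only [hpull]
    _ = ∫ y, (∫ x, ψ x * coulombDefect r (x - y)) ∂μ := (integral_integral_swap hprod).symm
    _ ≤ ∫ y, ((ψ y + ε) * ∫ z : Space d, coulombDefect r z) ∂μ := by
        refine integral_mono hprod.integral_prod_left ((hψμ.add (integrable_const ε)).mul_const _)
          fun y => ?_
        show ∫ x, ψ x * coulombDefect r (x - y) ≤ (ψ y + ε) * ∫ z : Space d, coulombDefect r z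
        rw [← integral_sub_right_eq_self (coulombDefect (d := d) r) y, ← integral_const_mul]
        refine integral_mono_ae (hyint y) ((hD.comp_sub_right y).const_mul _) ?_
        filter_upwards [compl_mem_ae_iff.2 (measure_singleton y)] with x hx
        rcases lt_or_ge r ‖x - y‖ with h | h
        · rw [coulombDefect_eq_zero hd hr.1 h, mul_zero, mul_zero]
        · refine mul_le_mul_of_nonneg_right ?_ (coulombDefect_nonneg hd hr.1 (sub_ne_zero.2 hx))
          have h1 := hδu (show dist x y < δ by rw [dist_eq_norm]; exact h.trans_lt hr.2)
          rw [Real.dist_eq] at h1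
          linarith [(abs_lt.1 h1).2]
    _ = _ := by
        rw [integral_mul_const, integral_add hψμ (integrable_const ε), integral_const, smul_eq_mul,
          mul_comm ε]

/-- The exponential bound is linearized to an estimate of f minus its ball average by β f times the
defect integral. Pair it with φ ≥ 0, move the average onto φ by symmetry, divide by r² and let r →
0: both sides acquire the factor `ballConst d`, which cancels. -/
theorem negLaplacianLE_of_le_ballAvg {d : ℕ} (hd : 2 ≤ d) {μ : Measure (Space d)}
    [IsFiniteMeasure μ] {β : ℝ} (hβ : 0 < β) {f : Space d → ℝ} (hf : Continuous f)
    (h0 : ∀ x, 0 ≤ f x)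
    (h : ∀ x r, 0 < r → f x ≤ Real.exp (β * ∫ y, coulombDefect r (x - y) ∂μ) * ballAvg r f x) :
    NegLaplacianLE f (fun x => β * coulombConst d * f x) μ := by
  refine ⟨hf.locallyIntegrable, (continuous_const.mul hf).locallyIntegrable,
    fun φ hφ hφc hφ0 => ?_⟩
  have hpt : ∀ x r, 0 < r → f x - ballAvg r f x ≤ β * (f x * ∫ y, coulombDefect r (x - y) ∂μ) := by
    intro x r hr
    set a := ∫ y, coulombDefect r (x - y) ∂μ
    have h1 : Real.exp (-(β * a)) * f x ≤ ballAvg r f x := by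
      have := mul_le_mul_of_nonneg_left (h x r hr) (Real.exp_pos (-(β * a))).le
      rwa [← mul_assoc, ← Real.exp_add, neg_add_cancel, Real.exp_zero, one_mul] at this
    -- Linearization by exp(-t) ≥ 1 - t with t = β a.
    have h2 := mul_le_mul_of_nonneg_right (Real.add_one_le_exp (-(β * a))) (h0 x)
    linarith
  set ψ : Space d → ℝ := fun x => φ x * f x with hψ
  have hψc : Continuous ψ := hφ.continuous.mul hf
  have hψs : HasCompactSupport ψ := hφc.mul_right
  have hφ2 : ContDiff ℝ 2 φ := contDiff_infty.1 hφ 2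
  have key : ∀ ε > 0, -∫ x, f x * Laplacian.laplacian φ x ≤
      β * coulombConst d * (∫ y, ψ y ∂μ + ε * μ.real Set.univ) := by
    intro ε hε
    have l1 := (tendsto_integral_mul_ballAvg_sub hf.locallyIntegrable hf.measurable hφ2 hφc).neg
    have l2 := (tendsto_integral_coulombDefect hd).const_mul
      (β * (∫ y, ψ y ∂μ + ε * μ.real Set.univ))
    have hle := le_of_tendsto_of_tendsto l1 l2 (by
      filter_upwards [integral_mul_coulombDefect_le hd (μ := μ) hψc hψs hε, self_mem_nhdsWithin]
        with r hr hr0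
      have hr0' : 0 < r := hr0
      obtain ⟨i1, i2, e⟩ := integral_mul_ballAvg hf.locallyIntegrable hf.measurable hφ.continuous
        hφc r
      have i3 : Integrable fun x => f x * φ x :=
        (hf.mul hφ.continuous).integrable_of_hasCompactSupport hφc.mul_left
      have e1 : ∫ x, f x * (ballAvg r φ x - φ x) = ∫ x, (ballAvg r f x * φ x - f x * φ x) := by
        simp only [mul_sub]
        rw [integral_sub i1 i3, integral_sub i2 i3, e]
      have e2 : -∫ x, f x * (ballAvg r φ x - φ x) ≤
          β * ∫ x, ψ x * ∫ y, coulombDefect r (x - y) ∂μ := by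
        rw [e1, ← integral_neg, ← integral_const_mul]
        refine integral_mono (i2.sub i3).neg (hr.1.const_mul β) fun x => ?_
        have := mul_le_mul_of_nonneg_right (hpt x r hr0') (hφ0 x)
        simp only [hψ]
        linarith
      have e3 := mul_le_mul_of_nonneg_left (e2.trans (mul_le_mul_of_nonneg_left hr.2 hβ.le))
        (show 0 ≤ (r ^ 2)⁻¹ by positivity)
      linarith)
    have hb := ballConst_pos d
    refine le_of_mul_le_mul_left ?_ hb
    linarith
  have hlim : Tendsto (fun ε : ℝ => β * coulombConst d * (∫ y, ψ y ∂μ + ε * μ.real Set.univ))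
      (𝓝[>] 0) (𝓝 (β * coulombConst d * (∫ y, ψ y ∂μ + 0 * μ.real Set.univ))) := by
    refine Tendsto.mono_left ?_ nhdsWithin_le_nhds
    exact Continuous.tendsto (by fun_prop) 0
  have hfin := ge_of_tendsto hlim (by filter_upwards [self_mem_nhdsWithin] with ε hε using key ε hε)
  refine hfin.trans (le_of_eq ?_)
  rw [zero_mul, add_zero, ← integral_const_mul]
  congr 1; ext x; simp only [hψ]; ring

theorem subharmonicOn_of_le_ballAvg {d : ℕ} (hd : 2 ≤ d) {μ : Measure (Space d)}
    {β : ℝ} {f : Space d → ℝ} (hf : Continuous f)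
    (h : ∀ x r, 0 < r → f x ≤ Real.exp (β * ∫ y, coulombDefect r (x - y) ∂μ) * ballAvg r f x) :
    SubharmonicOn f μ.supportᶜ := by
  refine ⟨Measure.isClosed_support.isOpen_compl,
    hf.upperSemicontinuous.upperSemicontinuousOn _, fun x r hr hsub => ⟨?_, ?_⟩⟩
  · exact (hf.continuousOn.integrableOn_compact (isCompact_closedBall x r)).mono_set
      Metric.ball_subset_closedBall
  · rw [← ballAvg_eq_average f x hr]
    -- The closed ball misses the support, so every charge lies beyond distance r, where the defect
    -- vanishes.
    have h0 : ∫ y, coulombDefect r (x - y) ∂μ = 0 := by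
      refine integral_eq_zero_of_ae ?_
      filter_upwards [(Measure.support_mem_ae : μ.support ∈ ae μ)] with y hy
      refine coulombDefect_eq_zero hd hr (not_le.1 fun hle => ?_)
      refine hsub (Metric.mem_closedBall.2 ?_) hy
      rwa [dist_comm, dist_eq_norm]
    simpa [h0] using h x r hr

theorem IsRegularCharge.potential_sub_ballAvg {d : ℕ} (hd : 2 ≤ d) {μ : Measure (Space d)}
    (h : IsRegularCharge μ) (x : Space d) {r : ℝ} (hr : 0 < r) :
    potential μ x - ballAvg r (potential μ) x = ∫ y, coulombDefect r (x - y) ∂μ := by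
  have hm := isSuperAveraging_ballMeasure hd x hr
  have := hm.isProbabilityMeasure
  obtain ⟨R, hR⟩ := hm.compact
  obtain ⟨h1, h2⟩ := h.integral_potential hR
  have e : ∀ y, ∫ z, coulomb (z - y) ∂(ballMeasure x r) = ballAvg r coulomb (x - y) := fun y => by
    rw [integral_ballMeasure x hr, ballAvg_comp_sub]
  simp only [e] at h1 h2
  rw [← integral_ballMeasure x hr, h2, potential, ← integral_sub (h.integrable x) h1]
  rfl

/-- Here the exponent ζ - V is the potential of μ minus the constant c. The constant cancels between
the value at x and its average, leaving exactly the defect integral of μ. -/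
theorem IsInsertionDensity.le_ballAvg {d n N : ℕ} (hd : 2 ≤ d) (hn : n + 1 ≤ N) {β : ℝ}
    (hβ : 0 < β) {V ζ : Space d → ℝ} (hV : Continuous V) {μ : Measure (Space d)}
    (hμ : IsRegularCharge μ) {c : ℝ} (hζ : ∀ x, ζ x = potential μ x + V x - c)
    {y : Fin n → Space d} {F : Space d → ℝ≥0∞} (hF : IsInsertionDensity N β V y F)
    (x : Space d) {r : ℝ} (hr : 0 < r) :
    Real.exp (β * ζ x) * (F x).toReal ≤ Real.exp (β * ∫ y, coulombDefect r (x - y) ∂μ) *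
      ballAvg r (fun z => Real.exp (β * ζ z) * (F z).toReal) x := by
  obtain ⟨hFc, hFt⟩ := hF.continuous hd hn hβ hV
  have hζc : Continuous ζ := by
    rw [funext hζ]; exact (hμ.continuous.add hV).sub continuous_const
  have hfc : Continuous fun z => Real.exp (β * ζ z) * (F z).toReal := by
    refine Continuous.mul (by fun_prop) (continuous_iff_continuousAt.2 fun z => ?_)
    exact (ENNReal.tendsto_toReal (hFt z)).comp hFc.continuousAt
  have hm := isSuperAveraging_ballMeasure hd x hr
  have := hm.isProbabilityMeasure
  have hU : ∀ z, ζ z - V z - ∑ i ∈ (∅ : Finset (Fin n)), coulomb (z - y i) = potential μ z - c :=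
    fun z => by rw [hζ, Finset.sum_empty]; ring
  have hUc : Continuous fun z => potential μ z - c := hμ.continuous.sub continuous_const
  obtain ⟨M, hM⟩ := (isCompact_closedBall x r).exists_bound_of_continuousOn hUc.continuousOn
  have h := hF.exp_mul_le hd hn hβ hV.measurable hζc.measurable hm ∅ (C := M) (by
    filter_upwards [ae_mem_ballMeasure x hr] with z hz
    rw [hU]; exact hM z (Metric.ball_subset_closedBall hz)) (by simp) (by simp)
  have hof : ∀ z, ENNReal.ofReal (Real.exp (β * ζ z)) * F z =
      ENNReal.ofReal (Real.exp (β * ζ z) * (F z).toReal) := fun z => by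
    rw [ENNReal.ofReal_mul (Real.exp_pos _).le, ENNReal.ofReal_toReal (hFt z)]
  have hnn : ∀ z, 0 ≤ Real.exp (β * ζ z) * (F z).toReal := fun z => by positivity
  simp only [hU, hof] at h
  rw [← ofReal_integral_eq_lintegral_ofReal (hm.integrable hfc) (Eventually.of_forall hnn),
    ← ENNReal.ofReal_mul (Real.exp_pos _).le, ENNReal.ofReal_le_ofReal_iff
      (mul_nonneg (Real.exp_pos _).le (integral_nonneg hnn)),
    integral_sub (hm.integrable hμ.continuous) (integrable_const c), integral_const,
    integral_ballMeasure x hr, integral_ballMeasure x hr] at h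
  rw [← hμ.potential_sub_ballAvg hd x hr]
  refine h.trans (le_of_eq ?_)
  congr 3
  simp

theorem IsInsertionDensity.negLaplacianLE_and_subharmonicOn {d n N : ℕ} (hd : 2 ≤ d)
    (hn : n + 1 ≤ N) {β : ℝ} (hβ : 0 < β) {V ζ : Space d → ℝ} (hV : Continuous V)
    {μ : Measure (Space d)} (hμ : IsRegularCharge μ) {c : ℝ}
    (hζ : ∀ x, ζ x = potential μ x + V x - c)
    {y : Fin n → Space d} {F : Space d → ℝ≥0∞} (hF : IsInsertionDensity N β V y F) :
    NegLaplacianLE (fun x => Real.exp (β * ζ x) * (F x).toReal)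
        (fun x => β * coulombConst d * (Real.exp (β * ζ x) * (F x).toReal)) μ ∧
      SubharmonicOn (fun x => Real.exp (β * ζ x) * (F x).toReal) μ.supportᶜ := by
  have := hμ.isFinite
  obtain ⟨hFc, hFt⟩ := hF.continuous hd hn hβ hV
  have hζc : Continuous ζ := by
    rw [funext hζ]; exact (hμ.continuous.add hV).sub continuous_const
  have hfc : Continuous fun z => Real.exp (β * ζ z) * (F z).toReal := by
    refine Continuous.mul (by fun_prop) (continuous_iff_continuousAt.2 fun z => ?_)
    exact (ENNReal.tendsto_toReal (hFt z)).comp hFc.continuousAt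
  have h := fun x r (hr : 0 < r) => hF.le_ballAvg hd hn hβ hV hμ hζ x hr
  exact ⟨negLaplacianLE_of_le_ballAvg hd hβ hfc (fun x => by positivity) h,
    subharmonicOn_of_le_ballAvg hd hfc h⟩

/-! ### Harmonic measure inequalities -/

open scoped Classical in
theorem IsHarmonicMeasureAt.dirichletPotentialPoints_eq {d n : ℕ} {Ω : Set (Space d)}
    (hΩ : IsRegularDomain Ω) {x : Space d} (hx : x ∈ Ω) {m : Measure (Space d)}
    (hm : IsHarmonicMeasureAt Ω x m) (y : Fin n → Space d) :
    dirichletPotentialPoints Ω y x = ∑ i with y i ∈ Ω,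
      (coulomb (x - y i) - ∫ z, coulomb (z - y i) ∂m) := by
  rw [dirichletPotentialPoints, Finset.sum_filter]
  refine Finset.sum_congr rfl fun i _ => ?_
  rw [dirichletPotential, if_pos hx, setIntegral_dirac]
  split_ifs with hi
  · rw [hm.green_eq hΩ hi, Pi.one_apply, mul_one]
  · rfl

/-- For a conditioning charge inside Ω, the kernel at x minus its boundary average is the Green's
function. Taking S to be these charges gives the negative point-charge term; charges outside Ω are
only super-averaged. -/
theorem IsInsertionDensity.le_lintegral_harmonic {d n N : ℕ} (hd : 2 ≤ d) (hn : n + 1 ≤ N) {β : ℝ}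
    (hβ : 0 < β) {V φ : Space d → ℝ} (hV : Continuous V) (hφ : Continuous φ)
    {y : Fin n → Space d} {F : Space d → ℝ≥0∞} (hF : IsInsertionDensity N β V y F)
    {Ω : Set (Space d)} (hΩ : IsRegularDomain Ω) {x : Space d} (hx : x ∈ Ω)
    {m : Measure (Space d)} (hm : IsHarmonicMeasureAt Ω x m) :
    ENNReal.ofReal (Real.exp (β * φ x)) * F x ≤
      ENNReal.ofReal (Real.exp (β * ((φ x - V x) - ∫ z, (φ z - V z) ∂m -
        dirichletPotentialPoints Ω y x))) *
      ∫⁻ z, ENNReal.ofReal (Real.exp (β * φ z)) * F z ∂m := by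
  classical
  by_cases hxy : ∃ i, x = y i
  · obtain ⟨i, rfl⟩ := hxy
    rw [hF.eq_zero hn i, mul_zero]
    exact zero_le
  push Not at hxy
  have hcS : ∀ i, y i ∈ Ω → ContinuousOn (fun z => coulomb (z - y i)) (frontier Ω) :=
    fun i hi => continuousOn_coulomb_sub hΩ.isOpen hi
  have hsum : ContinuousOn (fun z => ∑ i with y i ∈ Ω, coulomb (z - y i)) (frontier Ω) :=
    continuousOn_finsetSum _ fun i hi => hcS i (Finset.mem_filter.1 hi).2
  have hU : ContinuousOn (fun z => φ z - V z - ∑ i with y i ∈ Ω, coulomb (z - y i))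
      (frontier Ω) := (hφ.sub hV).continuousOn.sub hsum
  obtain ⟨C, hC⟩ := (hΩ.isBounded.isCompact_closure.of_isClosed_subset isClosed_frontier
    frontier_subset_closure).exists_bound_of_continuousOn hU
  have h := hF.exp_mul_le hd hn hβ hV.measurable hφ.measurable (hm.isSuperAveraging hd hΩ hx)
    {i | y i ∈ Ω} (C := C) (hm.ae_mem_frontier.mono hC) (fun i _ => hxy i)
    -- Harmonic measure lives on the boundary, which is disjoint from the open set Ω containing the
    -- charges of S.
    (hm.ae_mem_frontier.mono fun z hz i hi h => by
      rw [frontier, hΩ.isOpen.interior_eq] at hz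
      exact hz.2 (h ▸ (Finset.mem_filter.1 hi).2))
  refine h.trans (le_of_eq ?_)
  have hint := fun {f : Space d → ℝ} (hf : ContinuousOn f (frontier Ω)) =>
    hm.integrable hΩ.isBounded hf
  rw [integral_sub (f := fun z => φ z - V z) (hint (hφ.sub hV).continuousOn) (hint hsum),
    integral_finsetSum _ fun i hi => hint (hcS i (Finset.mem_filter.1 hi).2),
    hm.dirichletPotentialPoints_eq hΩ hx, Finset.sum_sub_distrib]
  congr 4
  ring

/-- Both bounds are instances of `IsInsertionDensity.le_lintegral_harmonic`. With φ = ζ the exponent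
φ - V is the potential of μ minus c; with φ = 0 it is -V. A Riesz decomposition converts each into a
Dirichlet potential. -/
theorem IsInsertionDensity.harmonicMeasure_le {d n N : ℕ} (hd : 2 ≤ d)
    (hn : n + 1 ≤ N) {β : ℝ} (hβ : 0 < β) {V ζ : Space d → ℝ} (hV : ContDiff ℝ 2 V)
    {μ : Measure (Space d)} (hμ : IsRegularCharge μ) {c : ℝ}
    (hζ : ∀ x, ζ x = potential μ x + V x - c)
    {y : Fin n → Space d} {F : Space d → ℝ≥0∞} (hF : IsInsertionDensity N β V y F)
    {Ω : Set (Space d)} (hΩ : IsRegularDomain Ω) (x : Space d) :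
    (ENNReal.ofReal (Real.exp (β * ζ x)) * F x ≤
      ENNReal.ofReal (Real.exp (β *
          (dirichletPotential Ω μ 1 x - dirichletPotentialPoints Ω y x))) *
        ∫⁻ z, ENNReal.ofReal (Real.exp (β * ζ z)) * F z ∂(harmonicMeasure Ω x)) ∧
    (F x ≤ ENNReal.ofReal (Real.exp (β *
          (dirichletPotential Ω volume
              (fun z => (coulombConst d)⁻¹ * Laplacian.laplacian V z) x -
            dirichletPotentialPoints Ω y x))) *
        ∫⁻ z, F z ∂(harmonicMeasure Ω x)) := by
  by_cases hx : x ∈ Ω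
  swap
  -- Outside Ω all Dirichlet potentials vanish and harmonic measure is the Dirac mass at x, so both
  -- bounds are equalities.
  · simp [dirichletPotentialPoints, dirichletPotential, harmonicMeasure, hx]
  have hm := hΩ.isHarmonicMeasureAt hx
  have := hm.isProbabilityMeasure
  have hζc : Continuous ζ := by
    rw [funext hζ]; exact (hμ.continuous.add hV.continuous).sub continuous_const
  constructor
  · refine (hF.le_lintegral_harmonic hd hn hβ hV.continuous hζc hΩ hx hm).trans (le_of_eq ?_)
    have hU : ∀ z, ζ z - V z = potential μ z - c := fun z => by rw [hζ]; ring
    have e : dirichletPotential Ω μ 1 x =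
        potential μ x - ∫ z, potential μ z ∂(harmonicMeasure Ω x) := by
      rw [← (hμ.integral_green hd hΩ hm).2, dirichletPotential, if_pos hx]
      simp
    simp only [hU]
    rw [e, integral_sub (hm.integrable hΩ.isBounded hμ.continuous.continuousOn)
      (integrable_const c), integral_const]
    congr 4
    simp
  · have h := hF.le_lintegral_harmonic (φ := fun _ => 0) hd hn hβ hV.continuous continuous_const
      hΩ hx hm
    simp only [mul_zero, Real.exp_zero, ENNReal.ofReal_one, one_mul, zero_sub,
      integral_neg, sub_neg_eq_add] at h
    rwa [dirichletPotential_laplacian hd hΩ hx hm hV]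

end CoulombGas

/-! ### Assembly of the theorem -/

theorem theoremt (d : ℕ) (hd : 2 ≤ d) (N : ℕ) (hN : 1 ≤ N) (β θ : ℝ) (hθ : 2 < θ)
    (hβ : θ ≤ β * (N : ℝ) ^ ((2 : ℝ) / d))
    (V₁ : Space d → ℝ) (hV : AdmissiblePotential V₁ θ)
    (μ₁ : Measure (Space d)) (c₁ : ℝ) (hμ : IsEquilibriumMeasure V₁ μ₁ c₁)
    (V ζ : Space d → ℝ) (hVN : V = rescale N V₁) (hζ : ζ = effPotential N V₁ μ₁ c₁)
    (μ : Measure (Space d)) (hμN : μ = rescaleMeasure N μ₁) :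
    (NegLaplacianLE (fun x => Real.exp (β * ζ x) * (onePoint N β V x).toReal)
        (fun x => β * coulombConst d * (Real.exp (β * ζ x) * (onePoint N β V x).toReal)) μ ∧
      SubharmonicOn (fun x => Real.exp (β * ζ x) * (onePoint N β V x).toReal) μ.supportᶜ) ∧
    ∀ (m : ℕ) (hm : m + 1 ≤ N), ∀ᵐ y ∂(marginal N β V (Nat.le_of_succ_le hm)),
      (NegLaplacianLE (fun x => Real.exp (β * ζ x) * (condOnePoint N β V y x).toReal)
          (fun x => β * coulombConst d *
            (Real.exp (β * ζ x) * (condOnePoint N β V y x).toReal)) μ ∧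
        SubharmonicOn (fun x => Real.exp (β * ζ x) * (condOnePoint N β V y x).toReal)
          μ.supportᶜ) ∧
      ∀ Ω : Set (Space d), IsRegularDomain Ω → ∀ x : Space d,
        (ENNReal.ofReal (Real.exp (β * ζ x)) * condOnePoint N β V y x ≤
          ENNReal.ofReal (Real.exp (β *
              (dirichletPotential Ω μ 1 x - dirichletPotentialPoints Ω y x))) *
            ∫⁻ z, ENNReal.ofReal (Real.exp (β * ζ z)) * condOnePoint N β V y z
              ∂(harmonicMeasure Ω x)) ∧
        (condOnePoint N β V y x ≤
          ENNReal.ofReal (Real.exp (β *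
              (dirichletPotential Ω volume
                  (fun z => (coulombConst d)⁻¹ * Laplacian.laplacian V z) x -
                dirichletPotentialPoints Ω y x))) *
            ∫⁻ z, condOnePoint N β V y z ∂(harmonicMeasure Ω x)) := by
  have hNpos : (0 : ℝ) < (N : ℝ) ^ ((2 : ℝ) / d) :=
    Real.rpow_pos_of_pos (by exact_mod_cast hN) _
  have hβ0 : 0 < β := pos_of_mul_pos_left (by linarith) hNpos.le
  obtain ⟨hreg, c, hc⟩ := exists_effPotential_eq hd hN hV hμ
  rw [← hμN, ← hζ, ← hVN] at hc
  rw [← hμN] at hreg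
  have hVc : ContDiff ℝ 2 V := hVN ▸ contDiff_rescale N hV.contDiff
  refine ⟨(isInsertionDensity_onePoint hd hN β hVc.continuous.measurable
    ).negLaplacianLE_and_subharmonicOn hd hN hβ0 hVc.continuous hreg hc, fun m hm => ?_⟩
  filter_upwards [ae_isInsertionDensity_condOnePoint hd hm β hVc.continuous.measurable] with y hy
  exact ⟨hy.negLaplacianLE_and_subharmonicOn hd hm hβ0 hVc.continuous hreg hc,
    fun Ω hΩ x => hy.harmonicMeasure_le hd hm hβ0 hVc hreg hc hΩ x⟩
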